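/- Let $V:\mathbb{R}\to[0,\infty)$ be a measurable function such that, for some $\delta,L>0$, $V(\lambda)\ge(2+\delta)\log|\lambda|$ for all $|\lambda|>L$, and such that for every $R>0$ there are $A,\gamma>0$ with $|V(\lambda_1)-V(\lambda_2)|\le A|\lambda_1-\lambda_2|^{\gamma}$ whenever $|\lambda_1|,|\lambda_2|\le R$. For $n\ge1$ let $\mathbf{P}_n(dM)=Z_n^{-1}\exp\{-n\,\mathrm{Tr}\,V(M)\}\,dM$ be the probability law on $n\times n$ Hermitian matrices, where $dM=\prod_{j}dM_{jj}\prod_{j<k}d\Re M_{jk}\,d\Im M_{jk}$. For $\varphi:\mathbb{R}\to\mathbb{C}$ let $\mathcal{N}_n[\varphi]=\sum_{l=1}^n\varphi(\lambda_l)$, where $\lambda_1,\dots,\lambda_n$ are the eigenvalues of $M$, and let $\mathbf{Var}\{X\}=\mathbf{E}\{|X-\mathbf{E}X|^2\}$ with respect to $\mathbf{P}_n$. Call $n\ge1$ admissible if $\int_{\mathbb{R}}\lambda^{2n}e^{-nV(\lambda)}\,d\lambda<\infty$. Every $n\geq 1$ with $n\delta>1$ is admissible. If $n$ is admissible, then $\mathbf{P}_n$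 is a well-defined probability law, the polynomials $P_l^{(n)}$, $0\le l\le n$, of degree $l$ with positive leading coefficient and orthonormal with respect to the weight $e^{-nV}$ exist, and with $\psi_l^{(n)}=e^{-nV/2}P_l^{(n)}$, $r_l^{(n)}=\int_{\mathbb{R}}\lambda\,\psi_l^{(n)}(\lambda)\psi_{l+1}^{(n)}(\lambda)\,d\lambda$, $s_l^{(n)}=\int_{\mathbb{R}}\lambda\,\psi_l^{(n)}(\lambda)^2\,d\lambda$, $r_{-1}^{(n)}=0$, they satisfy $$r_l^{(n)}\psi_{l+1}^{(n)}(\lambda)+s_l^{(n)}\psi_l^{(n)}(\lambda)+r_{l-1}^{(n)}\psi_{l-1}^{(n)}(\lambda)=\lambda\psi_l^{(n)}(\lambda),\qquad 0\le l<n,\ \lambda\in\mathbb{R}.$$ Moreover there is a constant $K$, depending only on $V$, such that for every admissible $n$ one has $(r_{n-1}^{(n)})^2\le K$, and for every $\varphi:\mathbb{R}\to\mathbb{C}$ of class $C^1$ with $\sup_{\lambda\in\mathbb{R}}|\varphi'(\lambda)|<\infty$ the random variable $\mathcal{N}_n[\varphi]$ is square integrable and $$\mathbf{Var}\{\mathcal{N}_n[\varphi]\}\le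 (r_{n-1}^{(n)})^2\Big(\sup_{\lambda\in\mathbb{R}}|\varphi'(\lambda)|\Big)^2,\qquad \mathbf{Var}\{\mathcal{N}_n[\varphi]\}\le K\Big(\sup_{\lambda\in\mathbb{R}}|\varphi'(\lambda)|\Big)^2 .$$ -/

import Mathlib

open MeasureTheory Polynomial

noncomputable section

namespace MatrixModel

/-! ### The matrix model -/

/-- The space of `n × n` Hermitian matrices. -/
abbrev HermMat (n : ℕ) : Type := {M : Matrix (Fin n) (Fin n) ℂ // M.IsHermitian}

/-- Hermitian matrices carry the Borel σ-algebra of the entrywise topology. -/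
instance instMeasurableSpaceHermMat (n : ℕ) : MeasurableSpace (HermMat n) := borel (HermMat n)

instance instBorelSpaceHermMat (n : ℕ) : BorelSpace (HermMat n) := ⟨rfl⟩

/-- The independent entries of an `n × n` Hermitian matrix: the real diagonal entries, and the
complex entries strictly above the diagonal. -/
abbrev Coords (n : ℕ) : Type := (Fin n → ℝ) × ({p : Fin n × Fin n // p.1 < p.2} → ℂ)

/-- The matrix with entries `M j j = x.1 j`, `M j k = x.2 (j, k)` for `j < k`, and
`M j k = conj (M k j)` for `k < j`. -/
def matrixOfCoords {n : ℕ} (x : Coords n) : Matrix (Fin n) (Fin n) ℂ := fun j k =>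
  if h : j < k then x.2 ⟨(j, k), h⟩
  else if h : k < j then star (x.2 ⟨(k, j), h⟩)
  else ((x.1 j : ℝ) : ℂ)

theorem isHermitian_matrixOfCoords {n : ℕ} (x : Coords n) : (matrixOfCoords x).IsHermitian := by
  ext j k
  rcases lt_trichotomy j k with h | h | h
  · simp [matrixOfCoords, h, h.not_gt]
  · subst h
    simp [matrixOfCoords]
  · simp [matrixOfCoords, h, h.not_gt]

/-- The Hermitian matrix with the given independent entries. -/
def hermOfCoords {n : ℕ} (x : Coords n) : HermMat n :=
  ⟨matrixOfCoords x, isHermitian_matrixOfCoords x⟩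

/-- The measure `dM = ∏ⱼ dMⱼⱼ ∏_{j<k} d(Re Mⱼₖ) d(Im Mⱼₖ)` on Hermitian matrices. -/
def hermVolume (n : ℕ) : Measure (HermMat n) :=
  Measure.map hermOfCoords (volume : Measure (Coords n))

/-- The eigenvalues of a Hermitian matrix, with multiplicities. -/
def eig {n : ℕ} (M : HermMat n) : Fin n → ℝ := M.2.eigenvalues

/-- `Tr V(M) = ∑ₗ V(λₗ)`. -/
def traceFun {n : ℕ} (V : ℝ → ℝ) (M : HermMat n) : ℝ := ∑ l, V (eig M l)

/-- The linear eigenvalue statistic `𝒩ₙ[φ] = ∑ₗ φ(λₗ)`. -/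
def linearStatistic {n : ℕ} (φ : ℝ → ℂ) (M : HermMat n) : ℂ := ∑ l, φ (eig M l)

/-- The unitary invariant matrix model `Zₙ⁻¹ exp (-n Tr V(M)) dM` with potential `V`. -/
def matrixLaw (V : ℝ → ℝ) (n : ℕ) : Measure (HermMat n) :=
  (hermVolume n).tilted fun M => -((n : ℝ) * traceFun V M)

/-- The variance `E |X - E X|²` of a complex random variable (for square integrable `X`). -/
def complexVariance {Ω : Type*} [MeasurableSpace Ω] (X : Ω → ℂ) (P : Measure Ω) : ℝ :=
  ∫ ω, ‖X ω - ∫ ω', X ω' ∂P‖ ^ 2 ∂P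

/-! ### Orthonormal polynomials with respect to `exp (-n V)` -/

/-- The weight `wₙ = exp (-n V)`. -/
def weight (V : ℝ → ℝ) (n : ℕ) (x : ℝ) : ℝ := Real.exp (-((n : ℝ) * V x))

/-- The inner product of two polynomials in `L²(wₙ(x) dx)`. -/
def weightInner (V : ℝ → ℝ) (n : ℕ) (p q : ℝ[X]) : ℝ :=
  ∫ x, weight V n x * p.eval x * q.eval x

/-- The monic orthogonal polynomials for the weight `wₙ`: Gram–Schmidt applied to the monomials. -/
def monicOrthoPoly (V : ℝ → ℝ) (n : ℕ) : ℕ → ℝ[X]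
  | l => X ^ l - ∑ k : Fin l,
      C (weightInner V n (X ^ l) (monicOrthoPoly V n k) /
        weightInner V n (monicOrthoPoly V n k) (monicOrthoPoly V n k)) * monicOrthoPoly V n k
  termination_by l => l
  decreasing_by all_goals exact k.isLt

/-- The orthonormal polynomials `Pₗ⁽ⁿ⁾`. -/
def orthoPoly (V : ℝ → ℝ) (n l : ℕ) : ℝ[X] :=
  C (1 / Real.sqrt (weightInner V n (monicOrthoPoly V n l) (monicOrthoPoly V n l))) *
    monicOrthoPoly V n l

/-- The orthonormal functions `ψₗ⁽ⁿ⁾ = exp (-n V / 2) Pₗ⁽ⁿ⁾`. -/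
def psi (V : ℝ → ℝ) (n l : ℕ) (x : ℝ) : ℝ :=
  Real.exp (-((n : ℝ) * V x / 2)) * (orthoPoly V n l).eval x

/-- The off-diagonal recurrence coefficients `rₗ⁽ⁿ⁾`, i.e. the entries `(l, l + 1)` of the Jacobi
matrix of multiplication by `x` in the basis `ψ₀⁽ⁿ⁾, ψ₁⁽ⁿ⁾, …`. -/
def recR (V : ℝ → ℝ) (n l : ℕ) : ℝ := ∫ x, x * psi V n l x * psi V n (l + 1) x

/-- The diagonal recurrence coefficients `sₗ⁽ⁿ⁾`. -/
def recS (V : ℝ → ℝ) (n l : ℕ) : ℝ := ∫ x, x * psi V n l x * psi V n l x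

/-- The polynomial `Pₗ⁽ⁿ⁾` has degree `l` and positive leading coefficient for `l ≤ n`, and these
polynomials are orthonormal with respect to the weight `exp (-n V)`. -/
def OrthonormalUpTo (V : ℝ → ℝ) (n : ℕ) : Prop :=
  (∀ l ≤ n, (orthoPoly V n l).natDegree = l ∧ 0 < (orthoPoly V n l).leadingCoeff) ∧
  ∀ l ≤ n, ∀ m ≤ n,
    Integrable (fun x => weight V n x * (orthoPoly V n l).eval x * (orthoPoly V n m).eval x) ∧
    ∫ x, weight V n x * (orthoPoly V n l).eval x * (orthoPoly V n m).eval x =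
      if l = m then 1 else 0

/-- The three-term relations
`rₗ ψₗ₊₁(x) + sₗ ψₗ(x) + rₗ₋₁ ψₗ₋₁(x) = x ψₗ(x)`, `r₋₁ = 0`, for `0 ≤ l < n`. -/
def ThreeTermUpTo (V : ℝ → ℝ) (n : ℕ) : Prop :=
  ∀ l < n, ∀ x : ℝ,
    recR V n l * psi V n (l + 1) x + recS V n l * psi V n l x +
      (if l = 0 then 0 else recR V n (l - 1) * psi V n (l - 1) x) = x * psi V n l x

end MatrixModel

end

/-! ### Orthogonal polynomials for a weight with finitely many moments -/

noncomputable section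
namespace MatrixModel

/-! ### Moments of the weight -/

/-! The eigenvalues form a determinantal ensemble whose kernel `K(x, y) = ∑_{l<n} ψₗ(x) ψₗ(y)` is an
orthogonal projection. For such an ensemble the variance of `∑ φ(λₗ)` equals `½ ∬ |φ(x) - φ(y)|²
K(x, y)² dx dy` (`slaterLaw_complexVariance`). Bounding `|φ(x) - φ(y)|` by `sup |φ'| |x - y|` leaves
`½ ∬ (x - y)² K²`. By Christoffel–Darboux, `(x - y) K` is `rₙ₋₁ (ψₙ(x) ψₙ₋₁(y) - ψₙ₋₁(x) ψₙ(y))`,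
and orthonormality makes the integral of its square exactly `2 rₙ₋₁²`
(`Admissible.integral_sub_sq_mul_kern_sq`). All of this needs only `ψₙ ∈ L²`, that is, moments of
the weight up to order `2n`, which is what admissibility provides.

The link with matrices is the Weyl integration formula `exists_weyl_integration`, proved by
induction on the size. Split off the first row of the matrix and diagonalise the remaining minor;
Lebesgue measure on the row is unitarily invariant, so only an arrowhead matrix remains. For a fixed
minor spectrum `μ`, its corner and squared row entries are explicit functions of its eigenvalues
`x`, with Jacobian `|Δ(x)| / |Δ(μ)|`, and positivity of the squared entries says precisely that `μ`
interlaces `x`. Integrating `|Δ(μ)|` over interlacing `μ` returns `|Δ(x)|`, so `Δ(μ)²` becomes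
`Δ(x)²`. Column operations then turn `e^{-n∑V} Δ²` into a constant times `(det ψⱼ(xᵢ))²`.

The uniform bound on `rₙ₋₁²` starts from Bessel, `rₙ₋₁² ≤ ∫ x² ψₙ₋₁²`. A polynomial of degree `m` is
controlled outside `[-1, 1]` by `C^{m+1} |x|^{2m}` times its squared `L²` norm on `[-1, 1]`
(`eval_sq_le_of_natDegree_le`). Since `V` is bounded there, that norm is at most `e^{nB}`, and the
growth of `V` gives `x² ψₙ₋₁² ≤ (T/|x|)^{nδ}` beyond a radius `T` that does not depend on `n`. The
finitely many `n` with `nδ < 2` are absorbed in the constant. -/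

theorem weight_pos (V : ℝ → ℝ) (n : ℕ) (x : ℝ) : 0 < weight V n x := Real.exp_pos _

theorem weight_le_one {V : ℝ → ℝ} (hV0 : ∀ x, 0 ≤ V x) (n : ℕ) (x : ℝ) : weight V n x ≤ 1 := by
  have := mul_nonneg (Nat.cast_nonneg (α := ℝ) n) (hV0 x)
  exact Real.exp_le_one_iff.2 (by linarith)

theorem measurable_weight {V : ℝ → ℝ} (hV : Measurable V) (n : ℕ) : Measurable (weight V n) := by
  unfold weight
  fun_prop

/-- The weight `exp (-n V)` has finite moments up to order `2 n`. -/
structure Admissible (V : ℝ → ℝ) (n : ℕ) : Prop where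
  measurable : Measurable V
  nonneg : ∀ x, 0 ≤ V x
  integrable : Integrable fun x : ℝ => x ^ (2 * n) * weight V n x

section
variable {V : ℝ → ℝ} {n : ℕ} (h : Admissible V n)
include h

/-- Dominated by the indicator of `[-1, 1]` plus the top moment: the weight is at most `1`, and
`|x|^k ≤ |x|^(2n)` outside the interval. -/
theorem Admissible.integrable_pow {k : ℕ} (hk : k ≤ 2 * n) :
    Integrable fun x : ℝ => weight V n x * x ^ k := by
  have h1 : Integrable ((Set.Icc (-1 : ℝ) 1).indicator fun _ => (1 : ℝ)) :=
    (integrable_indicator_iff measurableSet_Icc).2 (by simp)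
  refine (h1.add h.integrable).mono' ?_ (Filter.Eventually.of_forall fun x => ?_)
  · exact ((measurable_weight h.measurable n).mul (by fun_prop)).aestronglyMeasurable
  · have hw := weight_pos V n x
    have hw1 := weight_le_one h.nonneg n x
    have he : x ^ (2 * n) = |x| ^ (2 * n) := by rw [pow_mul, pow_mul, sq_abs]
    rw [norm_mul, norm_pow, Real.norm_of_nonneg hw.le, Real.norm_eq_abs]
    simp only [Pi.add_apply, he]
    by_cases hx : |x| ≤ 1
    · rw [Set.indicator_of_mem (by rwa [Set.mem_Icc, ← abs_le])]
      have := pow_le_one₀ (n := k) (abs_nonneg x) hx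
      have : weight V n x * |x| ^ k ≤ 1 * 1 := by gcongr
      have : 0 ≤ |x| ^ (2 * n) * weight V n x := by positivity
      linarith
    · rw [Set.indicator_of_notMem (by rwa [Set.mem_Icc, ← abs_le])]
      have : |x| ^ k ≤ |x| ^ (2 * n) := pow_le_pow_right₀ (not_le.1 hx).le hk
      nlinarith

theorem Admissible.integrable_eval {p : ℝ[X]} (hp : p.natDegree ≤ 2 * n) :
    Integrable fun x : ℝ => weight V n x * p.eval x := by
  simp_rw [Polynomial.eval_eq_sum_range, Finset.mul_sum]
  refine integrable_finsetSum _ fun i hi => ?_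
  have := (h.integrable_pow (k := i) (by grind)).const_mul (p.coeff i)
  exact this.congr (Filter.Eventually.of_forall fun x => by simp only; ring)

theorem Admissible.integrable_eval_eval {p q : ℝ[X]} (hpq : p.natDegree + q.natDegree ≤ 2 * n) :
    Integrable fun x : ℝ => weight V n x * p.eval x * q.eval x := by
  simpa only [eval_mul, mul_assoc] using h.integrable_eval (natDegree_mul_le.trans hpq)

/-- Degree bounds are essential here and in the two variants below: only moments up to `2n` are
known to be finite, and a divergent Bochner integral has value `0`, which would break additivity. -/
theorem Admissible.weightInner_add_right {p q r : ℝ[X]} (hpq : p.natDegree + q.natDegree ≤ 2 * n)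
    (hpr : p.natDegree + r.natDegree ≤ 2 * n) :
    weightInner V n p (q + r) = weightInner V n p q + weightInner V n p r := by
  simp only [weightInner, eval_add, mul_add]
  exact integral_add (h.integrable_eval_eval hpq) (h.integrable_eval_eval hpr)

theorem Admissible.weightInner_sub_right {p q r : ℝ[X]} (hpq : p.natDegree + q.natDegree ≤ 2 * n)
    (hpr : p.natDegree + r.natDegree ≤ 2 * n) :
    weightInner V n p (q - r) = weightInner V n p q - weightInner V n p r := by
  simp only [weightInner, eval_sub, mul_sub]
  exact integral_sub (h.integrable_eval_eval hpq) (h.integrable_eval_eval hpr)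

theorem Admissible.weightInner_sum_right {ι : Type*} (s : Finset ι) {p : ℝ[X]} {q : ι → ℝ[X]}
    (hpq : ∀ i ∈ s, p.natDegree + (q i).natDegree ≤ 2 * n) :
    weightInner V n p (∑ i ∈ s, q i) = ∑ i ∈ s, weightInner V n p (q i) := by
  simp only [weightInner, eval_finsetSum, Finset.mul_sum]
  exact integral_finsetSum _ fun i hi => h.integrable_eval_eval (hpq i hi)

end

theorem weightInner_comm (V : ℝ → ℝ) (n : ℕ) (p q : ℝ[X]) :
    weightInner V n p q = weightInner V n q p := by
  simp only [weightInner, mul_right_comm]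

theorem weightInner_C_mul_right (V : ℝ → ℝ) (n : ℕ) (c : ℝ) (p q : ℝ[X]) :
    weightInner V n p (C c * q) = c * weightInner V n p q := by
  simp only [weightInner, eval_mul, eval_C, ← integral_const_mul]
  exact integral_congr_ae (Filter.Eventually.of_forall fun x => by simp only; ring)

theorem weightInner_C_mul_left (V : ℝ → ℝ) (n : ℕ) (c : ℝ) (p q : ℝ[X]) :
    weightInner V n (C c * p) q = c * weightInner V n p q := by
  rw [weightInner_comm, weightInner_C_mul_right, weightInner_comm]

theorem weightInner_X_mul (V : ℝ → ℝ) (n : ℕ) (p q : ℝ[X]) :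
    weightInner V n (X * p) q = weightInner V n p (X * q) := by
  simp only [weightInner, eval_mul, eval_X]
  exact integral_congr_ae (Filter.Eventually.of_forall fun x => by simp only; ring)

/-- The integrand is nonnegative and vanishes only on the finite root set of `p`, so its support has
positive measure. -/
theorem Admissible.weightInner_self_pos {V : ℝ → ℝ} {n : ℕ} (h : Admissible V n) {p : ℝ[X]}
    (hp : p ≠ 0) (hd : p.natDegree ≤ n) : 0 < weightInner V n p p := by
  have hint := h.integrable_eval_eval (p := p) (q := p) (by omega)
  have hnn : ∀ x, 0 ≤ weight V n x * p.eval x * p.eval x := fun x => by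
    rw [mul_assoc]
    exact mul_nonneg (weight_pos V n x).le (mul_self_nonneg _)
  rw [weightInner, integral_pos_iff_support_of_nonneg hnn hint]
  have hsub : {x : ℝ | p.IsRoot x}ᶜ ⊆
      Function.support fun x => weight V n x * p.eval x * p.eval x := fun x hx => by
    have h0 : p.eval x ≠ 0 := hx
    simpa [h0] using (weight_pos V n x).ne'
  refine lt_of_lt_of_le ?_ (measure_mono hsub)
  have hfin : {x : ℝ | p.IsRoot x}.Finite := finite_setOfPred_isRoot hp
  rw [measure_compl hfin.measurableSet (by rw [hfin.measure_zero]; simp), hfin.measure_zero]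
  simp

/-! ### Orthogonal polynomials -/

theorem monicOrthoPoly_eq (V : ℝ → ℝ) (n l : ℕ) : monicOrthoPoly V n l = X ^ l - ∑ k : Fin l,
      C (weightInner V n (X ^ l) (monicOrthoPoly V n k) /
        weightInner V n (monicOrthoPoly V n k) (monicOrthoPoly V n k)) * monicOrthoPoly V n k := by
  rw [monicOrthoPoly]

/-- The subtracted combination has degree below `l` whatever its coefficients are, so no assumption
on the moments is needed. -/
theorem monicOrthoPoly_monic_natDegree (V : ℝ → ℝ) (n l : ℕ) :
    (monicOrthoPoly V n l).Monic ∧ (monicOrthoPoly V n l).natDegree = l := by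
  induction l using Nat.strong_induction_on with
  | _ l ih =>
    rw [monicOrthoPoly_eq]
    set q := ∑ k : Fin l, C (weightInner V n (X ^ l) (monicOrthoPoly V n k) /
        weightInner V n (monicOrthoPoly V n k) (monicOrthoPoly V n k)) * monicOrthoPoly V n k
    have hq : q.degree < l := by
      refine (degree_sum_le _ _).trans_lt ((Finset.sup_lt_iff (WithBot.bot_lt_coe l)).2 ?_)
      intro k _
      refine degree_le_natDegree.trans_lt ?_
      exact Nat.cast_lt.2 ((natDegree_C_mul_le _ _).trans_lt ((ih k k.2).2.trans_lt k.2))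
    have hm : (X ^ l - q).Monic := monic_X_pow_sub hq
    refine ⟨hm, ?_⟩
    have : (X ^ l - q).degree = (l : WithBot ℕ) := by
      rw [degree_sub_eq_left_of_degree_lt (by rwa [degree_X_pow]), degree_X_pow]
    exact natDegree_eq_of_degree_eq_some this

theorem monicOrthoPoly_monic (V : ℝ → ℝ) (n l : ℕ) : (monicOrthoPoly V n l).Monic :=
  (monicOrthoPoly_monic_natDegree V n l).1

theorem natDegree_monicOrthoPoly (V : ℝ → ℝ) (n l : ℕ) : (monicOrthoPoly V n l).natDegree = l :=
  (monicOrthoPoly_monic_natDegree V n l).2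

section
variable {V : ℝ → ℝ} {n : ℕ} (h : Admissible V n)
include h

theorem Admissible.norm_monicOrthoPoly_pos {l : ℕ} (hl : l ≤ n) :
    0 < weightInner V n (monicOrthoPoly V n l) (monicOrthoPoly V n l) :=
  h.weightInner_self_pos (monicOrthoPoly_monic V n l).ne_zero (by rwa [natDegree_monicOrthoPoly])

theorem Admissible.monicOrthoPoly_orthogonal {l m : ℕ} (hml : m < l) (hl : l ≤ n) :
    weightInner V n (monicOrthoPoly V n m) (monicOrthoPoly V n l) = 0 := by
  induction l using Nat.strong_induction_on generalizing m with
  | _ l ih =>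
    have hk : ∀ k, (C (weightInner V n (X ^ l) (monicOrthoPoly V n k) /
        weightInner V n (monicOrthoPoly V n k) (monicOrthoPoly V n k)) *
          monicOrthoPoly V n k).natDegree ≤ k := fun k =>
      (natDegree_C_mul_le _ _).trans (natDegree_monicOrthoPoly V n k).le
    -- Only the term `k = m` of the Gram–Schmidt sum survives the pairing, and it cancels `⟨X^l,
    -- p_m⟩` because the norm of `p_m` is nonzero. The other terms vanish by induction, applied at
    -- `k` or at `m` according to which is larger.
    rw [monicOrthoPoly_eq V n l, h.weightInner_sub_right, h.weightInner_sum_right,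
      Finset.sum_eq_single (⟨m, hml⟩ : Fin l), weightInner_C_mul_right, div_mul_cancel₀,
      weightInner_comm, sub_self]
    · exact (h.norm_monicOrthoPoly_pos (by omega)).ne'
    · intro k _ hkm
      rw [weightInner_C_mul_right]
      rcases lt_trichotomy m k with hlt | heq | hgt
      · rw [ih k k.2 hlt (by omega), mul_zero]
      · exact absurd (Fin.ext heq.symm) hkm
      · rw [weightInner_comm V n (monicOrthoPoly V n m), ih m hml hgt (by omega), mul_zero]
    · simp
    · intro k _
      have := hk k
      have := k.2
      rw [natDegree_monicOrthoPoly]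
      omega
    · rw [natDegree_monicOrthoPoly, natDegree_X_pow]
      omega
    · rw [natDegree_monicOrthoPoly]
      have : (∑ k : Fin l, C (weightInner V n (X ^ l) (monicOrthoPoly V n k) /
        weightInner V n (monicOrthoPoly V n k) (monicOrthoPoly V n k)) *
          monicOrthoPoly V n k).natDegree ≤ l :=
        natDegree_sum_le_of_forall_le _ _ fun k _ => (hk k).trans k.2.le
      omega

/-- The monic family spans: peel off the leading term of `q` with the monic polynomial of the same
degree and induct on `l`. -/
theorem Admissible.weightInner_eq_zero_of_orthogonal {l : ℕ} (hl : l ≤ n) {p : ℝ[X]}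
    (hp : p.natDegree ≤ n)
    (horth : ∀ k < l, weightInner V n p (monicOrthoPoly V n k) = 0) {q : ℝ[X]}
    (hq : q.degree < l) : weightInner V n p q = 0 := by
  induction l generalizing q with
  | zero =>
    have : q = 0 := by simpa using hq
    simp [this, weightInner]
  | succ l ih =>
    have hql : q.natDegree ≤ l := by
      by_contra hcon
      push Not at hcon
      have h2 : q.degree = q.natDegree := degree_eq_natDegree (by rintro rfl; simp at hcon)
      rw [h2] at hq
      have : q.natDegree < l + 1 := by exact_mod_cast hq
      omega
    set q' := q - C (q.coeff l) * monicOrthoPoly V n l with hq'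
    have hdeg : (C (q.coeff l) * monicOrthoPoly V n l).natDegree ≤ l :=
      (natDegree_C_mul_le _ _).trans (natDegree_monicOrthoPoly V n l).le
    have hlt : q'.degree < l := by
      rw [degree_lt_iff_coeff_zero]
      intro m hm
      rcases hm.eq_or_lt with rfl | hm
      · have := (monicOrthoPoly_monic V n l).coeff_natDegree
        rw [natDegree_monicOrthoPoly] at this
        simp [hq', this]
      · rw [hq', coeff_sub, coeff_eq_zero_of_natDegree_lt (hql.trans_lt hm),
          coeff_eq_zero_of_natDegree_lt (hdeg.trans_lt hm), sub_zero]
    have hq'd : q'.natDegree ≤ l := (natDegree_sub_le_of_le hql hdeg).trans (max_self l).le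
    have : q = q' + C (q.coeff l) * monicOrthoPoly V n l := by rw [hq']; ring
    rw [this, h.weightInner_add_right (by omega) (by omega), weightInner_C_mul_right,
      ih (by omega) (fun k hk => horth k (by omega)) hlt, horth l (by omega), mul_zero, add_zero]

theorem Admissible.monicOrthoPoly_orthogonal_degree_lt {l : ℕ} (hl : l ≤ n) {q : ℝ[X]}
    (hq : q.degree < l) : weightInner V n (monicOrthoPoly V n l) q = 0 :=
  h.weightInner_eq_zero_of_orthogonal hl (by rwa [natDegree_monicOrthoPoly])
    (fun k hk => by rw [weightInner_comm, h.monicOrthoPoly_orthogonal hk hl]) hq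

theorem Admissible.orthoPoly_scale_pos {l : ℕ} (hl : l ≤ n) :
    0 < 1 / Real.sqrt (weightInner V n (monicOrthoPoly V n l) (monicOrthoPoly V n l)) :=
  one_div_pos.2 (Real.sqrt_pos.2 (h.norm_monicOrthoPoly_pos hl))

theorem Admissible.natDegree_orthoPoly {l : ℕ} (hl : l ≤ n) : (orthoPoly V n l).natDegree = l := by
  rw [orthoPoly, natDegree_C_mul (h.orthoPoly_scale_pos hl).ne', natDegree_monicOrthoPoly]

theorem Admissible.leadingCoeff_orthoPoly_pos {l : ℕ} (hl : l ≤ n) :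
    0 < (orthoPoly V n l).leadingCoeff := by
  rw [orthoPoly, leadingCoeff_mul, leadingCoeff_C, (monicOrthoPoly_monic V n l).leadingCoeff,
    mul_one]
  exact h.orthoPoly_scale_pos hl

theorem Admissible.weightInner_orthoPoly {l m : ℕ} (hl : l ≤ n) (hm : m ≤ n) :
    weightInner V n (orthoPoly V n l) (orthoPoly V n m) = if l = m then 1 else 0 := by
  rw [orthoPoly, orthoPoly, weightInner_C_mul_left, weightInner_C_mul_right]
  split_ifs with hlm
  · subst hlm
    have := h.norm_monicOrthoPoly_pos hl
    have hs := Real.mul_self_sqrt this.le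
    have : Real.sqrt (weightInner V n (monicOrthoPoly V n l) (monicOrthoPoly V n l)) ≠ 0 :=
      (Real.sqrt_pos.2 this).ne'
    field_simp
    nlinarith
  · rcases Nat.lt_or_gt_of_ne hlm with hlt | hgt
    · rw [h.monicOrthoPoly_orthogonal hlt hm]; simp
    · rw [weightInner_comm V n (monicOrthoPoly V n l) (monicOrthoPoly V n m), h.monicOrthoPoly_orthogonal hgt hl]; simp

theorem Admissible.orthonormalUpTo : OrthonormalUpTo V n := by
  refine ⟨fun l hl => ⟨h.natDegree_orthoPoly hl, h.leadingCoeff_orthoPoly_pos hl⟩,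
    fun l hl m hm => ⟨h.integrable_eval_eval ?_, h.weightInner_orthoPoly hl hm⟩⟩
  rw [h.natDegree_orthoPoly hl, h.natDegree_orthoPoly hm]
  omega

theorem Admissible.orthoPoly_orthogonal_degree_lt {l : ℕ} (hl : l ≤ n) {q : ℝ[X]}
    (hq : q.degree < l) : weightInner V n (orthoPoly V n l) q = 0 := by
  rw [orthoPoly, weightInner_C_mul_left, h.monicOrthoPoly_orthogonal_degree_lt hl hq, mul_zero]

/-- Such a `p` is orthogonal to itself. This is how polynomial identities are checked below: by
pairing with the `Pₖ`. -/
theorem Admissible.eq_zero_of_orthogonal {l : ℕ} (hl : l ≤ n) {p : ℝ[X]} (hp : p.natDegree ≤ l)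
    (horth : ∀ k ≤ l, weightInner V n p (orthoPoly V n k) = 0) : p = 0 := by
  by_contra h0
  refine (h.weightInner_self_pos h0 (hp.trans hl)).ne' ?_
  have hmon : ∀ k ≤ l, weightInner V n p (monicOrthoPoly V n k) = 0 := fun k hk => by
    have := horth k hk
    rw [orthoPoly, weightInner_C_mul_right] at this
    exact (mul_eq_zero.1 this).resolve_left (h.orthoPoly_scale_pos (hk.trans hl)).ne'
  set q := p - C (p.coeff l) * monicOrthoPoly V n l with hq
  have hdeg : (C (p.coeff l) * monicOrthoPoly V n l).natDegree ≤ l :=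
    (natDegree_C_mul_le _ _).trans (natDegree_monicOrthoPoly V n l).le
  have hqd : q.natDegree ≤ l := (natDegree_sub_le_of_le hp hdeg).trans (max_self l).le
  have hlt : q.degree < l := by
    rw [degree_lt_iff_coeff_zero]
    intro m hm
    rcases hm.eq_or_lt with rfl | hm
    · have := (monicOrthoPoly_monic V n l).coeff_natDegree
      rw [natDegree_monicOrthoPoly] at this
      simp [hq, this]
    · rw [hq, coeff_sub, coeff_eq_zero_of_natDegree_lt (hp.trans_lt hm),
        coeff_eq_zero_of_natDegree_lt (hdeg.trans_lt hm), sub_zero]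
  have : weightInner V n p p = weightInner V n p (q + C (p.coeff l) * monicOrthoPoly V n l) := by
    rw [hq, sub_add_cancel]
  rw [this, h.weightInner_add_right (by omega) (by omega), weightInner_C_mul_right,
    hmon l le_rfl, mul_zero, add_zero]
  exact h.weightInner_eq_zero_of_orthogonal hl (hp.trans hl) (fun k hk => hmon k hk.le) hlt

end

/-! ### The three-term relation -/

theorem exp_half_mul_self (V : ℝ → ℝ) (n : ℕ) (x : ℝ) :
    Real.exp (-((n : ℝ) * V x / 2)) * Real.exp (-((n : ℝ) * V x / 2)) = weight V n x := by
  rw [← Real.exp_add, weight]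
  congr 1
  ring

theorem psi_mul_psi (V : ℝ → ℝ) (n l m : ℕ) (x : ℝ) : psi V n l x * psi V n m x =
    weight V n x * (orthoPoly V n l).eval x * (orthoPoly V n m).eval x := by
  rw [← exp_half_mul_self, psi, psi]
  ring

theorem recR_eq (V : ℝ → ℝ) (n l : ℕ) :
    recR V n l = weightInner V n (X * orthoPoly V n l) (orthoPoly V n (l + 1)) := by
  refine integral_congr_ae (Filter.Eventually.of_forall fun x => ?_)
  simp only [mul_assoc, psi_mul_psi, eval_mul, eval_X]
  ring

theorem recS_eq (V : ℝ → ℝ) (n l : ℕ) :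
    recS V n l = weightInner V n (X * orthoPoly V n l) (orthoPoly V n l) := by
  refine integral_congr_ae (Filter.Eventually.of_forall fun x => ?_)
  simp only [mul_assoc, psi_mul_psi, eval_mul, eval_X]
  ring

section
variable {V : ℝ → ℝ} {n : ℕ} (h : Admissible V n)
include h

/-- Both sides have degree at most `l + 1 ≤ n`, so it suffices to pair with `Pₖ` for `k ≤ l + 1`. If
`k + 1 < l`, moving `X` onto `Pₖ` gives a polynomial of degree below `l`, hence `0`; the other three
values of `k` read off the coefficients. -/
theorem Admissible.X_mul_orthoPoly {l : ℕ} (hl : l < n) : X * orthoPoly V n l =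
    C (recR V n l) * orthoPoly V n (l + 1) + C (recS V n l) * orthoPoly V n l +
      (if l = 0 then 0 else C (recR V n (l - 1)) * orthoPoly V n (l - 1)) := by
  have hd : ∀ k ≤ n, (orthoPoly V n k).natDegree = k := fun k hk => h.natDegree_orthoPoly hk
  have hX : (X * orthoPoly V n l).natDegree ≤ l + 1 :=
    natDegree_mul_le.trans (by rw [natDegree_X, hd l hl.le]; omega)
  have h1 : ∀ c, (C c * orthoPoly V n (l + 1)).natDegree ≤ l + 1 := fun c =>
    (natDegree_C_mul_le _ _).trans (hd _ hl).le
  have h2 : ∀ c, (C c * orthoPoly V n l).natDegree ≤ l + 1 := fun c =>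
    (natDegree_C_mul_le _ _).trans ((hd _ hl.le).le.trans l.le_succ)
  have h3 : (if l = 0 then (0 : ℝ[X]) else
      C (recR V n (l - 1)) * orthoPoly V n (l - 1)).natDegree ≤ l + 1 := by
    split_ifs
    · simp
    · exact (natDegree_C_mul_le _ _).trans ((hd _ (by omega)).le.trans (by omega))
  have h12 := fun c d => natDegree_add_le_of_degree_le (h1 c) (h2 d)
  have h123 := natDegree_add_le_of_degree_le (h12 (recR V n l) (recS V n l)) h3
  rw [← sub_eq_zero]
  refine h.eq_zero_of_orthogonal (l := l + 1) hl ((natDegree_sub_le_of_le hX h123).trans (max_self _).le) fun k hk => ?_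
  have hdk := hd k (by omega)
  rw [weightInner_comm, h.weightInner_sub_right (by omega) (by omega),
    h.weightInner_add_right (by have := h12 (recR V n l) (recS V n l); omega) (by omega),
    h.weightInner_add_right (by have := h1 (recR V n l); omega)
      (by have := h2 (recS V n l); omega), weightInner_C_mul_right, weightInner_C_mul_right,
    h.weightInner_orthoPoly (by omega) hl, h.weightInner_orthoPoly (by omega) hl.le]
  have h4 : weightInner V n (orthoPoly V n k) (if l = 0 then (0 : ℝ[X]) else
      C (recR V n (l - 1)) * orthoPoly V n (l - 1)) =
      if k + 1 = l then recR V n k else 0 := by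
    split_ifs with h0 h1 h1
    · omega
    · simp [weightInner]
    · subst h1
      rw [weightInner_C_mul_right, Nat.add_sub_cancel, h.weightInner_orthoPoly (by omega) (by omega)]
      simp
    · rw [weightInner_C_mul_right, h.weightInner_orthoPoly (by omega) (by omega), if_neg (by omega),
        mul_zero]
  rw [h4]
  rcases Nat.lt_or_ge (k + 1) l with hkl | hkl
  · rw [← weightInner_X_mul, weightInner_comm, h.orthoPoly_orthogonal_degree_lt hl.le]
    · simp [show k ≠ l + 1 by omega, show k ≠ l by omega, show k + 1 ≠ l by omega]
    · refine (degree_le_natDegree).trans_lt ?_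
      have : (X * orthoPoly V n k).natDegree ≤ k + 1 :=
        natDegree_mul_le.trans (by rw [natDegree_X, hdk]; omega)
      exact_mod_cast this.trans_lt hkl
  · obtain rfl | rfl | rfl : k = l + 1 ∨ k = l ∨ k + 1 = l := by omega
    · rw [weightInner_comm, ← recR_eq]; simp; omega
    · rw [weightInner_comm, ← recS_eq]; simp
    · rw [← weightInner_X_mul, ← recR_eq]; simp; omega

theorem Admissible.threeTermUpTo : ThreeTermUpTo V n := by
  intro l hl x
  have := congrArg (fun p => Real.exp (-((n : ℝ) * V x / 2)) * p.eval x) (h.X_mul_orthoPoly hl)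
  simp only [eval_mul, eval_X, eval_add, eval_C] at this
  have h3 : (if l = 0 then 0 else recR V n (l - 1) * psi V n (l - 1) x) =
      Real.exp (-((n : ℝ) * V x / 2)) * (if l = 0 then (0 : ℝ[X]) else
        C (recR V n (l - 1)) * orthoPoly V n (l - 1)).eval x := by
    split_ifs
    · simp
    · simp only [psi, eval_mul, eval_C]; ring
  rw [h3]
  simp only [psi]
  linarith

/-- The Christoffel–Darboux kernel. -/
theorem Admissible.christoffel_darboux {m : ℕ} (hm : m < n) (x y : ℝ) :
    (x - y) * ∑ l ∈ Finset.range (m + 1), psi V n l x * psi V n l y =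
      recR V n m * (psi V n (m + 1) x * psi V n m y - psi V n m x * psi V n (m + 1) y) := by
  induction m with
  | zero =>
    have hx := h.threeTermUpTo 0 hm x
    have hy := h.threeTermUpTo 0 hm y
    simp only [if_true, add_zero] at hx hy
    simp only [zero_add, Finset.sum_range_one] at *
    linear_combination (-psi V n 0 y) * hx + psi V n 0 x * hy
  | succ m ih =>
    have hx := h.threeTermUpTo (m + 1) hm x
    have hy := h.threeTermUpTo (m + 1) hm y
    simp only [Nat.succ_ne_zero, if_false, Nat.add_sub_cancel] at hx hy
    rw [Finset.sum_range_succ, mul_add, ih (by omega)]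
    -- Cross-multiplying the relations at `x` and at `y` cancels the diagonal terms, and the sum
    -- telescopes.
    linear_combination (-psi V n (m + 1) y) * hx + psi V n (m + 1) x * hy

theorem Admissible.integrable_psi_mul_psi {l m : ℕ} (hl : l ≤ n) (hm : m ≤ n) :
    Integrable fun x => psi V n l x * psi V n m x := by
  simp only [psi_mul_psi]
  exact (h.orthonormalUpTo.2 l hl m hm).1

theorem Admissible.integral_psi_mul_psi {l m : ℕ} (hl : l ≤ n) (hm : m ≤ n) :
    ∫ x, psi V n l x * psi V n m x = if l = m then 1 else 0 := by
  simp only [psi_mul_psi]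
  exact (h.orthonormalUpTo.2 l hl m hm).2

theorem Admissible.measurable_psi (l : ℕ) : Measurable (psi V n l) := by
  have := h.measurable
  unfold psi
  exact Measurable.mul (by fun_prop) (Polynomial.continuous _).measurable

/-- For `l < n` the polynomial `X Pₗ` has degree at most `n`, so its square stays within the
available moments. -/
theorem Admissible.integrable_sq_mul_psi_sq {l : ℕ} (hl : l < n) :
    Integrable fun x => x ^ 2 * psi V n l x ^ 2 := by
  have := h.integrable_eval_eval (p := X * orthoPoly V n l) (q := X * orthoPoly V n l) (by
    have : (X * orthoPoly V n l).natDegree ≤ l + 1 :=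
      natDegree_mul_le.trans (by rw [natDegree_X, h.natDegree_orthoPoly hl.le]; omega)
    omega)
  refine this.congr (Filter.Eventually.of_forall fun x => ?_)
  simp only [sq (psi V n l x), psi_mul_psi, eval_mul, eval_X]
  ring

/-- Bessel's inequality for `x ψₗ`. -/
theorem Admissible.recR_sq_le {l : ℕ} (hl : l < n) :
    recR V n l ^ 2 ≤ ∫ x, x ^ 2 * psi V n l x ^ 2 := by
  set r := recR V n l with hr
  have i1 := h.integrable_sq_mul_psi_sq hl
  have i2 := h.integrable_psi_mul_psi (l := l + 1) hl hl
  have i3 : Integrable fun x => x * psi V n l x * psi V n (l + 1) x := by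
    have := h.integrable_eval_eval (p := X * orthoPoly V n l) (q := orthoPoly V n (l + 1)) (by
      have : (X * orthoPoly V n l).natDegree ≤ l + 1 :=
        natDegree_mul_le.trans (by rw [natDegree_X, h.natDegree_orthoPoly hl.le]; omega)
      rw [h.natDegree_orthoPoly hl]
      omega)
    refine this.congr (Filter.Eventually.of_forall fun x => ?_)
    simp only [mul_assoc, psi_mul_psi, eval_mul, eval_X]
    ring
  -- Expanding this square gives `∫ x² ψₗ² - 2r² + r²`.
  have h0 : 0 ≤ ∫ x, (x * psi V n l x - r * psi V n (l + 1) x) ^ 2 :=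
    integral_nonneg fun x => sq_nonneg _
  have he : ∀ x, (x * psi V n l x - r * psi V n (l + 1) x) ^ 2 =
      x ^ 2 * psi V n l x ^ 2 - 2 * r * (x * psi V n l x * psi V n (l + 1) x) +
        r ^ 2 * (psi V n (l + 1) x * psi V n (l + 1) x) := fun x => by ring
  simp_rw [he] at h0
  rw [integral_add (f := fun x => x ^ 2 * psi V n l x ^ 2 - 2 * r * (x * psi V n l x * psi V n (l + 1) x))
      (i1.sub (i3.const_mul _)) (i2.const_mul _), integral_sub i1 (i3.const_mul _),
    integral_const_mul, integral_const_mul, h.integral_psi_mul_psi hl hl] at h0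
  have hr' : ∫ x, x * psi V n l x * psi V n (l + 1) x = r := rfl
  rw [hr'] at h0
  simp only [if_true] at h0
  linarith

end

end MatrixModel
end

/-! ### Uniform bound for the last recurrence coefficient -/

noncomputable section
namespace MatrixModel

/-! ### Growth of the weight -/

/-- The growth condition makes the weight at most `|x|^(-n(2+δ))`; the factor `x^(2n)` uses up the
`2n`. -/
theorem weight_le_rpow {V : ℝ → ℝ} {δ L : ℝ}
    (hgrowth : ∀ x : ℝ, L < |x| → (2 + δ) * Real.log |x| ≤ V x) {n : ℕ} {x : ℝ} (hx : L < |x|)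
    (hx0 : 0 < |x|) : x ^ (2 * n) * weight V n x ≤ |x| ^ (-(n * δ)) := by
  have h1 : x ^ (2 * n) = |x| ^ ((2 * n : ℕ) : ℝ) := by
    rw [Real.rpow_natCast, pow_mul, pow_mul, sq_abs]
  have h2 : weight V n x ≤ |x| ^ (-(n * (2 + δ))) := by
    rw [weight, Real.rpow_def_of_pos hx0, Real.exp_le_exp]
    nlinarith [hgrowth x hx, Nat.cast_nonneg (α := ℝ) n]
  calc x ^ (2 * n) * weight V n x ≤ |x| ^ ((2 * n : ℕ) : ℝ) * |x| ^ (-(n * (2 + δ))) := by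
        rw [h1]; gcongr
    _ = |x| ^ (-(n * δ)) := by
        rw [← Real.rpow_add hx0]
        congr 1
        push_cast
        ring

theorem integrable_pow_mul_weight {V : ℝ → ℝ} (hV : Measurable V) (hV0 : ∀ x, 0 ≤ V x) {δ L : ℝ}
    (hgrowth : ∀ x : ℝ, L < |x| → (2 + δ) * Real.log |x| ≤ V x) {n : ℕ} (hn : 1 < n * δ) :
    Integrable fun x : ℝ => x ^ (2 * n) * weight V n x := by
  set s : ℝ := n * δ with hs
  set R := max L 1
  have hR : 1 ≤ R := le_max_right _ _
  have hi : Integrable fun x : ℝ => (1 + ‖x‖) ^ (-s) := integrable_one_add_norm (by simpa using hn)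
  -- The second summand of the constant covers `|x| ≤ R`, where the weight is at most `1`; the first
  -- covers `|x| > R ≥ 1`, where `|x| ≥ (1 + |x|) / 2`.
  refine (hi.const_mul (2 ^ s + R ^ (2 * n) * (1 + R) ^ s)).mono'
    ((Measurable.mul (by fun_prop) (measurable_weight hV n)).aestronglyMeasurable)
    (Filter.Eventually.of_forall fun x => ?_)
  have hw := weight_pos V n x
  have he : x ^ (2 * n) = |x| ^ (2 * n) := by rw [pow_mul, pow_mul, sq_abs]
  have h1x : 0 < 1 + |x| := by positivity
  rw [Real.norm_of_nonneg (by rw [he]; positivity), Real.norm_eq_abs]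
  rcases le_or_gt |x| R with hx | hx
  · calc x ^ (2 * n) * weight V n x ≤ R ^ (2 * n) * 1 := by
          rw [he]; gcongr; exact weight_le_one hV0 n x
      _ ≤ R ^ (2 * n) * (1 + R) ^ s * (1 + |x|) ^ (-s) := by
          rw [mul_assoc]
          gcongr
          rw [Real.rpow_neg h1x.le, ← div_eq_mul_inv, one_le_div (by positivity)]
          gcongr
      _ ≤ _ := by gcongr; exact le_add_of_nonneg_left (by positivity)
  · have hx1 : 1 < |x| := hR.trans_lt hx
    calc x ^ (2 * n) * weight V n x ≤ |x| ^ (-s) :=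
          weight_le_rpow hgrowth ((le_max_left _ _).trans_lt hx) (by linarith)
      _ ≤ ((1 + |x|) / 2) ^ (-s) :=
          Real.rpow_le_rpow_of_nonpos (by positivity) (by linarith) (by linarith)
      _ = 2 ^ s * (1 + |x|) ^ (-s) := by
          rw [Real.div_rpow h1x.le (by norm_num), Real.rpow_neg (by norm_num : (0 : ℝ) ≤ 2),
            div_inv_eq_mul, mul_comm]
      _ ≤ _ := by gcongr; exact le_add_of_nonneg_right (by positivity)

/-! ### Growth of polynomials outside an interval -/

/-- These are the Lagrange denominators for equally spaced nodes; the product is split at `j`. -/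
theorem prod_abs_sub_nat (m j : ℕ) (hj : j ≤ m) :
    ∏ i ∈ (Finset.range (m + 1)).erase j, |((j : ℝ) - i)| = (j.factorial * (m - j).factorial : ℕ) := by
  set g : ℕ → ℝ := fun i => if i = j then 1 else |((j : ℝ) - i)|
  have h1 : ∏ i ∈ (Finset.range (m + 1)).erase j, |((j : ℝ) - i)| =
      ∏ i ∈ Finset.range (m + 1), g i := by
    rw [← Finset.mul_prod_erase _ _ (Finset.mem_range.2 (Nat.lt_succ_of_le hj))]
    simp only [g, if_true, one_mul]
    exact Finset.prod_congr rfl fun i hi => by rw [if_neg (Finset.ne_of_mem_erase hi)]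
  have h2 : ∏ i ∈ Finset.range j, g i = (j.factorial : ℝ) := by
    rw [← Finset.prod_range_reflect, ← Finset.prod_range_add_one_eq_factorial]
    push_cast
    refine Finset.prod_congr rfl fun i hi => ?_
    have hi := Finset.mem_range.1 hi
    simp only [g]
    rw [if_neg (by omega), Nat.cast_sub (by omega), Nat.cast_sub (by omega)]
    rw [abs_of_nonneg (by push_cast; linarith [Nat.cast_nonneg (α := ℝ) i])]
    push_cast
    ring
  have h3 : ∏ i ∈ Finset.range (m - j), g (j + 1 + i) = ((m - j).factorial : ℝ) := by
    rw [← Finset.prod_range_add_one_eq_factorial]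
    push_cast
    refine Finset.prod_congr rfl fun i hi => ?_
    simp only [g]
    rw [if_neg (by omega)]
    push_cast
    rw [abs_sub_comm, abs_of_nonneg (by linarith [Nat.cast_nonneg (α := ℝ) i])]
    ring
  rw [h1, show m + 1 = (j + 1) + (m - j) by omega, Finset.prod_range_add, h3,
    Finset.prod_range_succ, h2]
  simp [g]

/-- The minimum of a function is at most its mean. -/
theorem exists_sq_le_integral (q : ℝ[X]) {a b : ℝ} (hab : a < b) :
    ∃ t ∈ Set.Icc a b, (b - a) * q.eval t ^ 2 ≤ ∫ y in a..b, q.eval y ^ 2 := by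
  have hc : Continuous fun y => q.eval y ^ 2 := by fun_prop
  obtain ⟨t, ht, hmin⟩ := isCompact_Icc.exists_isMinOn (Set.nonempty_Icc.2 hab.le)
    hc.continuousOn
  refine ⟨t, ht, ?_⟩
  have := intervalIntegral.integral_mono_on (μ := volume) hab.le
    (intervalIntegrable_const (c := q.eval t ^ 2)) (hc.intervalIntegrable a b) fun y hy => hmin hy
  simpa using this

/-- Growth of a polynomial off an interval, by Lagrange interpolation at nodes in `[-1, 1]` where
`q²` is at most `N` times its integral. The nodes are separated like equally spaced points, so the
basis polynomials are bounded by `(2|x|N)^m / (j! (m-j)!)`, and the binomial sum together with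
Stirling-type bounds keeps the total exponential in `m`. -/
theorem eval_sq_le_of_natDegree_le {m : ℕ} {q : ℝ[X]} (hq : q.natDegree ≤ m) {x : ℝ}
    (hx : 1 ≤ |x|) : q.eval x ^ 2 ≤
      (16 * Real.exp 3) ^ (m + 1) * x ^ (2 * m) * ∫ y in (-1 : ℝ)..1, q.eval y ^ 2 := by
  set I := ∫ y in (-1 : ℝ)..1, q.eval y ^ 2 with hI
  set N : ℝ := m + 1 with hN
  have hNpos : 0 < N := by positivity
  have hc : Continuous fun y => q.eval y ^ 2 := by fun_prop
  -- The windows have length `1/N` and are followed by gaps of the same length, so the chosen nodes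
  -- satisfy `|tᵢ - tⱼ| ≥ |i - j| / N`. Only `j ≤ m` keeps a window inside `[-1, 1]`, hence the
  -- restricted bound.
  have hex : ∀ j : ℕ, ∃ t ∈ Set.Icc (-1 + 2 * j / N) (-1 + (2 * j + 1) / N), j ≤ m →
      q.eval t ^ 2 ≤ N * I := fun j => by
    have hlt : -1 + 2 * j / N < -1 + (2 * j + 1) / N := by gcongr; linarith
    obtain ⟨t, ht, hle⟩ := exists_sq_le_integral q hlt
    refine ⟨t, ht, fun hj => ?_⟩
    have hj' : (j : ℝ) ≤ m := by exact_mod_cast hj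
    have hsub : ∫ y in (-1 + 2 * j / N)..(-1 + (2 * j + 1) / N), q.eval y ^ 2 ≤ I := by
      refine intervalIntegral.integral_mono_interval ?_ hlt.le ?_
        (Filter.Eventually.of_forall fun y => sq_nonneg _) (hc.intervalIntegrable _ _)
      · have : 0 ≤ 2 * j / N := by positivity
        linarith
      · have : (2 * j + 1) / N ≤ 2 := by
          rw [div_le_iff₀ hNpos]; linarith
        linarith
    have h1 : (-1 + (2 * j + 1) / N) - (-1 + 2 * j / N) = 1 / N := by field_simp; ring
    rw [h1] at hle
    have := hle.trans hsub
    field_simp at this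
    linarith
  choose t ht htI using hex
  have hsep : ∀ i j : ℕ, |(i : ℝ) - j| / N ≤ |t i - t j| := by
    have key : ∀ i j : ℕ, i < j → |(i : ℝ) - j| / N ≤ |t i - t j| := fun i j hij => by
      have h1 := (ht i).2
      have h2 := (ht j).1
      have hij' : (i : ℝ) + 1 ≤ j := by exact_mod_cast hij
      have h3 : (2 * i + 1) / N ≤ (2 * j - (j - i)) / N := by gcongr; linarith
      have h4 : (2 * j - (j - i : ℝ)) / N = 2 * j / N - (j - i) / N := by ring
      rw [abs_sub_comm, abs_of_nonneg (by linarith), abs_sub_comm (t i)]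
      exact le_trans (by linarith) (le_abs_self _)
    intro i j
    rcases lt_trichotomy i j with hij | rfl | hij
    · exact key i j hij
    · simp
    · rw [abs_sub_comm, abs_sub_comm (t i)]; exact key j i hij
  have hinj : Function.Injective t := fun i j hij => by
    have := hsep i j
    rw [hij, sub_self, abs_zero] at this
    have h0 : |(i : ℝ) - j| ≤ 0 := by
      by_contra hcon
      push Not at hcon
      have := div_pos hcon hNpos
      linarith
    have := abs_nonpos_iff.1 h0
    exact_mod_cast sub_eq_zero.1 this
  have htx : ∀ i ≤ m, |x - t i| ≤ 2 * |x| := fun i hi => by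
    have hi' : (i : ℝ) ≤ m := by exact_mod_cast hi
    have h1 : |t i| ≤ 1 := by
      have : (2 * i + 1) / N ≤ 2 := by rw [div_le_iff₀ hNpos]; linarith
      have : 0 ≤ 2 * i / N := by positivity
      have := ht i
      rw [abs_le]
      constructor <;> linarith [this.1, this.2]
    linarith [abs_sub x (t i)]
  set s := Finset.range (m + 1)
  have hlag : q = Lagrange.interpolate s t fun i => q.eval (t i) := by
    refine Lagrange.eq_interpolate (hinj.injOn) ?_
    rw [Finset.card_range]
    exact degree_le_natDegree.trans_lt (by exact_mod_cast Nat.lt_succ_of_le hq)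
  have hbas : ∀ j ∈ s, |(Lagrange.basis s t j).eval x| ≤
      (2 * |x|) ^ m * N ^ m * (1 / (j.factorial * (m - j).factorial : ℕ)) := fun j hj => by
    have hjm : j ≤ m := Nat.lt_succ_iff.1 (Finset.mem_range.1 hj)
    have hcard : (s.erase j).card = m := by rw [Finset.card_erase_of_mem hj]; simp [s]
    rw [Lagrange.basis, eval_prod, Finset.abs_prod, ← prod_abs_sub_nat m j hjm, mul_one_div,
      ← mul_pow]
    have hp : (2 * |x| * N) ^ m = ∏ i ∈ s.erase j, (2 * |x| * N) := by
      rw [Finset.prod_const, hcard]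
    rw [hp, ← Finset.prod_div_distrib]
    refine Finset.prod_le_prod (fun _ _ => abs_nonneg _) fun i hi => ?_
    have hij := Finset.ne_of_mem_erase hi
    have him : i ≤ m := Nat.lt_succ_iff.1 (Finset.mem_range.1 (Finset.mem_of_mem_erase hi))
    have hpos : 0 < |(j : ℝ) - i| := abs_pos.2 (sub_ne_zero.2 (by exact_mod_cast hij.symm))
    have hs := hsep j i
    have h1 : 0 < |(j : ℝ) - i| / N := by positivity
    rw [Lagrange.basisDivisor, eval_mul, eval_C, eval_sub, eval_X, eval_C, abs_mul, abs_inv,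
      inv_mul_eq_div]
    calc |x - t i| / |t j - t i| ≤ (2 * |x|) / (|(j : ℝ) - i| / N) := by gcongr; exact htx i him
      _ = _ := by field_simp
  have hI0 : 0 ≤ I := intervalIntegral.integral_nonneg (by norm_num) fun _ _ => sq_nonneg _
  have habs : |q.eval x| ≤ Real.sqrt (N * I) * ((4 * |x|) ^ m * Real.exp N) := by
    -- Multiplying by `m!` turns the summands into binomial coefficients.
    have hsum : ∑ j ∈ s, (1 : ℝ) / (j.factorial * (m - j).factorial : ℕ) = 2 ^ m / m.factorial := by
      have h2 : (2 : ℝ) ^ m = ∑ j ∈ s, (m.choose j : ℝ) := by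
        exact_mod_cast (Nat.sum_range_choose m).symm
      rw [h2, Finset.sum_div]
      refine Finset.sum_congr rfl fun j hj => ?_
      have hjm : j ≤ m := Nat.lt_succ_iff.1 (Finset.mem_range.1 hj)
      have := Nat.choose_mul_factorial_mul_factorial hjm
      have hm0 : (m.factorial : ℝ) ≠ 0 := by positivity
      have hj0 : (j.factorial : ℝ) ≠ 0 := by positivity
      have hmj0 : ((m - j).factorial : ℝ) ≠ 0 := by positivity
      rw [← this]
      push_cast
      have hch : (m.choose j : ℝ) ≠ 0 := by
        exact_mod_cast (Nat.choose_pos hjm).ne'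
      field_simp
    conv_lhs => rw [hlag, Lagrange.interpolate_apply, eval_finsetSum]
    calc |∑ j ∈ s, (C (q.eval (t j)) * Lagrange.basis s t j).eval x|
        ≤ ∑ j ∈ s, |(C (q.eval (t j)) * Lagrange.basis s t j).eval x| :=
          Finset.abs_sum_le_sum_abs _ _
      _ ≤ ∑ j ∈ s, Real.sqrt (N * I) *
            ((2 * |x|) ^ m * N ^ m * (1 / (j.factorial * (m - j).factorial : ℕ))) := by
          refine Finset.sum_le_sum fun j hj => ?_
          have hjm : j ≤ m := Nat.lt_succ_iff.1 (Finset.mem_range.1 hj)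
          rw [eval_mul, eval_C, abs_mul]
          gcongr
          · exact Real.abs_le_sqrt (htI j hjm)
          · exact hbas j hj
      _ = Real.sqrt (N * I) * ((4 * |x|) ^ m * (N ^ m / m.factorial)) := by
          rw [← Finset.mul_sum, ← Finset.mul_sum, hsum,
            show (4 : ℝ) * |x| = 2 * |x| * 2 by ring, mul_pow (2 * |x|) 2]
          ring
      _ ≤ _ := by
          gcongr
          exact Real.pow_div_factorial_le_exp N hNpos.le m
  have hNexp : N ≤ Real.exp N := by linarith [Real.add_one_le_exp N]
  calc q.eval x ^ 2 = |q.eval x| ^ 2 := (sq_abs _).symm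
    _ ≤ (Real.sqrt (N * I) * ((4 * |x|) ^ m * Real.exp N)) ^ 2 := by gcongr
    _ = N * I * (16 ^ m * x ^ (2 * m) * Real.exp N ^ 2) := by
        rw [mul_pow, Real.sq_sqrt (by positivity), mul_pow, ← pow_mul, mul_pow, pow_mul x 2 m, ← sq_abs x,
          mul_comm m 2, pow_mul 4 2 m, pow_mul |x| 2 m]
        norm_num
    -- The prefactor `N` is absorbed by `N ≤ e^N`, which accounts for the third power of `e`.
    _ ≤ Real.exp N * I * (16 ^ (m + 1) * x ^ (2 * m) * Real.exp N ^ 2) := by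
        have : 0 ≤ x ^ (2 * m) := by rw [pow_mul]; positivity
        gcongr
        · norm_num
        · omega
    _ = _ := by
        have : Real.exp 3 ^ (m + 1) = Real.exp N ^ 3 := by
          rw [← Real.exp_nat_mul, ← Real.exp_nat_mul]
          congr 1
          push_cast
          ring
        rw [mul_pow, this]
        ring

/-! ### Boundedness of the recurrence coefficients -/

/-- By Bessel it is enough to bound the second moment of `ψₙ₋₁²`. Inside `[-T, T]` it is at most
`T²`; outside, polynomial growth against the decay of the weight gives `(T/|x|)^{nδ}`, integrable
uniformly in `n` once `nδ ≥ 2`. -/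
theorem exists_recR_sq_le_of_large {V : ℝ → ℝ} {δ L B : ℝ} (hδ : 0 < δ)
    (hgrowth : ∀ x : ℝ, L < |x| → (2 + δ) * Real.log |x| ≤ V x)
    (hB : ∀ x : ℝ, |x| ≤ 1 → V x ≤ B) :
    ∃ K : ℝ, ∀ n : ℕ, 1 ≤ n → Admissible V n → 2 ≤ n * δ → recR V n (n - 1) ^ 2 ≤ K := by
  set A := 16 * Real.exp 3 * Real.exp B with hA
  have hA0 : 0 < A := by positivity
  -- Chosen so that `T^δ ≥ A`: the exponential loss `A^n` is then beaten by `|x|^(-nδ)` for every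
  -- `|x| > T`, with `T` independent of `n`.
  set T := max (max 1 (L + 1)) (A ^ (1 / δ)) with hT
  have hT1 : 1 ≤ T := (le_max_left _ _).trans (le_max_left _ _)
  have hTL : L < T := (lt_add_one L).trans_le ((le_max_right _ _).trans (le_max_left _ _))
  have hTA : A ≤ T ^ δ := by
    calc A = (A ^ (1 / δ)) ^ δ := by
          rw [← Real.rpow_mul hA0.le, one_div_mul_cancel hδ.ne', Real.rpow_one]
      _ ≤ T ^ δ := by gcongr; exact le_max_right _ _
  refine ⟨T ^ 2 + 2 * T ^ 2 * Real.pi, fun n hn h hnδ => ?_⟩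
  obtain ⟨m, rfl⟩ : ∃ m, n = m + 1 := ⟨n - 1, by omega⟩
  rw [Nat.add_sub_cancel]
  set n := m + 1
  have hmn : m < n := Nat.lt_succ_self m
  refine (h.recR_sq_le hmn).trans ?_
  set q := orthoPoly V n m with hq
  have hqd : q.natDegree ≤ m := (h.natDegree_orthoPoly hmn.le).le
  have hone : ∫ x, psi V n m x * psi V n m x = 1 := by
    rw [h.integral_psi_mul_psi hmn.le hmn.le, if_pos rfl]
  -- On `[-1, 1]` the weight is at least `e^{-nB}`, while `q² w` has total integral `1`.
  have hI : ∫ y in (-1 : ℝ)..1, q.eval y ^ 2 ≤ Real.exp B ^ n := by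
    have hint := h.integrable_psi_mul_psi hmn.le hmn.le
    have hint' := hint.const_mul (Real.exp B ^ n)
    have hc : Continuous fun y => q.eval y ^ 2 := by fun_prop
    calc ∫ y in (-1 : ℝ)..1, q.eval y ^ 2
        ≤ ∫ y in (-1 : ℝ)..1, Real.exp B ^ n * (psi V n m y * psi V n m y) := by
          refine intervalIntegral.integral_mono_on (by norm_num) (hc.intervalIntegrable _ _)
            hint'.intervalIntegrable fun y hy => ?_
          have hw : 1 ≤ Real.exp B ^ n * weight V n y := by
            rw [weight, ← Real.exp_nat_mul, ← Real.exp_add]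
            refine Real.one_le_exp ?_
            have := hB y (abs_le.2 hy)
            nlinarith [Nat.cast_nonneg (α := ℝ) n]
          rw [psi_mul_psi]
          nlinarith [sq_nonneg (q.eval y)]
      _ = ∫ y in Set.Ioc (-1 : ℝ) 1, Real.exp B ^ n * (psi V n m y * psi V n m y) :=
          intervalIntegral.integral_of_le (by norm_num)
      _ ≤ ∫ y, Real.exp B ^ n * (psi V n m y * psi V n m y) :=
          setIntegral_le_integral hint' (Filter.Eventually.of_forall fun y =>
            mul_nonneg (by positivity) (mul_self_nonneg _))
      _ = Real.exp B ^ n := by rw [integral_const_mul, hone, mul_one]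
  have hbound : ∀ x, x ^ 2 * psi V n m x ^ 2 ≤
      T ^ 2 * (psi V n m x * psi V n m x) + 2 * T ^ 2 * (1 + x ^ 2)⁻¹ := fun x => by
    have hp : 0 ≤ psi V n m x * psi V n m x := mul_self_nonneg _
    rcases le_or_gt |x| T with hx | hx
    · have h1 : x ^ 2 ≤ T ^ 2 := by rw [← sq_abs]; gcongr
      have h2 : 0 ≤ 2 * T ^ 2 * (1 + x ^ 2)⁻¹ := by positivity
      nlinarith
    · have hx0 : 0 < |x| := by linarith
      have hx1 : 1 ≤ |x| := by linarith
      have hgr := eval_sq_le_of_natDegree_le hqd hx1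
      have hxm : 0 ≤ x ^ (2 * m) := by rw [pow_mul]; positivity
      have h1 : x ^ 2 * psi V n m x ^ 2 ≤ A ^ n * (x ^ (2 * n) * weight V n x) := by
        rw [sq (psi V n m x), psi_mul_psi]
        have hw := weight_pos V n x
        calc x ^ 2 * (weight V n x * q.eval x * q.eval x)
            = x ^ 2 * weight V n x * q.eval x ^ 2 := by ring
          _ ≤ x ^ 2 * weight V n x *
              ((16 * Real.exp 3) ^ n * x ^ (2 * m) * Real.exp B ^ n) := by
              gcongr
              exact hgr.trans (by gcongr)
          _ = _ := by
              rw [hA, mul_pow _ (Real.exp B), show 2 * n = 2 + 2 * m by omega, pow_add]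
              ring
      have h2 : A ^ n * |x| ^ (-(n * δ)) ≤ (T / |x|) ^ (n * δ) := by
        rw [Real.div_rpow (by linarith) hx0.le, Real.rpow_neg hx0.le, ← div_eq_mul_inv]
        gcongr
        calc A ^ n ≤ (T ^ δ) ^ n := by gcongr
          _ = T ^ (n * δ) := by
            rw [← Real.rpow_natCast, ← Real.rpow_mul (by linarith), mul_comm]
      have h3 : (T / |x|) ^ (n * δ) ≤ (T / |x|) ^ (2 : ℝ) :=
        Real.rpow_le_rpow_of_exponent_ge (by positivity) ((div_le_one hx0).2 hx.le) hnδ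
      -- The factor `2` comes from `1 + x² ≤ 2x²` for `|x| ≥ 1`.
      have h4 : (T / |x|) ^ (2 : ℝ) ≤ 2 * T ^ 2 * (1 + x ^ 2)⁻¹ := by
        rw [Real.rpow_two, div_pow, sq_abs, ← div_eq_mul_inv]
        have : 1 ≤ x ^ 2 := by rw [← sq_abs]; nlinarith
        rw [div_le_div_iff₀ (by positivity) (by positivity)]
        nlinarith [sq_nonneg T]
      have h5 : A ^ n * (x ^ (2 * n) * weight V n x) ≤ A ^ n * |x| ^ (-(n * δ)) := by
        gcongr
        exact weight_le_rpow hgrowth (hTL.trans hx) hx0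
      have h6 : 0 ≤ T ^ 2 * (psi V n m x * psi V n m x) := by positivity
      linarith
  have i1 := (h.integrable_psi_mul_psi hmn.le hmn.le).const_mul (T ^ 2)
  have i2 := integrable_inv_one_add_sq.const_mul (2 * T ^ 2)
  calc ∫ x, x ^ 2 * psi V n m x ^ 2
      ≤ ∫ x, (T ^ 2 * (psi V n m x * psi V n m x) + 2 * T ^ 2 * (1 + x ^ 2)⁻¹) :=
        integral_mono (h.integrable_sq_mul_psi_sq hmn) (i1.add i2) hbound
    _ = T ^ 2 + 2 * T ^ 2 * Real.pi := by
        rw [integral_add i1 i2, integral_const_mul, integral_const_mul, hone,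
          integral_univ_inv_one_add_sq, mul_one]

/-- The last recurrence coefficients `rₙ₋₁⁽ⁿ⁾` are bounded uniformly in `n`. -/
theorem exists_recR_sq_le {V : ℝ → ℝ} {δ L B : ℝ} (hδ : 0 < δ)
    (hgrowth : ∀ x : ℝ, L < |x| → (2 + δ) * Real.log |x| ≤ V x)
    (hB : ∀ x : ℝ, |x| ≤ 1 → V x ≤ B) :
    ∃ K : ℝ, ∀ n : ℕ, 1 ≤ n → Admissible V n → recR V n (n - 1) ^ 2 ≤ K := by
  obtain ⟨K, hK⟩ := exists_recR_sq_le_of_large hδ hgrowth hB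
  obtain ⟨N, hN⟩ := exists_nat_ge (2 / δ)
  -- The sum of squares dominates each of the finitely many coefficients with `n < N`, where `N ≥
  -- 2/δ`.
  refine ⟨max K (∑ n ∈ Finset.range N, recR V n (n - 1) ^ 2), fun n hn h => ?_⟩
  rcases lt_or_ge n N with hlt | hge
  · exact (Finset.single_le_sum (f := fun n => recR V n (n - 1) ^ 2) (fun _ _ => sq_nonneg _)
      (Finset.mem_range.2 hlt)).trans (le_max_right _ _)
  · refine (hK n hn h ?_).trans (le_max_left _ _)
    rw [← div_le_iff₀ hδ]
    exact hN.trans (by exact_mod_cast hge)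

/-- Local Hölder regularity enters only through this upper bound, which keeps the weight on `[-1,
1]` from being more than exponentially small in `n`. -/
theorem exists_bound_of_holder {V : ℝ → ℝ} (hlip : ∀ R : ℝ, 0 < R → ∃ A γ : ℝ, 0 < A ∧ 0 < γ ∧
      ∀ x y : ℝ, |x| ≤ R → |y| ≤ R → |V x - V y| ≤ A * |x - y| ^ γ) :
    ∃ B : ℝ, ∀ x : ℝ, |x| ≤ 1 → V x ≤ B := by
  obtain ⟨A, γ, hA, hγ, h⟩ := hlip 1 one_pos
  refine ⟨V 0 + A, fun x hx => ?_⟩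
  have h1 := h x 0 hx (by simp)
  rw [sub_zero] at h1
  have h2 : |x| ^ γ ≤ 1 := Real.rpow_le_one (abs_nonneg x) hx hγ.le
  nlinarith [le_abs_self (V x - V 0)]

end MatrixModel
end

/-! ### Measurability and integration of symmetric functions of eigenvalues -/

noncomputable section
namespace MatrixModel

/-! ### Symmetric functions of finitely many real variables -/

/-- Functions of `n` real variables that are invariant under permutations. -/
def IsSymm {n : ℕ} {β : Type*} (f : (Fin n → ℝ) → β) : Prop :=
  ∀ (σ : Equiv.Perm (Fin n)) (x : Fin n → ℝ), f (x ∘ σ) = f x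

/-- The monic polynomial with the given roots. -/
def rootPoly {n : ℕ} (x : Fin n → ℝ) : ℝ[X] := ∏ j, (X - C (x j))

/-- The values of `rootPoly x` at `0, …, n - 1`. -/
def nodeVals {n : ℕ} (x : Fin n → ℝ) : Fin n → ℝ := fun k => ∏ j, ((k : ℝ) - x j)

theorem eval_rootPoly {n : ℕ} (x : Fin n → ℝ) (t : ℝ) : (rootPoly x).eval t = ∏ j, (t - x j) := by
  simp [rootPoly, eval_prod]

theorem rootPoly_monic {n : ℕ} (x : Fin n → ℝ) : (rootPoly x).Monic :=
  monic_prod_of_monic _ _ fun j _ => monic_X_sub_C (x j)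

theorem natDegree_rootPoly {n : ℕ} (x : Fin n → ℝ) : (rootPoly x).natDegree = n := by
  rw [rootPoly, natDegree_prod_of_monic _ _ fun j _ => monic_X_sub_C (x j)]
  simp

theorem rootPoly_comp {n : ℕ} (x : Fin n → ℝ) (σ : Equiv.Perm (Fin n)) :
    rootPoly (x ∘ σ) = rootPoly x :=
  Equiv.prod_comp σ fun j => X - C (x j)

theorem nodeVals_eq {n : ℕ} (x : Fin n → ℝ) (k : Fin n) :
    nodeVals x k = (rootPoly x).eval (k : ℝ) := by
  rw [eval_rootPoly, nodeVals]

/-- The difference of two monic polynomials of degree `n` has degree below `n` and vanishes at `n`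
points. -/
theorem rootPoly_eq_of_nodeVals {n : ℕ} {x y : Fin n → ℝ} (h : nodeVals x = nodeVals y) :
    rootPoly x = rootPoly y := by
  have hinj : Set.InjOn (fun k : Fin n => (k : ℝ)) (Finset.univ : Finset (Fin n)) := fun a _ b _ hab =>
    Fin.ext (Nat.cast_injective (R := ℝ) hab)
  have hd : (rootPoly x - rootPoly y).degree < (Finset.univ : Finset (Fin n)).card := by
    rw [Finset.card_univ, Fintype.card_fin]
    rcases Nat.eq_zero_or_pos n with rfl | hn
    · simp [rootPoly]
    · have h1 : (rootPoly x).degree = (n : WithBot ℕ) := by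
        rw [degree_eq_natDegree (rootPoly_monic x).ne_zero, natDegree_rootPoly]
      have h2 : (rootPoly y).degree = (n : WithBot ℕ) := by
        rw [degree_eq_natDegree (rootPoly_monic y).ne_zero, natDegree_rootPoly]
      rw [← h1]
      exact degree_sub_lt_left (h1.trans h2.symm) (rootPoly_monic x).ne_zero
        ((rootPoly_monic x).leadingCoeff.trans (rootPoly_monic y).leadingCoeff.symm)
  have := eq_zero_of_degree_lt_of_eval_index_eq_zero (f := rootPoly x - rootPoly y)
    (v := fun k : Fin n => (k : ℝ)) _ hinj hd fun k _ => by
      rw [eval_sub, ← nodeVals_eq, ← nodeVals_eq, h, sub_self]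
  exact sub_eq_zero.1 this

theorem roots_rootPoly {n : ℕ} (x : Fin n → ℝ) :
    (rootPoly x).roots = Finset.univ.val.map x := by
  have := roots_multiset_prod_X_sub_C (Finset.univ.val.map x)
  rwa [Multiset.map_map] at this

theorem eq_of_rootPoly_eq_of_monotone {n : ℕ} {x y : Fin n → ℝ} (h : rootPoly x = rootPoly y)
    (hx : Monotone x) (hy : Monotone y) : x = y := by
  have hm : (Finset.univ.val.map x : Multiset ℝ) = Finset.univ.val.map y := by
    rw [← roots_rootPoly, ← roots_rootPoly, h]
  rw [Fin.univ_val_map, Fin.univ_val_map, Multiset.coe_eq_coe] at hm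
  exact List.ofFn_injective (hm.eq_of_sortedLE hx.sortedLE_ofFn hy.sortedLE_ofFn)

theorem IsSymm.eq_of_rootPoly_eq {n : ℕ} {β : Type*} {f : (Fin n → ℝ) → β} (hf : IsSymm f)
    {x y : Fin n → ℝ} (h : rootPoly x = rootPoly y) : f x = f y := by
  rw [← hf (Tuple.sort x) x, ← hf (Tuple.sort y) y]
  congr 1
  refine eq_of_rootPoly_eq_of_monotone ?_ (Tuple.monotone_sort x) (Tuple.monotone_sort y)
  rw [rootPoly_comp, rootPoly_comp, h]

theorem continuous_nodeVals {n : ℕ} : Continuous (nodeVals (n := n)) := by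
  unfold nodeVals
  fun_prop

/-- On the closed set of monotone tuples `nodeVals` is continuous and injective, hence by the
Lusin–Souslin theorem a measurable embedding; its inverse extends measurably to the whole space. -/
theorem exists_measurable_sort (n : ℕ) : ∃ g : (Fin n → ℝ) → (Fin n → ℝ), Measurable g ∧
    ∀ x, g (nodeVals x) = x ∘ Tuple.sort x := by
  set s : Set (Fin n → ℝ) := {x | Monotone x}
  have hs : IsClosed s := by
    have : s = ⋂ i, ⋂ j, ⋂ (_ : i ≤ j), {x : Fin n → ℝ | x i ≤ x j} := by
      ext x
      simp [s, Monotone]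
    rw [this]
    exact isClosed_iInter fun i => isClosed_iInter fun j => isClosed_iInter fun _ =>
      isClosed_le (continuous_apply i) (continuous_apply j)
  have hinj : Set.InjOn (nodeVals (n := n)) s := fun x hx y hy hxy =>
    eq_of_rootPoly_eq_of_monotone (rootPoly_eq_of_nodeVals hxy) hx hy
  obtain ⟨g, hg, hgx⟩ := (continuous_nodeVals.continuousOn.measurableEmbedding hs.measurableSet
    hinj).exists_measurable_extend (g := Subtype.val) measurable_subtype_coe fun _ => inferInstance
  refine ⟨g, hg, fun x => ?_⟩
  have h1 := congrFun hgx ⟨x ∘ Tuple.sort x, Tuple.monotone_sort x⟩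
  simp only [Function.comp_apply, Set.domRestrict_apply] at h1
  rw [← h1]
  congr 1
  ext k
  rw [nodeVals_eq, nodeVals_eq, rootPoly_comp]

/-- The increasing rearrangement as a measurable function of `nodeVals`. -/
def sortOfVals (n : ℕ) : (Fin n → ℝ) → (Fin n → ℝ) := (exists_measurable_sort n).choose

theorem measurable_sortOfVals (n : ℕ) : Measurable (sortOfVals n) :=
  (exists_measurable_sort n).choose_spec.1

theorem sortOfVals_nodeVals {n : ℕ} (x : Fin n → ℝ) :
    sortOfVals n (nodeVals x) = x ∘ Tuple.sort x :=
  (exists_measurable_sort n).choose_spec.2 x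

theorem IsSymm.comp_sortOfVals {n : ℕ} {β : Type*} {f : (Fin n → ℝ) → β} (hf : IsSymm f)
    (x : Fin n → ℝ) : f (sortOfVals n (nodeVals x)) = f x := by
  rw [sortOfVals_nodeVals, hf]

/-! ### Eigenvalues -/

theorem rootPoly_eig {n : ℕ} (M : HermMat n) :
    (rootPoly (eig M)).map (algebraMap ℝ ℂ) = M.1.charpoly := by
  rw [M.2.charpoly_eq, rootPoly, Polynomial.map_prod]
  simp [eig]

theorem eig_eq_iff {n : ℕ} {M N : HermMat n} : eig M = eig N ↔ M.1.charpoly = N.1.charpoly :=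
  M.2.eigenvalues_eq_eigenvalues_iff N.2

theorem rootPoly_eig_eq_iff {n : ℕ} {M : HermMat n} {p : ℝ[X]} :
    rootPoly (eig M) = p ↔ M.1.charpoly = p.map (algebraMap ℝ ℂ) := by
  rw [← rootPoly_eig]
  exact (Polynomial.map_injective _ (algebraMap ℝ ℂ).injective).eq_iff.symm

/-- Expresses symmetric information on the spectrum as determinants in the matrix entries, so that
continuity of individual eigenvalues is never needed. -/
theorem nodeVals_eig {n : ℕ} (M : HermMat n) (k : Fin n) :
    nodeVals (eig M) k = ((Matrix.scalar (Fin n) (k : ℂ) - M.1).det).re := by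
  rw [← Matrix.eval_charpoly, ← rootPoly_eig, nodeVals_eq]
  have : ((k : ℕ) : ℂ) = algebraMap ℝ ℂ (k : ℝ) := by simp
  rw [this, eval_map_apply]
  simp

theorem continuous_nodeVals_eig {n : ℕ} : Continuous fun M : HermMat n => nodeVals (eig M) := by
  refine continuous_pi fun k => ?_
  simp_rw [nodeVals_eig]
  exact Complex.continuous_re.comp
    (Continuous.matrix_det (continuous_const.sub continuous_subtype_val))

/-- A symmetric function factors through the sorted tuple, which is a measurable function of the
continuous map `M ↦ det(k - M)`. -/
theorem IsSymm.measurable_comp_eig {n : ℕ} {β : Type*} [MeasurableSpace β] {f : (Fin n → ℝ) → β}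
    (hf : IsSymm f) (hm : Measurable f) : Measurable fun M : HermMat n => f (eig M) := by
  have : (fun M : HermMat n => f (eig M)) =
      f ∘ sortOfVals n ∘ fun M : HermMat n => nodeVals (eig M) := by
    ext M
    exact (hf.comp_sortOfVals _).symm
  rw [this]
  exact hm.comp ((measurable_sortOfVals n).comp continuous_nodeVals_eig.measurable)

theorem continuous_matrixOfCoords {n : ℕ} : Continuous (matrixOfCoords (n := n)) := by
  refine continuous_matrix fun j k => ?_
  unfold matrixOfCoords
  split_ifs <;> fun_prop

theorem continuous_hermOfCoords {n : ℕ} : Continuous (hermOfCoords (n := n)) :=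
  continuous_matrixOfCoords.subtype_mk _

theorem measurable_hermOfCoords {n : ℕ} : Measurable (hermOfCoords (n := n)) :=
  continuous_hermOfCoords.measurable

theorem isSymm_sum {n : ℕ} {β : Type*} [AddCommMonoid β] (g : ℝ → β) :
    IsSymm fun x : Fin n → ℝ => ∑ l, g (x l) :=
  fun σ x => Equiv.sum_comp σ fun l => g (x l)

theorem isSymm_prod {n : ℕ} {β : Type*} [CommMonoid β] (g : ℝ → β) :
    IsSymm fun x : Fin n → ℝ => ∏ l, g (x l) :=
  fun σ x => Equiv.prod_comp σ fun l => g (x l)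

/-! ### Symmetrization of integrals -/

theorem coe_piCongrLeft_const {n : ℕ} (α : Type*) [MeasurableSpace α] (σ : Equiv.Perm (Fin n)) :
    ⇑(MeasurableEquiv.piCongrLeft (fun _ : Fin n => α) σ.symm) = fun x => x ∘ σ := by
  ext x i
  rw [MeasurableEquiv.coe_piCongrLeft, Equiv.piCongrLeft_apply]
  exact eq_rec_constant _ _

theorem measurePreserving_comp_perm {n : ℕ} (σ : Equiv.Perm (Fin n)) :
    MeasurePreserving (fun x : Fin n → ℝ => x ∘ σ) := by
  have := volume_measurePreserving_piCongrLeft (fun _ : Fin n => ℝ) σ.symm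
  rwa [coe_piCongrLeft_const] at this

theorem measurePreserving_comp_perm_complex {n : ℕ} (σ : Equiv.Perm (Fin n)) :
    MeasurePreserving (fun x : Fin n → ℂ => x ∘ σ) := by
  have := volume_measurePreserving_piCongrLeft (fun _ : Fin n => ℂ) σ.symm
  rwa [coe_piCongrLeft_const] at this

/-- The open Weyl chamber of strictly increasing tuples. -/
def chamber (n : ℕ) : Set (Fin n → ℝ) := {x | StrictMono x}

theorem isOpen_chamber (n : ℕ) : IsOpen (chamber n) := by
  have : chamber n = ⋂ i, ⋂ j, {x : Fin n → ℝ | i < j → x i < x j} := by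
    ext x
    simp [chamber, StrictMono]
  rw [this]
  refine isOpen_iInter_of_finite fun i => isOpen_iInter_of_finite fun j => ?_
  by_cases h : i < j
  · simpa [h] using isOpen_lt (continuous_apply i) (continuous_apply j)
  · simp [h]

/-- A finite union of hyperplanes `xᵢ = xⱼ`. -/
theorem volume_not_injective (n : ℕ) :
    volume {x : Fin n → ℝ | ¬ Function.Injective x} = 0 := by
  have hsub : {x : Fin n → ℝ | ¬ Function.Injective x} ⊆
      ⋃ i : Fin n, ⋃ j : Fin n, {x : Fin n → ℝ | i ≠ j ∧ x i = x j} := fun x hx => by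
    simp only [Function.Injective, not_forall, Set.mem_ofPred_eq] at hx
    obtain ⟨i, j, hij, hne⟩ := hx
    simp only [Set.mem_iUnion, Set.mem_ofPred_eq]
    exact ⟨i, j, hne, hij⟩
  refine measure_mono_null hsub (measure_iUnion_null fun i => measure_iUnion_null fun j => ?_)
  by_cases h : i = j
  · simp [h]
  · set S : Submodule ℝ (Fin n → ℝ) :=
      LinearMap.ker (LinearMap.proj (R := ℝ) (φ := fun _ : Fin n => ℝ) i - LinearMap.proj j)
    have hS : {x : Fin n → ℝ | i ≠ j ∧ x i = x j} = (S : Set (Fin n → ℝ)) := by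
      ext x
      simp [S, h, sub_eq_zero]
    rw [hS]
    refine Measure.addHaar_submodule _ S fun htop => ?_
    have : (Pi.single i 1 : Fin n → ℝ) ∈ S := htop ▸ Submodule.mem_top
    simp [S, Ne.symm h] at this

theorem injective_ae (n : ℕ) : ∀ᵐ x : Fin n → ℝ, Function.Injective x :=
  ae_iff.2 (volume_not_injective n)

/-- Up to the null set of tuples with a repeated entry, space is the disjoint union of the `n!`
images of the chamber under permutations, and each contributes equally. -/
theorem lintegral_symm {n : ℕ} {f : (Fin n → ℝ) → ENNReal} (hf : IsSymm f) :
    ∫⁻ x, f x = n.factorial * ∫⁻ x in chamber n, f x := by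
  set A : Equiv.Perm (Fin n) → Set (Fin n → ℝ) := fun σ => (fun x => x ∘ σ) ⁻¹' chamber n
  have hAm : ∀ σ, MeasurableSet (A σ) := fun σ =>
    (measurePreserving_comp_perm σ).measurable (isOpen_chamber n).measurableSet
  have hunion : (⋃ σ, A σ) =ᵐ[volume] Set.univ := by
    refine Filter.eventuallyEq_univ.2 ?_
    filter_upwards [injective_ae n] with x hx
    exact Set.mem_iUnion.2 ⟨Tuple.sort x,
      (Tuple.monotone_sort x).strictMono_of_injective (hx.comp (Equiv.injective _))⟩
  have hdisj : Pairwise (Function.onFun Disjoint A) := fun σ τ hστ => by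
    refine Set.disjoint_left.2 fun x hσ hτ => hστ ?_
    have h1 : x ∘ σ = x ∘ τ := Tuple.unique_monotone
      (StrictMono.monotone hσ) (StrictMono.monotone hτ)
    have hx : Function.Injective x := by
      have := (StrictMono.injective hσ).comp σ.symm.injective
      simpa [Function.comp_assoc] using this
    exact Equiv.ext fun i => hx (congrFun h1 i)
  calc ∫⁻ x, f x = ∫⁻ x in ⋃ σ, A σ, f x := by
        rw [setLIntegral_congr hunion, Measure.restrict_univ]
    _ = ∑' σ, ∫⁻ x in A σ, f x := lintegral_iUnion hAm hdisj f
    _ = ∑ σ : Equiv.Perm (Fin n), ∫⁻ x in chamber n, f x := by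
        rw [tsum_fintype]
        refine Finset.sum_congr rfl fun σ _ => ?_
        have he : MeasurableEmbedding fun x : Fin n → ℝ => x ∘ σ := by
          rw [← coe_piCongrLeft_const]
          exact (MeasurableEquiv.piCongrLeft (fun _ : Fin n => ℝ) σ.symm).measurableEmbedding
        have := (measurePreserving_comp_perm σ).setLIntegral_comp_preimage_emb he f (chamber n)
        rw [← this]
        exact lintegral_congr fun x => (hf σ x).symm
    _ = _ := by simp [Fintype.card_perm]

end MatrixModel
end

/-! ### Reduction of a Hermitian matrix to arrowhead form -/

noncomputable section
namespace MatrixModel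

/-! ### Splitting off the first row of a Hermitian matrix -/

/-- The coordinates of the minor without the first row, the first row, and the corner entry. -/
def minorMap (n : ℕ) : Coords (n + 1) →ₗ[ℝ] Coords n × ((Fin n → ℂ) × ℝ) where
  toFun y := ((fun i => y.1 i.succ,
    fun p => y.2 ⟨(p.1.1.succ, p.1.2.succ), Fin.succ_lt_succ_iff.2 p.2⟩),
    (fun i => y.2 ⟨(0, i.succ), Fin.succ_pos i⟩, y.1 0))
  map_add' _ _ := rfl
  map_smul' _ _ := rfl

theorem minorMap_bijective (n : ℕ) : Function.Bijective (minorMap n) := by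
  constructor
  · rw [← LinearMap.ker_eq_bot, LinearMap.ker_eq_bot']
    intro y hy
    simp only [minorMap, LinearMap.coe_mk, AddHom.coe_mk, Prod.mk_eq_zero] at hy
    obtain ⟨⟨h1, h2⟩, h3, h4⟩ := hy
    refine Prod.ext (funext fun i => ?_) (funext fun p => ?_)
    · refine Fin.cases h4 (fun i => congrFun h1 i) i
    · obtain ⟨⟨j, k⟩, hjk⟩ := p
      induction k using Fin.cases with
      | zero => exact absurd hjk (Fin.not_lt_zero j)
      | succ k =>
        induction j using Fin.cases with
        | zero => exact congrFun h3 k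
        | succ j => exact congrFun h2 ⟨(j, k), Fin.succ_lt_succ_iff.1 hjk⟩
  · rintro ⟨x, v, a⟩
    refine ⟨(Fin.cons a x.1, fun p => if h : p.1.1 = 0 then
        v (p.1.2.pred (Fin.ne_zero_of_lt p.2))
      else x.2 ⟨(p.1.1.pred h, p.1.2.pred (Fin.ne_zero_of_lt p.2)),
        (Fin.pred_lt_pred_iff (ha := h) (hb := Fin.ne_zero_of_lt p.2)).2 p.2⟩), ?_⟩
    refine Prod.ext (Prod.ext ?_ ?_) (Prod.ext ?_ ?_)
    · ext i
      simp [minorMap]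
    · ext p
      simp [minorMap]
    · ext i
      simp [minorMap]
    · simp [minorMap]

/-- The coordinates of the Hermitian matrix with the given minor, first row and corner. -/
def border (n : ℕ) : (Coords n × ((Fin n → ℂ) × ℝ)) ≃ₗ[ℝ] Coords (n + 1) :=
  (LinearEquiv.ofBijective (minorMap n) (minorMap_bijective n)).symm

/-- A matrix bordered by a row and its conjugate transpose. -/
def blockMat {n : ℕ} (A : Matrix (Fin n) (Fin n) ℂ) (v : Fin n → ℂ) (a : ℝ) :
    Matrix (Fin n ⊕ Unit) (Fin n ⊕ Unit) ℂ :=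
  Matrix.fromBlocks A (Matrix.replicateRow Unit v).conjTranspose (Matrix.replicateRow Unit v)
    (Matrix.of fun _ _ => (a : ℂ))

/-- `Fin (n + 1)` as `Fin n` together with a first element. -/
def finSuccSum (n : ℕ) : Fin (n + 1) ≃ Fin n ⊕ Unit :=
  (finSuccEquiv n).trans (Equiv.optionEquivSumPUnit (Fin n))

@[simp] theorem finSuccSum_zero (n : ℕ) : finSuccSum n 0 = Sum.inr () := rfl

@[simp] theorem finSuccSum_succ {n : ℕ} (i : Fin n) : finSuccSum n i.succ = Sum.inl i := by
  simp [finSuccSum]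

theorem matrixOfCoords_eq_blockMat {n : ℕ} (y : Coords (n + 1)) : matrixOfCoords y =
    (blockMat (matrixOfCoords (minorMap n y).1) (minorMap n y).2.1 (minorMap n y).2.2).submatrix
      (finSuccSum n) (finSuccSum n) := by
  ext j k
  induction j using Fin.cases with
  | zero =>
    induction k using Fin.cases with
    | zero => simp [matrixOfCoords, blockMat, minorMap]
    | succ k => simp [matrixOfCoords, blockMat, minorMap]
  | succ j =>
    induction k using Fin.cases with
    | zero => simp [matrixOfCoords, blockMat, minorMap]
    | succ k => simp [matrixOfCoords, blockMat, minorMap]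

theorem charpoly_border {n : ℕ} (x : Coords n) (v : Fin n → ℂ) (a : ℝ) :
    (hermOfCoords (border n (x, v, a))).1.charpoly = (blockMat (matrixOfCoords x) v a).charpoly := by
  have h : minorMap n (border n (x, v, a)) = (x, v, a) :=
    (LinearEquiv.ofBijective (minorMap n) (minorMap_bijective n)).apply_symm_apply _
  change (matrixOfCoords (border n (x, v, a))).charpoly = _
  rw [matrixOfCoords_eq_blockMat, h]
  exact Matrix.charpoly_reindex (finSuccSum n).symm _

/-- The characteristic polynomial of an arrowhead matrix. -/
def arrowPoly {n : ℕ} (μ u : Fin n → ℝ) (a : ℝ) : ℝ[X] :=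
  (X - C a) * rootPoly μ - ∑ i, C (u i) * ∏ k ∈ Finset.univ.erase i, (X - C (μ k))

/-- Schur complement of the diagonal block. The row enters only through `|vᵢ|²`, so its phases do
not affect the spectrum. -/
theorem charpoly_blockMat_diagonal {n : ℕ} (μ : Fin n → ℝ) (v : Fin n → ℂ) (a : ℝ) :
    (blockMat (Matrix.diagonal fun i => (μ i : ℂ)) v a).charpoly =
      (arrowPoly μ (fun i => ‖v i‖ ^ 2) a).map (algebraMap ℝ ℂ) := by
  -- It suffices to compare at the infinitely many `t` distinct from all `μᵢ`, where the diagonal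
  -- block is invertible.
  refine Polynomial.eq_of_infinite_eval_eq _ _
    ((Set.finite_range fun i => (μ i : ℂ)).infinite_compl.mono fun t ht => ?_)
  have hne : ∀ i, t - (μ i : ℂ) ≠ 0 := fun i h0 => ht ⟨i, (sub_eq_zero.1 h0).symm⟩
  change Polynomial.eval t _ = Polynomial.eval t _
  rw [Matrix.eval_charpoly]
  have hsc : Matrix.scalar (Fin n ⊕ Unit) t - blockMat (Matrix.diagonal fun i => (μ i : ℂ)) v a =
      Matrix.fromBlocks (Matrix.diagonal fun i => t - (μ i : ℂ))
        (-(Matrix.replicateRow Unit v).conjTranspose) (-(Matrix.replicateRow Unit v))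
        (Matrix.of fun _ _ => t - (a : ℂ)) := by
    ext j k
    rcases j with j | j <;> rcases k with k | k
    · rcases eq_or_ne j k with rfl | hjk
      · simp [blockMat]
      · simp [blockMat, hjk]
    · simp [blockMat]
    · simp [blockMat]
    · simp [blockMat]
  let inst : Invertible (Matrix.diagonal fun i => t - (μ i : ℂ)) :=
    invertibleOfRightInverse _ (Matrix.diagonal fun i => (t - (μ i : ℂ))⁻¹) (by
      rw [Matrix.diagonal_mul_diagonal, ← Matrix.diagonal_one]
      congr 1
      ext i
      exact mul_inv_cancel₀ (hne i))
  have hinv : ⅟ (Matrix.diagonal fun i => t - (μ i : ℂ)) =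
      Matrix.diagonal fun i => (t - (μ i : ℂ))⁻¹ := rfl
  rw [hsc, Matrix.det_fromBlocks₁₁, hinv, Matrix.det_diagonal, Matrix.det_unique]
  have h1 : (-(Matrix.replicateRow Unit v) * (Matrix.diagonal fun i => (t - (μ i : ℂ))⁻¹) *
      -(Matrix.replicateRow Unit v).conjTranspose) default default =
      ∑ i, (‖v i‖ : ℂ) ^ 2 * (t - μ i)⁻¹ := by
    rw [Matrix.mul_apply]
    refine Finset.sum_congr rfl fun i _ => ?_
    rw [Matrix.mul_diagonal]
    simp only [Matrix.neg_apply, Matrix.replicateRow_apply, Matrix.conjTranspose_apply, RCLike.star_def]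
    rw [← Complex.mul_conj']
    ring
  rw [Matrix.sub_apply, h1, mul_sub, Finset.mul_sum]
  simp only [arrowPoly, rootPoly, Polynomial.map_sub, Polynomial.map_mul, Polynomial.map_prod,
    Polynomial.map_sum, map_X, map_C, eval_sub, eval_mul, eval_X, eval_C, eval_prod, eval_finsetSum,
    Matrix.of_apply]
  congr 1
  · rw [mul_comm]
    rfl
  · refine Finset.sum_congr rfl fun i _ => ?_
    rw [← Finset.mul_prod_erase _ _ (Finset.mem_univ i)]
    have := hne i
    simp only [Complex.coe_algebraMap]
    push_cast
    field_simp

theorem arrowPoly_comp_perm {n : ℕ} (μ u : Fin n → ℝ) (a : ℝ) (σ : Equiv.Perm (Fin n)) :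
    arrowPoly (μ ∘ σ) (u ∘ σ) a = arrowPoly μ u a := by
  rw [arrowPoly, arrowPoly, rootPoly_comp]
  congr 1
  rw [← Equiv.sum_comp σ fun i => C (u i) * ∏ k ∈ Finset.univ.erase i, (X - C (μ k))]
  refine Finset.sum_congr rfl fun i _ => ?_
  congr 1
  refine Finset.prod_bij (M := ℝ[X]) (fun k _ => σ k) (fun k hk => ?_) (fun _ _ _ _ h => σ.injective h)
    (fun k hk => ⟨σ.symm k, ?_, by simp⟩) (fun _ _ => rfl)
  · simpa using hk
  · simp only [Finset.mem_erase, Finset.mem_univ, and_true] at hk ⊢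
    rintro rfl
    simp at hk

/-- Conjugation by the block matrix `diag(U, 1)` diagonalises the minor and rotates the bordering
row. -/
theorem charpoly_blockMat_conj {n : ℕ} (U D : Matrix (Fin n) (Fin n) ℂ)
    (hU : U * U.conjTranspose = 1) (v : Fin n → ℂ) (a : ℝ) :
    (blockMat (U * D * U.conjTranspose) v a).charpoly =
      (blockMat D (Matrix.vecMul v U) a).charpoly := by
  have hU' : U.conjTranspose * U = 1 := mul_eq_one_comm.1 hU
  have hr : Matrix.replicateRow Unit (Matrix.vecMul v U) = Matrix.replicateRow Unit v * U := by
    ext i j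
    simp [Matrix.mul_apply, Matrix.vecMul, dotProduct]
  set W := Matrix.fromBlocks U 0 0 (1 : Matrix Unit Unit ℂ)
  set W' := Matrix.fromBlocks U.conjTranspose 0 0 (1 : Matrix Unit Unit ℂ)
  have h1 : blockMat (U * D * U.conjTranspose) v a = W * blockMat D (Matrix.vecMul v U) a * W' := by
    simp only [blockMat, W, W', hr, Matrix.fromBlocks_multiply, Matrix.conjTranspose_mul,
      Matrix.mul_zero, Matrix.zero_mul, add_zero, zero_add, Matrix.one_mul, Matrix.mul_one]
    rw [← Matrix.mul_assoc U, hU, Matrix.one_mul, Matrix.mul_assoc _ U, hU, Matrix.mul_one]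
  have h2 : W' * W = 1 := by
    simp [W, W', Matrix.fromBlocks_multiply, hU']
  rw [h1, Matrix.mul_assoc, Matrix.charpoly_mul_comm, Matrix.mul_assoc, h2, Matrix.mul_one]

/-- The coordinates of a real diagonal matrix. -/
def diagCoords {n : ℕ} (μ : Fin n → ℝ) : Coords n := (μ, 0)

theorem matrixOfCoords_diagCoords {n : ℕ} (μ : Fin n → ℝ) :
    matrixOfCoords (diagCoords μ) = Matrix.diagonal fun i => (μ i : ℂ) := by
  ext j k
  rcases lt_trichotomy j k with h | h | h
  · simp [matrixOfCoords, diagCoords, h, h.ne]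
  · subst h
    simp [matrixOfCoords, diagCoords]
  · simp [matrixOfCoords, diagCoords, h, h.not_gt, h.ne']

theorem rootPoly_eig_border_diag {n : ℕ} (μ : Fin n → ℝ) (v : Fin n → ℂ) (a : ℝ) :
    rootPoly (eig (hermOfCoords (border n (diagCoords μ, v, a)))) =
      arrowPoly μ (fun i => ‖v i‖ ^ 2) a := by
  rw [rootPoly_eig_eq_iff, charpoly_border, matrixOfCoords_diagCoords, charpoly_blockMat_diagonal]

/-- Spectral theorem for the minor. The unitary depends on the minor only, so for a fixed minor it
can be removed from the integral over the row. -/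
theorem exists_unitary_eig_border {n : ℕ} (x : Coords n) : ∃ U : Matrix (Fin n) (Fin n) ℂ,
    U * U.conjTranspose = 1 ∧ ∀ (v : Fin n → ℂ) (a : ℝ), eig (hermOfCoords (border n (x, v, a))) =
      eig (hermOfCoords (border n (diagCoords (eig (hermOfCoords x)), Matrix.vecMul v U, a))) := by
  have hM := isHermitian_matrixOfCoords x
  refine ⟨hM.eigenvectorUnitary, ?_, fun v a => ?_⟩
  · have := Unitary.mul_star_self_of_mem hM.eigenvectorUnitary.2
    rwa [Matrix.star_eq_conjTranspose] at this
  · rw [eig_eq_iff, charpoly_border, charpoly_border, matrixOfCoords_diagCoords,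
      ← charpoly_blockMat_conj]
    · congr 2
      have := hM.spectral_theorem
      rw [Unitary.conjStarAlgAut_apply] at this
      exact this
    · have := Unitary.mul_star_self_of_mem hM.eigenvectorUnitary.2
      rwa [Matrix.star_eq_conjTranspose] at this

/-! ### Unitary invariance of Lebesgue measure -/

theorem sum_norm_sq_vecMul {n : ℕ} {U : Matrix (Fin n) (Fin n) ℂ} (hU : U * U.conjTranspose = 1)
    (v : Fin n → ℂ) : ∑ i, ‖Matrix.vecMul v U i‖ ^ 2 = ∑ i, ‖v i‖ ^ 2 := by
  have key : ∀ w : Fin n → ℂ, w ⬝ᵥ star w = ((∑ i, ‖w i‖ ^ 2 : ℝ) : ℂ) := fun w => by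
    simp only [dotProduct, Pi.star_apply, RCLike.star_def]
    push_cast
    exact Finset.sum_congr rfl fun i _ => Complex.mul_conj' _
  have : Matrix.vecMul v U ⬝ᵥ star (Matrix.vecMul v U) = v ⬝ᵥ star v := by
    rw [Matrix.star_vecMul, Matrix.dotProduct_mulVec, Matrix.vecMul_vecMul, hU, Matrix.vecMul_one]
  rw [key, key] at this
  exact_mod_cast this

/-- By uniqueness of Haar measure the image is a multiple of Lebesgue measure; the invariant
Euclidean ball, of finite positive volume, forces the factor to be `1`. -/
theorem measurePreserving_of_sum_norm_sq {n : ℕ} (l : (Fin n → ℂ) ≃ₗ[ℝ] (Fin n → ℂ))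
    (hl : ∀ v, ∑ i, ‖l v i‖ ^ 2 = ∑ i, ‖v i‖ ^ 2) : MeasurePreserving l := by
  have hc : Continuous l := l.toContinuousLinearEquiv.continuous
  have hH : (Measure.map l (volume : Measure (Fin n → ℂ))).IsAddHaarMeasure :=
    ContinuousLinearEquiv.isAddHaarMeasure_map l.toContinuousLinearEquiv volume
  refine ⟨hc.measurable, ?_⟩
  have heq := Measure.isAddLeftInvariant_eq_smul (Measure.map l (volume : Measure (Fin n → ℂ)))
    volume
  set c := (Measure.map l (volume : Measure (Fin n → ℂ))).addHaarScalarFactor volume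
  -- The norm on the product is the sup norm, so the Euclidean ball is written out; it lies in the
  -- sup-norm unit ball and so has finite volume.
  set B : Set (Fin n → ℂ) := {v | ∑ i, ‖v i‖ ^ 2 < 1}
  have hBo : IsOpen B := isOpen_lt (by fun_prop) continuous_const
  have hB0 : volume B ≠ 0 := (hBo.measure_pos volume ⟨0, by simp [B]⟩).ne'
  have hBt : volume B ≠ ⊤ := by
    refine ((measure_mono fun v hv => ?_).trans_lt
      (measure_closedBall_lt_top (x := (0 : Fin n → ℂ)) (r := 1))).ne
    rw [mem_closedBall_zero_iff, pi_norm_le_iff_of_nonneg zero_le_one]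
    intro i
    have h1 : ‖v i‖ ^ 2 ≤ ∑ i, ‖v i‖ ^ 2 :=
      Finset.single_le_sum (f := fun i => ‖v i‖ ^ 2) (fun _ _ => sq_nonneg _) (Finset.mem_univ i)
    have h2 : ∑ i, ‖v i‖ ^ 2 < 1 := hv
    nlinarith [norm_nonneg (v i)]
  have hpre : l ⁻¹' B = B := by
    ext v
    simp only [B, Set.mem_preimage, Set.mem_ofPred_eq, hl]
  have h1 : Measure.map l (volume : Measure (Fin n → ℂ)) B = c • volume B := by
    rw [heq]; rfl
  rw [Measure.map_apply hc.measurable hBo.measurableSet, hpre] at h1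
  have hc1 : (c : ENNReal) = 1 := by
    rw [ENNReal.smul_def, smul_eq_mul] at h1
    exact (ENNReal.mul_left_inj hB0 hBt).1 (by rw [one_mul, ← h1])
  have hc1' : c = 1 := by exact_mod_cast hc1
  rw [heq, hc1', one_smul]

theorem measurePreserving_vecMul {n : ℕ} {U : Matrix (Fin n) (Fin n) ℂ}
    (hU : U * U.conjTranspose = 1) : MeasurePreserving fun v : Fin n → ℂ => Matrix.vecMul v U := by
  have hU' : U.conjTranspose * U = 1 := mul_eq_one_comm.1 hU
  exact measurePreserving_of_sum_norm_sq
    { toFun := fun v => Matrix.vecMul v U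
      map_add' := fun v w => Matrix.add_vecMul U v w
      map_smul' := fun c v => Matrix.smul_vecMul c v U
      invFun := fun v => Matrix.vecMul v U.conjTranspose
      left_inv := fun v => by simp only [Matrix.vecMul_vecMul, hU, Matrix.vecMul_one]
      right_inv := fun v => by simp only [Matrix.vecMul_vecMul, hU', Matrix.vecMul_one] }
    (sum_norm_sq_vecMul hU)

end MatrixModel
end

/-! ### Integrating out the first row -/

noncomputable section
namespace MatrixModel

/-! ### Squared moduli of complex coordinates -/

/-- Polar coordinates: the angle contributes `2π`, and `2π r dr = π d(r²)`. -/
theorem map_norm_sq_volume : Measure.map (fun z : ℂ => ‖z‖ ^ 2) volume =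
    ENNReal.ofReal Real.pi • volume.restrict (Set.Ioi (0 : ℝ)) := by
  refine Measure.ext_of_lintegral _ fun h hh => ?_
  rw [lintegral_map hh (by fun_prop), lintegral_smul_measure,
    ← Complex.lintegral_comp_polarCoord_symm, polarCoord_target, Measure.volume_eq_prod,
    ← Measure.prod_restrict]
  have h1 : ∀ p : ℝ × ℝ, ENNReal.ofReal p.1 • h (‖Complex.polarCoord.symm p‖ ^ 2) =
      ENNReal.ofReal p.1 * h (p.1 ^ 2) := fun p => by
    rw [Complex.norm_polarCoord_symm, sq_abs, smul_eq_mul]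
  simp_rw [h1]
  rw [lintegral_prod _ (by fun_prop)]
  simp only [lintegral_const, Measure.restrict_apply MeasurableSet.univ, Set.univ_inter,
    Real.volume_Ioo]
  have himg : (fun r : ℝ => r ^ 2) '' Set.Ioi 0 = Set.Ioi 0 := by
    ext x
    constructor
    · rintro ⟨r, hr, rfl⟩
      exact pow_pos (Set.mem_Ioi.1 hr) 2
    · intro hx
      exact ⟨Real.sqrt x, Real.sqrt_pos.2 hx, Real.sq_sqrt (le_of_lt hx)⟩
  have hcv := lintegral_image_eq_lintegral_abs_deriv_mul (s := Set.Ioi (0 : ℝ))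
    (f := fun r => r ^ 2) (f' := fun r => 2 * r) measurableSet_Ioi
    (fun x _ => by simpa using (hasDerivAt_pow 2 x).hasDerivWithinAt)
    (fun x hx y hy hxy => by
      rwa [pow_left_inj₀ (le_of_lt hx) (le_of_lt hy) two_ne_zero] at hxy) h
  rw [himg] at hcv
  rw [hcv, lintegral_mul_const _ (by fun_prop), mul_comm, smul_eq_mul]
  have h2 : ENNReal.ofReal (Real.pi - -Real.pi) = ENNReal.ofReal Real.pi * 2 := by
    rw [show Real.pi - -Real.pi = Real.pi * 2 by ring, ENNReal.ofReal_mul Real.pi_pos.le]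
    simp
  rw [h2, mul_assoc, ← lintegral_const_mul _ (by fun_prop)]
  congr 1
  refine setLIntegral_congr_fun measurableSet_Ioi fun r hr => ?_
  have hr : 0 < r := hr
  rw [abs_of_pos (by positivity), ENNReal.ofReal_mul (by norm_num), mul_assoc]
  simp

theorem map_norm_sq_pi (n : ℕ) :
    Measure.map (fun (v : Fin n → ℂ) i => ‖v i‖ ^ 2) volume =
      ENNReal.ofReal Real.pi ^ n • volume.restrict (Set.univ.pi fun _ : Fin n => Set.Ioi (0 : ℝ)) := by
  have hs : SigmaFinite (Measure.map (fun z : ℂ => ‖z‖ ^ 2) volume) := by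
    rw [map_norm_sq_volume, ← ENNReal.coe_toNNReal ENNReal.ofReal_ne_top, ← ENNReal.smul_def]
    infer_instance
  rw [volume_pi, Measure.pi_map_pi (f := fun _ (z : ℂ) => ‖z‖ ^ 2) (fun _ => by fun_prop)]
  refine Measure.pi_eq fun s hs => ?_
  rw [Measure.smul_apply, volume_pi, Measure.restrict_pi_pi, Measure.pi_pi]
  simp only [map_norm_sq_volume, Measure.smul_apply, smul_eq_mul]
  rw [Finset.prod_mul_distrib]
  simp

/-- Tuples all of whose entries but the first one are positive. -/
def tailPos (n : ℕ) : Set (Fin (n + 1) → ℝ) := {y | ∀ i : Fin n, 0 < y i.succ}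

theorem isOpen_tailPos (n : ℕ) : IsOpen (tailPos n) := by
  have : tailPos n = ⋂ i : Fin n, {y | 0 < y i.succ} := by
    ext y
    simp [tailPos]
  rw [this]
  exact isOpen_iInter_of_finite fun i => isOpen_lt continuous_const (continuous_apply _)

theorem lintegral_comp_norm_sq {n : ℕ} {h : (Fin (n + 1) → ℝ) → ENNReal} (hh : Measurable h) :
    ∫⁻ p : (Fin n → ℂ) × ℝ, h (Fin.cons p.2 fun i => ‖p.1 i‖ ^ 2) =
      ENNReal.ofReal Real.pi ^ n * ∫⁻ y in tailPos n, h y := by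
  have hm := volume_preserving_piFinSuccAbove (fun _ : Fin (n + 1) => ℝ) 0
  have he : ∀ y, MeasurableEquiv.piFinSuccAbove (fun _ : Fin (n + 1) => ℝ) 0 y =
      (y 0, fun i => y i.succ) := fun y => by
    rfl
  have hcons : Measurable fun q : ℝ × (Fin n → ℝ) => (Fin.cons q.1 q.2 : Fin (n + 1) → ℝ) := by
    refine measurable_pi_iff.2 fun i => ?_
    induction i using Fin.cases with
    | zero => simpa using measurable_fst
    | succ i => simpa [Function.comp_def] using (measurable_pi_apply i).comp measurable_snd
  have hpre : tailPos n = (MeasurableEquiv.piFinSuccAbove (fun _ : Fin (n + 1) => ℝ) 0) ⁻¹'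
      (Set.univ ×ˢ Set.univ.pi fun _ : Fin n => Set.Ioi (0 : ℝ)) := by
    ext y
    simp only [Set.mem_preimage, he]
    simp [tailPos]
  have h1 : ∫⁻ y in tailPos n, h y = ∫⁻ q in (Set.univ : Set ℝ) ×ˢ
      (Set.univ.pi fun _ : Fin n => Set.Ioi (0 : ℝ)), h (Fin.cons q.1 q.2) := by
    rw [hpre, ← hm.setLIntegral_comp_preimage_emb (MeasurableEquiv.measurableEmbedding _)]
    refine lintegral_congr fun y => ?_
    rw [he]
    congr 1
    exact (Fin.cons_self_tail y).symm
  rw [h1, Measure.volume_eq_prod, Measure.volume_eq_prod, ← Measure.prod_restrict,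
    lintegral_prod_symm _ (by fun_prop), lintegral_prod _ (by fun_prop), Measure.restrict_univ]
  have hin : Measurable fun a : ℝ => ∫⁻ u in Set.univ.pi fun _ : Fin n => Set.Ioi (0 : ℝ),
      h (Fin.cons a u) := Measurable.lintegral_prod_right' (hh.comp hcons)
  rw [← lintegral_const_mul _ hin]
  refine lintegral_congr fun a => ?_
  have hF : Measurable fun u : Fin n → ℝ => h (Fin.cons a u) := by fun_prop
  have := lintegral_map (μ := volume) hF
    (show Measurable fun (v : Fin n → ℂ) i => ‖v i‖ ^ 2 by fun_prop)
  rw [map_norm_sq_pi, lintegral_smul_measure] at this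
  exact this.symm

/-! ### Integrating out the first row -/

/-- The value of `f` at the eigenvalues of the arrowhead matrix with diagonal `y 0, μ` and
squared first row `y 1, …, y n`. -/
def arrowFun {n : ℕ} {β : Type*} (f : (Fin (n + 1) → ℝ) → β) (μ : Fin n → ℝ) (y : Fin (n + 1) → ℝ) :
    β :=
  f (eig (hermOfCoords (border n (diagCoords μ, (fun i => (Real.sqrt (y i.succ) : ℂ)), y 0))))

theorem continuous_border (n : ℕ) : Continuous (border n) :=
  (border n).toContinuousLinearEquiv.continuous

theorem IsSymm.measurable_arrowFun {n : ℕ} {f : (Fin (n + 1) → ℝ) → ENNReal} (hf : IsSymm f)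
    (hm : Measurable f) :
    Measurable fun q : (Fin n → ℝ) × (Fin (n + 1) → ℝ) => arrowFun f q.1 q.2 := by
  refine (hf.measurable_comp_eig hm).comp (measurable_hermOfCoords.comp
    ((continuous_border n).comp ?_).measurable)
  unfold diagCoords
  fun_prop

/-- The characteristic polynomial sees only the moduli `|vᵢ|²`, so the phases may be dropped and the
row replaced by nonnegative square roots. -/
theorem IsSymm.eq_arrowFun {n : ℕ} {β : Type*} {f : (Fin (n + 1) → ℝ) → β} (hf : IsSymm f)
    (μ : Fin n → ℝ) (v : Fin n → ℂ) (a : ℝ) :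
    f (eig (hermOfCoords (border n (diagCoords μ, v, a)))) =
      arrowFun f μ (Fin.cons a fun i => ‖v i‖ ^ 2) := by
  refine hf.eq_of_rootPoly_eq ?_
  rw [rootPoly_eig_border_diag, rootPoly_eig_border_diag]
  simp

theorem IsSymm.arrowFun_eq {n : ℕ} {β : Type*} {f : (Fin (n + 1) → ℝ) → β} (hf : IsSymm f)
    {μ : Fin n → ℝ} {y : Fin (n + 1) → ℝ} (hy : y ∈ tailPos n) {x : Fin (n + 1) → ℝ}
    (hx : rootPoly x = arrowPoly μ (fun i => y i.succ) (y 0)) : arrowFun f μ y = f x := by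
  refine hf.eq_of_rootPoly_eq ?_
  rw [rootPoly_eig_border_diag, hx]
  congr 1
  ext i
  simp [Real.sq_sqrt (hy i).le]

theorem IsSymm.lintegral_arrowFun {n : ℕ} {f : (Fin (n + 1) → ℝ) → ENNReal} (hf : IsSymm f)
    (hm : Measurable f) (μ : Fin n → ℝ) :
    ∫⁻ p : (Fin n → ℂ) × ℝ, f (eig (hermOfCoords (border n (diagCoords μ, p)))) =
      ENNReal.ofReal Real.pi ^ n * ∫⁻ y in tailPos n, arrowFun f μ y := by
  have hmeas : Measurable (arrowFun f μ) := (hf.measurable_arrowFun hm).of_uncurry_left (x := μ)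
  rw [← lintegral_comp_norm_sq hmeas]
  exact lintegral_congr fun p => hf.eq_arrowFun μ p.1 p.2

/-- Permuting `μ` amounts to permuting the row, which preserves Lebesgue measure. The symmetry is
verified on the integral over complex rows and the factor `π^n` is then cancelled. -/
theorem IsSymm.lintegral_tailPos_arrowFun {n : ℕ} {f : (Fin (n + 1) → ℝ) → ENNReal}
    (hf : IsSymm f) (hm : Measurable f) :
    IsSymm fun μ => ∫⁻ y in tailPos n, arrowFun f μ y := by
  intro σ μ
  have hpi : ENNReal.ofReal Real.pi ^ n ≠ 0 := pow_ne_zero _ (by simp [Real.pi_pos])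
  have hpi' : ENNReal.ofReal Real.pi ^ n ≠ ⊤ := ENNReal.pow_ne_top ENNReal.ofReal_ne_top
  refine (ENNReal.mul_right_inj hpi hpi').1 ?_
  rw [← hf.lintegral_arrowFun hm, ← hf.lintegral_arrowFun hm]
  have hmp := (measurePreserving_comp_perm_complex σ).prod (MeasurePreserving.id (volume : Measure ℝ))
  have hmeas : Measurable fun p : (Fin n → ℂ) × ℝ =>
      f (eig (hermOfCoords (border n (diagCoords (μ ∘ σ), p)))) := by
    refine (hf.measurable_comp_eig hm).comp (measurable_hermOfCoords.comp
      ((continuous_border n).comp ?_).measurable)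
    fun_prop
  have := hmp.lintegral_comp hmeas
  rw [← Measure.volume_eq_prod] at this
  rw [← this]
  refine lintegral_congr fun p => hf.eq_of_rootPoly_eq ?_
  obtain ⟨v, a⟩ := p
  simp only [Prod.map_apply, id]
  rw [rootPoly_eig_border_diag, rootPoly_eig_border_diag]
  exact arrowPoly_comp_perm μ (fun i => ‖v i‖ ^ 2) a σ

theorem lintegral_hermVolume {n : ℕ} {g : HermMat n → ENNReal} (hg : Measurable g) :
    ∫⁻ M, g M ∂hermVolume n = ∫⁻ x : Coords n, g (hermOfCoords x) :=
  lintegral_map hg measurable_hermOfCoords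

instance isAddHaarMeasure_coords (n : ℕ) : (volume : Measure (Coords n)).IsAddHaarMeasure :=
  Measure.prod.instIsAddHaarMeasure _ _

instance isAddHaarMeasure_coords_prod (n : ℕ) :
    (volume : Measure (Coords n × ((Fin n → ℂ) × ℝ))).IsAddHaarMeasure :=
  have : (volume : Measure ((Fin n → ℂ) × ℝ)).IsAddHaarMeasure :=
    Measure.prod.instIsAddHaarMeasure _ _
  Measure.prod.instIsAddHaarMeasure _ _

/-- The inductive step for the Weyl formula. The constant is `π^n` times the Haar scalar of the
linear bijection `border`; inside, the unitary diagonalising the minor is absorbed by invariance of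
Lebesgue measure on the row. -/
theorem exists_lintegral_hermVolume_succ (n : ℕ) : ∃ c : ENNReal, c ≠ 0 ∧ c ≠ ⊤ ∧
    ∀ f : (Fin (n + 1) → ℝ) → ENNReal, IsSymm f → Measurable f →
      ∫⁻ M, f (eig M) ∂hermVolume (n + 1) =
        c * ∫⁻ M, (∫⁻ y in tailPos n, arrowFun f (eig M) y) ∂hermVolume n := by
  have hH : (Measure.map (border n) volume).IsAddHaarMeasure :=
    ContinuousLinearEquiv.isAddHaarMeasure_map (border n).toContinuousLinearEquiv volume
  have heq := Measure.isAddLeftInvariant_eq_smul (volume : Measure (Coords (n + 1)))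
    (Measure.map (border n) volume)
  set c := (volume : Measure (Coords (n + 1))).addHaarScalarFactor (Measure.map (border n) volume)
  have hc : c ≠ 0 := (Measure.addHaarScalarFactor_pos_of_isAddHaarMeasure _ _).ne'
  have hpi : ENNReal.ofReal Real.pi ^ n ≠ 0 := pow_ne_zero _ (by simp [Real.pi_pos])
  have hpi' : ENNReal.ofReal Real.pi ^ n ≠ ⊤ := ENNReal.pow_ne_top ENNReal.ofReal_ne_top
  refine ⟨c * ENNReal.ofReal Real.pi ^ n, mul_ne_zero (by simpa using hc) hpi,
    ENNReal.mul_ne_top ENNReal.coe_ne_top hpi', fun f hf hm => ?_⟩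
  have hfe := hf.measurable_comp_eig hm
  have hG : Measurable fun μ : Fin n → ℝ => ∫⁻ y in tailPos n, arrowFun f μ y :=
    Measurable.lintegral_prod_right' (hf.measurable_arrowFun hm)
  have hGe := (hf.lintegral_tailPos_arrowFun hm).measurable_comp_eig hG
  have hb : Measurable fun q => f (eig (hermOfCoords (border n q))) :=
    hfe.comp (measurable_hermOfCoords.comp (continuous_border n).measurable)
  rw [lintegral_hermVolume hfe, lintegral_hermVolume hGe, heq, lintegral_smul_measure,
    lintegral_map (f := fun y => f (eig (hermOfCoords y))) (hfe.comp measurable_hermOfCoords)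
      (continuous_border n).measurable,
    ENNReal.smul_def, smul_eq_mul, mul_assoc, Measure.volume_eq_prod, lintegral_prod _ hb.aemeasurable,
    ← lintegral_const_mul _ (f := fun x => ∫⁻ y in tailPos n, arrowFun f (eig (hermOfCoords x)) y)
      (hGe.comp measurable_hermOfCoords)]
  congr 1
  refine lintegral_congr fun x => ?_
  rw [← hf.lintegral_arrowFun hm]
  obtain ⟨U, hU, hUx⟩ := exists_unitary_eig_border x
  have hmp := (measurePreserving_vecMul hU).prod (MeasurePreserving.id (volume : Measure ℝ))
  have hmeas : Measurable fun p : (Fin n → ℂ) × ℝ =>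
      f (eig (hermOfCoords (border n (diagCoords (eig (hermOfCoords x)), p)))) :=
    hb.comp measurable_prodMk_left
  have := hmp.lintegral_comp hmeas
  rw [← Measure.volume_eq_prod] at this
  rw [← this]
  exact lintegral_congr fun p => congrArg f (hUx p.1 p.2)

end MatrixModel
end

/-! ### Change of variables from arrowhead entries to eigenvalues -/

noncomputable section
namespace MatrixModel

/-! ### Arrowhead coordinates of the eigenvalues -/

/-- The Vandermonde determinant. -/
def vdet {n : ℕ} (x : Fin n → ℝ) : ℝ := (Matrix.vandermonde x).det

/-- `∏_{k ≠ i} (xᵢ - xₖ)`. -/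
def nodeProd {n : ℕ} (x : Fin n → ℝ) (i : Fin n) : ℝ := ∏ k ∈ Finset.univ.erase i, (x i - x k)

theorem nodeProd_ne_zero {n : ℕ} {x : Fin n → ℝ} (hx : Function.Injective x) (i : Fin n) :
    nodeProd x i ≠ 0 :=
  Finset.prod_ne_zero_iff.2 fun _ hk => sub_ne_zero.2 fun h => Finset.ne_of_mem_erase hk (hx h).symm

theorem vdet_ne_zero {n : ℕ} {x : Fin n → ℝ} (hx : Function.Injective x) : vdet x ≠ 0 :=
  Matrix.det_vandermonde_ne_zero_iff.2 hx

theorem continuous_vdet {n : ℕ} : Continuous (vdet (n := n)) := by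
  unfold vdet
  refine Continuous.matrix_det (continuous_matrix fun i j => ?_)
  simp only [Matrix.vandermonde_apply]
  fun_prop

/-- Every unordered pair occurs twice, once from each end. -/
theorem prod_abs_nodeProd {n : ℕ} (x : Fin n → ℝ) : |∏ i, nodeProd x i| = vdet x ^ 2 := by
  have h := Finset.prod_prod_Ioi_mul_eq_prod_prod_off_diag (fun i j : Fin n => |x i - x j|)
  rw [vdet, Matrix.det_vandermonde, ← sq_abs, Finset.abs_prod, Finset.abs_prod, sq,
    ← Finset.prod_mul_distrib]
  have h1 : ∀ i, |nodeProd x i| = ∏ j ∈ {i}ᶜ, |x j - x i| := fun i => by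
    rw [nodeProd, Finset.abs_prod]
    refine Finset.prod_congr (by ext; simp) fun j _ => abs_sub_comm _ _
  simp_rw [h1]
  rw [← h]
  refine Finset.prod_congr rfl fun i _ => ?_
  rw [Finset.abs_prod, ← Finset.prod_mul_distrib]
  exact Finset.prod_congr rfl fun j _ => by rw [abs_sub_comm (x i)]

/-- The corner entry and the squared first row of the arrowhead matrix with diagonal `μ` and
eigenvalues `x`. -/
def arrowCoords {n : ℕ} (μ : Fin n → ℝ) (x : Fin (n + 1) → ℝ) : Fin (n + 1) → ℝ :=
  Fin.cons (∑ j, x j - ∑ i, μ i) fun i => -(∏ j, (μ i - x j)) / nodeProd μ i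

theorem degree_sum_lt {n : ℕ} (μ u : Fin n → ℝ) :
    (∑ i, C (u i) * ∏ k ∈ Finset.univ.erase i, (X - C (μ k))).degree < n := by
  refine (degree_sum_le _ _).trans_lt ((Finset.sup_lt_iff (WithBot.bot_lt_coe n)).2 fun i _ => ?_)
  have h1 : (C (u i) * ∏ k ∈ Finset.univ.erase i, (X - C (μ k))).natDegree ≤ n - 1 := by
    refine (natDegree_C_mul_le _ _).trans ?_
    rw [natDegree_prod_of_monic _ _ fun j _ => monic_X_sub_C (μ j)]
    simp
  refine degree_le_natDegree.trans_lt (Nat.cast_lt.2 (h1.trans_lt ?_))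
  have := i.2
  omega

theorem coeff_rootPoly {n : ℕ} (x : Fin (n + 1) → ℝ) : (rootPoly x).coeff n = -∑ j, x j := by
  have := prod_X_sub_C_nextCoeff (s := Finset.univ) x
  rw [← this, nextCoeff_of_natDegree_pos]
  · change (rootPoly x).coeff n = (rootPoly x).coeff ((rootPoly x).natDegree - 1)
    rw [natDegree_rootPoly, Nat.add_sub_cancel]
  · change 0 < (rootPoly x).natDegree
    rw [natDegree_rootPoly]
    omega

theorem rootPoly_cons {n : ℕ} (a : ℝ) (μ : Fin n → ℝ) :
    rootPoly (Fin.cons a μ : Fin (n + 1) → ℝ) = (X - C a) * rootPoly μ := by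
  simp [rootPoly, Fin.prod_univ_succ]

theorem coeff_arrowPoly {n : ℕ} (μ u : Fin n → ℝ) (a : ℝ) :
    (arrowPoly μ u a).coeff n = -(a + ∑ i, μ i) := by
  rw [arrowPoly, coeff_sub, coeff_eq_zero_of_degree_lt (degree_sum_lt μ u), ← rootPoly_cons,
    coeff_rootPoly, Fin.sum_univ_succ]
  simp

theorem eval_arrowPoly {n : ℕ} (μ u : Fin n → ℝ) (a : ℝ) (i : Fin n) :
    (arrowPoly μ u a).eval (μ i) = -(u i * nodeProd μ i) := by
  rw [arrowPoly, eval_sub, eval_mul, eval_rootPoly,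
    Finset.prod_eq_zero (Finset.mem_univ i) (sub_self _), mul_zero, zero_sub, eval_finsetSum,
    Finset.sum_eq_single i]
  · simp [eval_prod, nodeProd]
  · intro j _ hji
    rw [eval_mul, eval_prod, Finset.prod_eq_zero (i := i), mul_zero]
    · exact Finset.mem_erase.2 ⟨hji.symm, Finset.mem_univ _⟩
    · simp
  · simp

/-- The corner is read off from the coefficient of `X^n`, which is minus the trace, and the squared
row entries from the values at the `μᵢ`. -/
theorem arrowCoords_eq_of_rootPoly {n : ℕ} {μ : Fin n → ℝ} (hμ : Function.Injective μ)
    {x y : Fin (n + 1) → ℝ} (h : rootPoly x = arrowPoly μ (fun i => y i.succ) (y 0)) :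
    arrowCoords μ x = y := by
  ext i
  induction i using Fin.cases with
  | zero =>
    have := congrArg (fun p => p.coeff n) h
    simp only [coeff_rootPoly, coeff_arrowPoly] at this
    simp only [arrowCoords, Fin.cons_zero]
    linarith
  | succ i =>
    have := congrArg (fun p => p.eval (μ i)) h
    simp only [eval_rootPoly, eval_arrowPoly] at this
    simp only [arrowCoords, Fin.cons_succ]
    rw [this, neg_neg, mul_div_cancel_right₀ _ (nodeProd_ne_zero hμ i)]

/-- The two sides agree in the coefficients of `X^(n+1)` and `X^n`, so their difference has degree
below `n`; it vanishes at the `n` distinct `μᵢ`. -/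
theorem rootPoly_eq_arrowPoly {n : ℕ} {μ : Fin n → ℝ} (hμ : Function.Injective μ)
    (x : Fin (n + 1) → ℝ) :
    rootPoly x = arrowPoly μ (fun i => arrowCoords μ x i.succ) (arrowCoords μ x 0) := by
  rw [← sub_eq_zero]
  refine eq_zero_of_degree_lt_of_eval_index_eq_zero (v := μ) Finset.univ hμ.injOn ?_
    (fun i _ => ?_)
  · rw [Finset.card_univ, Fintype.card_fin, degree_lt_iff_coeff_zero]
    intro m hm
    rcases hm.eq_or_lt with rfl | hm
    · rw [coeff_sub, coeff_rootPoly, coeff_arrowPoly]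
      simp [arrowCoords]
    · have hS := coeff_eq_zero_of_degree_lt ((degree_sum_lt μ fun i => arrowCoords μ x i.succ).trans_le
        (Nat.cast_le.2 hm.le : (n : WithBot ℕ) ≤ m))
      rw [coeff_sub, arrowPoly, coeff_sub, hS, sub_zero, ← rootPoly_cons]
      rcases (Nat.succ_le_of_lt hm).eq_or_lt with rfl | hm
      · have h1 : ∀ z : Fin (n + 1) → ℝ, (rootPoly z).coeff n.succ = 1 := fun z => by
          have := (rootPoly_monic z).coeff_natDegree
          rwa [natDegree_rootPoly] at this
        rw [h1, h1, sub_self]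
      · rw [coeff_eq_zero_of_natDegree_lt (by rwa [natDegree_rootPoly]),
          coeff_eq_zero_of_natDegree_lt (by rwa [natDegree_rootPoly]), sub_zero]
  · rw [eval_sub, eval_rootPoly, eval_arrowPoly]
    simp only [arrowCoords, Fin.cons_succ]
    rw [div_mul_cancel₀ _ (nodeProd_ne_zero hμ i)]
    ring

/-- Surjectivity: an arrowhead polynomial with positive weights is the characteristic polynomial of
a Hermitian matrix, so it has only real roots. -/
theorem exists_monotone_arrowCoords {n : ℕ} {μ : Fin n → ℝ} (hμ : Function.Injective μ)
    {y : Fin (n + 1) → ℝ} (hy : y ∈ tailPos n) : ∃ x, Monotone x ∧ arrowCoords μ x = y := by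
  set e := eig (hermOfCoords (border n (diagCoords μ, (fun i => (Real.sqrt (y i.succ) : ℂ)), y 0)))
  refine ⟨e ∘ Tuple.sort e, Tuple.monotone_sort e, arrowCoords_eq_of_rootPoly hμ ?_⟩
  rw [rootPoly_comp, rootPoly_eig_border_diag]
  congr 1
  ext i
  simp [Real.sq_sqrt (hy i).le]

theorem injOn_arrowCoords {n : ℕ} {μ : Fin n → ℝ} (hμ : Function.Injective μ) :
    Set.InjOn (arrowCoords μ) (chamber (n + 1)) := fun x hx y hy hxy =>
  eq_of_rootPoly_eq_of_monotone
    (by rw [rootPoly_eq_arrowPoly hμ x, hxy, ← rootPoly_eq_arrowPoly hμ y])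
    (StrictMono.monotone hx) (StrictMono.monotone hy)

/-! ### The Jacobian of the arrowhead coordinates -/

/-- The Jacobian matrix of `arrowCoords μ`. -/
def arrowJacobian {n : ℕ} (μ : Fin n → ℝ) (x : Fin (n + 1) → ℝ) :
    Matrix (Fin (n + 1)) (Fin (n + 1)) ℝ := fun i j =>
  (Fin.cons 1 (fun i => (∏ k ∈ Finset.univ.erase j, (μ i - x k)) / nodeProd μ i) :
    Fin (n + 1) → ℝ) i

theorem hasFDerivAt_arrowCoords {n : ℕ} (μ : Fin n → ℝ) (x : Fin (n + 1) → ℝ) :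
    HasFDerivAt (arrowCoords μ) (Matrix.toLin' (arrowJacobian μ x)).toContinuousLinearMap x := by
  rw [hasFDerivAt_pi']
  intro i
  induction i using Fin.cases with
  | zero =>
    have h : HasFDerivAt (fun x : Fin (n + 1) → ℝ => ∑ j, x j - ∑ i, μ i)
        (∑ j, ContinuousLinearMap.proj (R := ℝ) (φ := fun _ : Fin (n + 1) => ℝ) j) x :=
      (HasFDerivAt.fun_sum fun j _ => hasFDerivAt_apply j x).sub_const _
    refine (h.congr_fderiv ?_)
    ext v
    simp [Matrix.mulVec, dotProduct, arrowJacobian]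
  | succ i =>
    have h1 := HasFDerivAt.finsetProd (u := Finset.univ) (x := x)
      (g := fun (j : Fin (n + 1)) (x : Fin (n + 1) → ℝ) => μ i - x j)
      (g' := fun j => -ContinuousLinearMap.proj (R := ℝ) (φ := fun _ : Fin (n + 1) => ℝ) j)
      fun j _ => (hasFDerivAt_apply j x).const_sub (μ i)
    have h2 := (h1.neg).mul_const (nodeProd μ i)⁻¹
    refine (h2.congr_fderiv ?_)
    ext v
    simp [Matrix.mulVec, dotProduct, arrowJacobian, Finset.mul_sum]
    refine Finset.sum_congr rfl fun j _ => ?_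
    ring

theorem lagrange_basis_eq {n : ℕ} (x : Fin n → ℝ) (j : Fin n) :
    Lagrange.basis Finset.univ x j =
      C (nodeProd x j)⁻¹ * ∏ k ∈ Finset.univ.erase j, (X - C (x k)) := by
  rw [Lagrange.basis, nodeProd, ← Finset.prod_inv_distrib, map_prod, ← Finset.prod_mul_distrib]
  rfl

/-- After removing the factors `1 / nodeProd μ i`, the Jacobian is a matrix `D` of Cauchy type. Its
determinant is found by Lagrange interpolation instead of the Cauchy formula. -/
theorem abs_det_arrowJacobian {n : ℕ} {μ : Fin n → ℝ} (hμ : Function.Injective μ)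
    {x : Fin (n + 1) → ℝ} (hx : Function.Injective x) :
    |(arrowJacobian μ x).det| = |vdet x| / |vdet μ| := by
  -- `E` and `D` apply the same functionals, the coefficient of `X^n` and evaluation at each `μᵢ`,
  -- to the monomials `X^m` and to the products `∏_{k≠j} (X - x_k)`. Interpolating `X^m` at the
  -- `x_j` relates them, and `|det E| = |vdet μ|` because the top row of `E` is a unit vector.
  set E : Matrix (Fin (n + 1)) (Fin (n + 1)) ℝ := fun i m =>
    (Fin.cons (if m = Fin.last n then 1 else 0) (fun i => μ i ^ (m : ℕ)) : Fin (n + 1) → ℝ) i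
  set D : Matrix (Fin (n + 1)) (Fin (n + 1)) ℝ := fun i j =>
    (Fin.cons 1 (fun i => ∏ k ∈ Finset.univ.erase j, (μ i - x k)) : Fin (n + 1) → ℝ) i
  have hJ : arrowJacobian μ x =
      Matrix.diagonal (Fin.cons 1 fun i => (nodeProd μ i)⁻¹ : Fin (n + 1) → ℝ) * D := by
    ext i j
    rw [Matrix.diagonal_mul]
    induction i using Fin.cases with
    | zero => simp [arrowJacobian, D]
    | succ i => simp [arrowJacobian, D, div_eq_inv_mul]
  have hlag : ∀ m : Fin (n + 1), (X ^ (m : ℕ) : ℝ[X]) =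
      ∑ j, C (x j ^ (m : ℕ)) *
        (C (nodeProd x j)⁻¹ * ∏ k ∈ Finset.univ.erase j, (X - C (x k))) := fun m => by
    have := Lagrange.eq_interpolate (s := Finset.univ) (v := x) (f := (X ^ (m : ℕ) : ℝ[X]))
      hx.injOn (by
        rw [degree_X_pow, Finset.card_univ, Fintype.card_fin]
        exact Nat.cast_lt.2 m.2)
    conv_lhs => rw [this]
    rw [Lagrange.interpolate_apply]
    simp only [eval_pow, eval_X, lagrange_basis_eq]
  have hE : E = D * Matrix.diagonal (fun j => (nodeProd x j)⁻¹) * Matrix.vandermonde x := by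
    ext i m
    rw [Matrix.mul_apply]
    simp only [Matrix.mul_diagonal, Matrix.vandermonde_apply]
    induction i using Fin.cases with
    | zero =>
      have := congrArg (fun p => p.coeff n) (hlag m)
      simp only [finsetSum_coeff, coeff_C_mul, coeff_X_pow] at this
      have h1 : ∀ j : Fin (n + 1), (∏ k ∈ Finset.univ.erase j, (X - C (x k))).coeff n = 1 := by
        intro j
        have hm : (∏ k ∈ Finset.univ.erase j, (X - C (x k))).Monic :=
          monic_prod_of_monic _ _ fun k _ => monic_X_sub_C (x k)
        have hd : (∏ k ∈ Finset.univ.erase j, (X - C (x k))).natDegree = n := by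
          rw [natDegree_prod_of_monic _ _ fun k _ => monic_X_sub_C (x k)]
          simp
        have := hm.coeff_natDegree
        rwa [hd] at this
      simp only [E, D, Fin.cons_zero, one_mul]
      calc (if m = Fin.last n then (1 : ℝ) else 0) = if n = (m : ℕ) then 1 else 0 := by
            congr 1
            rw [Fin.ext_iff, Fin.val_last]
            exact propext eq_comm
        _ = _ := by
            rw [this]
            exact Finset.sum_congr rfl fun j _ => by rw [h1]; ring
    | succ i =>
      have := congrArg (fun p => p.eval (μ i)) (hlag m)
      simp only [eval_finsetSum, eval_mul, eval_C, eval_pow, eval_X, eval_prod, eval_sub] at this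
      simp only [E, D, Fin.cons_succ]
      rw [this]
      exact Finset.sum_congr rfl fun j _ => by ring
  have hdetE : |E.det| = |vdet μ| := by
    rw [Matrix.det_succ_row_zero, Finset.sum_eq_single (Fin.last n)]
    · have : E.submatrix Fin.succ (Fin.last n).succAbove = Matrix.vandermonde μ := by
        ext i m
        rw [Matrix.submatrix_apply, Fin.succAbove_last, Matrix.vandermonde_apply]
        simp only [E, Fin.cons_succ, Fin.val_castSucc]
      rw [this, abs_mul, abs_mul, abs_pow]
      simp [E, vdet]
    · intro m _ hm
      simp [E, hm]
    · simp
  have hx0 : vdet x ≠ 0 := vdet_ne_zero hx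
  have hμ0 : vdet μ ≠ 0 := vdet_ne_zero hμ
  have h1 : |E.det| = |D.det| * (vdet x ^ 2)⁻¹ * |vdet x| := by
    rw [hE, Matrix.det_mul, Matrix.det_mul, Matrix.det_diagonal, abs_mul, abs_mul,
      Finset.prod_inv_distrib, abs_inv, prod_abs_nodeProd, vdet]
  have h2 : |(arrowJacobian μ x).det| = (vdet μ ^ 2)⁻¹ * |D.det| := by
    rw [hJ, Matrix.det_mul, Matrix.det_diagonal, abs_mul, Fin.prod_univ_succ]
    simp only [Fin.cons_zero, Fin.cons_succ, one_mul]
    rw [Finset.prod_inv_distrib, abs_inv, prod_abs_nodeProd]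
  have hxa : |vdet x| ≠ 0 := abs_ne_zero.2 hx0
  have hμa : |vdet μ| ≠ 0 := abs_ne_zero.2 hμ0
  rw [hdetE, ← sq_abs (vdet x)] at h1
  rw [h2, ← sq_abs (vdet μ)]
  have h3 : |D.det| = |vdet μ| * |vdet x| := by
    rw [h1]
    field_simp
  rw [h3]
  field_simp

/-! ### The change of variables -/

/-- The only missed points come from tuples with repeated entries, whose image is null because a
differentiable map between spaces of equal dimension preserves null sets. -/
theorem image_arrowCoords_ae_eq {n : ℕ} {μ : Fin n → ℝ} (hμ : Function.Injective μ) :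
    arrowCoords μ '' (chamber (n + 1) ∩ arrowCoords μ ⁻¹' tailPos n) =ᵐ[volume] tailPos n := by
  have hnull : volume (arrowCoords μ '' {x : Fin (n + 1) → ℝ | ¬ Function.Injective x}) = 0 :=
    addHaar_image_eq_zero_of_differentiableOn_of_addHaar_eq_zero volume
      (fun x _ => (hasFDerivAt_arrowCoords μ x).differentiableAt.differentiableWithinAt)
      (volume_not_injective _)
  have hae : ∀ᵐ y : Fin (n + 1) → ℝ,
      y ∉ arrowCoords μ '' {x : Fin (n + 1) → ℝ | ¬ Function.Injective x} :=
    measure_eq_zero_iff_ae_notMem.1 hnull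
  filter_upwards [hae] with y hy
  refine propext ⟨?_, fun hyt => ?_⟩
  · rintro ⟨x, hx, rfl⟩
    exact hx.2
  · obtain ⟨x, hx, rfl⟩ := exists_monotone_arrowCoords hμ hyt
    refine ⟨x, ⟨hx.strictMono_of_injective ?_, hyt⟩, rfl⟩
    by_contra hinj
    exact hy ⟨x, hinj, rfl⟩

theorem measurable_nodeProd {n : ℕ} (i : Fin n) : Measurable fun μ : Fin n → ℝ => nodeProd μ i := by
  unfold nodeProd
  fun_prop

theorem measurable_arrowCoords {n : ℕ} :
    Measurable fun q : (Fin n → ℝ) × (Fin (n + 1) → ℝ) => arrowCoords q.1 q.2 := by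
  refine measurable_pi_iff.2 fun i => ?_
  induction i using Fin.cases with
  | zero => simp only [arrowCoords, Fin.cons_zero]; fun_prop
  | succ i =>
    simp only [arrowCoords, Fin.cons_succ]
    exact Measurable.div (by fun_prop) ((measurable_nodeProd i).comp measurable_fst)

theorem IsSymm.lintegral_tailPos_eq {n : ℕ} {f : (Fin (n + 1) → ℝ) → ENNReal} (hf : IsSymm f)
    {μ : Fin n → ℝ} (hμ : Function.Injective μ) :
    ∫⁻ y in tailPos n, arrowFun f μ y =
      ∫⁻ x in chamber (n + 1) ∩ arrowCoords μ ⁻¹' tailPos n,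
        ENNReal.ofReal (|vdet x| / |vdet μ|) * f x := by
  have hs : MeasurableSet (chamber (n + 1) ∩ arrowCoords μ ⁻¹' tailPos n) :=
    (isOpen_chamber _).measurableSet.inter
      (measurable_arrowCoords.of_uncurry_left (x := μ) (isOpen_tailPos n).measurableSet)
  rw [← setLIntegral_congr (image_arrowCoords_ae_eq hμ),
    lintegral_image_eq_lintegral_abs_det_fderiv_mul volume hs
      (fun x _ => (hasFDerivAt_arrowCoords μ x).hasFDerivWithinAt)
      ((injOn_arrowCoords hμ).mono Set.inter_subset_left)]
  refine setLIntegral_congr_fun hs fun x hx => ?_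
  have hinj : Function.Injective x := StrictMono.injective hx.1
  rw [hf.arrowFun_eq hx.2 (rootPoly_eq_arrowPoly hμ x), ContinuousLinearMap.det,
    LinearMap.coe_toContinuousLinearMap, LinearMap.det_toLin', abs_det_arrowJacobian hμ hinj]

end MatrixModel
end

/-! ### Interlacing and the Weyl integration formula -/

noncomputable section
namespace MatrixModel

/-! ### Interlacing -/

theorem prod_sub_sign {ι : Type*} (s : Finset ι) (x : ι → ℝ) {t : ℝ} (ht : ∀ j ∈ s, t ≠ x j) :
    0 < (-1 : ℝ) ^ (s.filter fun j => t < x j).card * ∏ j ∈ s, (t - x j) := by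
  have h1 : (-1 : ℝ) ^ (s.filter fun j => t < x j).card = ∏ j ∈ s, if t < x j then -1 else 1 := by
    rw [Finset.prod_ite, Finset.prod_const, Finset.prod_const_one, mul_one]
  rw [h1, ← Finset.prod_mul_distrib]
  refine Finset.prod_pos fun j hj => ?_
  split_ifs with h
  · linarith
  · have := lt_of_le_of_ne (not_lt.1 h) (ht j hj).symm
    linarith

/-- Consecutive terms have opposite parity, so the nonincreasing sequence is strictly decreasing.
Its last term is odd, hence at least `1`; its first is at most `n + 1` and congruent to `n` modulo
`2`, hence at most `n`. No slack remains. -/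
theorem eq_of_parity {n : ℕ} {c : ℕ → ℕ} (hodd : ∀ i < n, (c i + (n - 1 - i)) % 2 = 1)
    (hmono : ∀ i, i + 1 < n → c (i + 1) ≤ c i) (h0 : ∀ i < n, c i ≤ n + 1) :
    ∀ i < n, c i = n - i := by
  have hlow : ∀ k < n, k + 1 ≤ c (n - 1 - k) := by
    intro k
    induction k with
    | zero =>
      intro hk
      have := hodd (n - 1) (by omega)
      simp only [Nat.sub_zero]
      omega
    | succ k ih =>
      intro hk
      have h1 := ih (by omega)
      have h2 := hmono (n - 1 - (k + 1)) (by omega)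
      have h3 := hodd (n - 1 - (k + 1)) (by omega)
      have h4 := hodd (n - 1 - k) (by omega)
      rw [show n - 1 - (k + 1) + 1 = n - 1 - k by omega] at h2
      omega
  have hup : ∀ i < n, c i ≤ n - i := by
    intro i
    induction i with
    | zero =>
      intro hi
      have h1 := h0 0 hi
      have h2 := hodd 0 hi
      omega
    | succ i ih =>
      intro hi
      have h1 := ih (by omega)
      have h2 := hmono i hi
      have h3 := hodd i (by omega)
      have h4 := hodd (i + 1) hi
      omega
  intro i hi
  have h1 := hlow (n - 1 - i) (by omega)
  rw [show n - 1 - (n - 1 - i) = i by omega] at h1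
  have h2 := hup i hi
  omega

/-- The number of entries of `x` above `t`. -/
def countAbove {m : ℕ} (x : Fin m → ℝ) (t : ℝ) : ℕ := (Finset.univ.filter fun j => t < x j).card

theorem arrowCoords_pos_iff {n : ℕ} {μ : Fin n → ℝ} (hμ : StrictMono μ) {x : Fin (n + 1) → ℝ}
    (i : Fin n) : 0 < arrowCoords μ x i.succ ↔
      (∀ j, μ i ≠ x j) ∧ (countAbove x (μ i) + (n - 1 - i)) % 2 = 1 := by
  simp only [arrowCoords, Fin.cons_succ]
  by_cases hne : ∀ j, μ i ≠ x j
  · have hP := prod_sub_sign Finset.univ x fun j _ => hne j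
    have hQ := prod_sub_sign (Finset.univ.erase i) μ fun k hk =>
      hμ.injective.ne (Finset.ne_of_mem_erase hk).symm
    have hcard : ((Finset.univ.erase i).filter fun k => μ i < μ k).card = n - 1 - i := by
      have : (Finset.univ.erase i).filter (fun k => μ i < μ k) = Finset.Ioi i := by
        ext k
        simp only [Finset.mem_filter, Finset.mem_erase, Finset.mem_univ, and_true, hμ.lt_iff_lt,
          Finset.mem_Ioi]
        exact ⟨fun h => h.2, fun h => ⟨h.ne', h⟩⟩
      rw [this, Fin.card_Ioi]
    rw [hcard] at hQ
    change 0 < (-1 : ℝ) ^ (countAbove x (μ i)) * _ at hP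
    change 0 < (-1 : ℝ) ^ (n - 1 - (i : ℕ)) * nodeProd μ i at hQ
    set P := ∏ j, (μ i - x j)
    set Q := nodeProd μ i
    set c := countAbove x (μ i)
    set d := n - 1 - (i : ℕ)
    have hQ0 : Q ≠ 0 := by rintro h; rw [h] at hQ; simp at hQ
    have hPQ : 0 < (-1 : ℝ) ^ (c + d) * (P * Q) := by
      rw [pow_add]
      have := mul_pos hP hQ
      linarith
    have h1 : 0 < -P / Q ↔ P * Q < 0 := by
      have : -P / Q = -(P * Q) / Q ^ 2 := by field_simp
      rw [this, div_pos_iff_of_pos_right (by positivity)]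
      constructor <;> intro h <;> linarith
    rw [h1]
    simp only [hne, implies_true, true_and, ne_eq, not_false_eq_true]
    rcases Nat.even_or_odd (c + d) with he | ho
    · rw [he.neg_one_pow, one_mul] at hPQ
      rw [Nat.even_iff] at he
      constructor <;> intro h
      · linarith
      · omega
    · rw [ho.neg_one_pow] at hPQ
      rw [Nat.odd_iff] at ho
      exact ⟨fun _ => ho, fun _ => by linarith⟩
  · have hz : ∏ j, (μ i - x j) = 0 := by
      push Not at hne
      obtain ⟨j, hj⟩ := hne
      exact Finset.prod_eq_zero (Finset.mem_univ j) (sub_eq_zero.2 hj)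
    rw [hz]
    simp [hne]

/-- The open box of tuples interlacing with `x`. -/
def interlaceBox {n : ℕ} (x : Fin (n + 1) → ℝ) : Set (Fin n → ℝ) :=
  Set.univ.pi fun i : Fin n => Set.Ioo (x i.castSucc) (x i.succ)

theorem strictMono_of_mem_interlaceBox {n : ℕ} {x : Fin (n + 1) → ℝ} (hx : StrictMono x)
    {μ : Fin n → ℝ} (hμ : μ ∈ interlaceBox x) : StrictMono μ := fun i j hij => by
  have h1 := (hμ i trivial).2
  have h2 := (hμ j trivial).1
  have h3 : x i.succ ≤ x j.castSucc := hx.monotone (by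
    rw [Fin.le_def]
    simpa using hij)
  linarith

theorem countAbove_of_interlace {n : ℕ} {x : Fin (n + 1) → ℝ} (hx : StrictMono x) {t : ℝ} (i : Fin n)
    (h1 : x i.castSucc < t) (h2 : t < x i.succ) : countAbove x t = n - i := by
  have : Finset.univ.filter (fun j => t < x j) = Finset.Ioi i.castSucc := by
    ext j
    simp only [Finset.mem_filter, Finset.mem_univ, true_and, Finset.mem_Ioi]
    constructor
    · intro h
      exact hx.lt_iff_lt.1 (h1.trans h)
    · intro h
      exact h2.trans_le (hx.monotone (Fin.castSucc_lt_iff_succ_le.1 h))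
  rw [countAbove, this, Fin.card_Ioi]
  simp

theorem interlace_of_countAbove {n : ℕ} {x : Fin (n + 1) → ℝ} (hx : StrictMono x) {t : ℝ}
    (ht : ∀ j, t ≠ x j) {i : Fin n} (hc : countAbove x t = n - i) :
    x i.castSucc < t ∧ t < x i.succ := by
  constructor
  · by_contra hcon
    have hlt : t < x i.castSucc := lt_of_le_of_ne (not_lt.1 hcon) (ht _)
    have hsub : Finset.Ici i.castSucc ⊆ Finset.univ.filter fun j => t < x j := fun j hj => by
      simp only [Finset.mem_filter, Finset.mem_univ, true_and]
      exact hlt.trans_le (hx.monotone (Finset.mem_Ici.1 hj))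
    have := Finset.card_le_card hsub
    rw [Fin.card_Ici] at this
    unfold countAbove at hc
    have := i.2
    simp only [Fin.val_castSucc] at *
    omega
  · by_contra hcon
    have hsub : (Finset.univ.filter fun j => t < x j) ⊆ Finset.Ioi i.succ := fun j hj => by
      simp only [Finset.mem_filter, Finset.mem_univ, true_and] at hj
      exact Finset.mem_Ioi.2 (hx.lt_iff_lt.1 ((not_lt.1 hcon).trans_lt hj))
    have := Finset.card_le_card hsub
    rw [Fin.card_Ioi] at this
    unfold countAbove at hc
    have := i.2
    simp only [Fin.val_succ] at *
    omega

theorem arrowCoords_mem_tailPos_iff {n : ℕ} {x : Fin (n + 1) → ℝ} (hx : StrictMono x)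
    {μ : Fin n → ℝ} (hμ : StrictMono μ) :
    arrowCoords μ x ∈ tailPos n ↔ μ ∈ interlaceBox x := by
  constructor
  · intro h
    have h' := fun i => (arrowCoords_pos_iff hμ i).1 (h i)
    set c : ℕ → ℕ := fun i => if hi : i < n then countAbove x (μ ⟨i, hi⟩) else 0
    have hc : ∀ i : Fin n, c i = countAbove x (μ i) := fun i => by simp [c]
    have key := eq_of_parity (n := n) (c := c) (fun i hi => by
        have := (h' ⟨i, hi⟩).2
        rwa [← hc] at this)
      (fun i hi => by
        have e1 := hc ⟨i, by omega⟩
        have e2 := hc ⟨i + 1, hi⟩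
        simp only at e1 e2
        rw [e1, e2]
        refine Finset.card_le_card fun j hj => ?_
        simp only [Finset.mem_filter, Finset.mem_univ, true_and] at hj ⊢
        exact (hμ (Fin.mk_lt_mk.2 (Nat.lt_succ_self i))).trans hj)
      (fun i hi => by
        have e1 := hc ⟨i, hi⟩
        simp only at e1
        rw [e1]
        exact (Finset.card_le_univ _).trans (by simp))
    intro i _
    exact interlace_of_countAbove hx (h' i).1 ((hc i).symm.trans (key i i.2))
  · intro h i
    obtain ⟨h1, h2⟩ := h i trivial
    refine (arrowCoords_pos_iff hμ i).2 ⟨fun j hj => ?_, ?_⟩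
    · rw [hj] at h1 h2
      have h3 := hx.lt_iff_lt.1 h1
      have h4 := hx.lt_iff_lt.1 h2
      rw [Fin.lt_def] at h3 h4
      simp only [Fin.val_castSucc, Fin.val_succ] at h3 h4
      omega
    · rw [countAbove_of_interlace hx i h1 h2]
      have := i.2
      omega

/-! ### Integrals of determinants -/

/-- A form of Andréief's identity. -/
theorem integral_det_pi {𝕜 : Type*} [RCLike 𝕜] {n : ℕ} {ν : Fin n → Measure ℝ}
    [∀ i, SigmaFinite (ν i)] {g : Fin n → Fin n → ℝ → 𝕜} (hg : ∀ i j, Integrable (g i j) (ν i)) :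
    Integrable (fun y : Fin n → ℝ => (Matrix.of fun i j => g i j (y i)).det) (Measure.pi ν) ∧
    ∫ y, (Matrix.of fun i j => g i j (y i)).det ∂Measure.pi ν =
      (Matrix.of fun i j => ∫ t, g i j t ∂ν i).det := by
  have hterm : ∀ σ : Equiv.Perm (Fin n),
      Integrable (fun y : Fin n → ℝ => ∏ i, g i (σ i) (y i)) (Measure.pi ν) := fun σ =>
    Integrable.fintype_prod fun i => hg i (σ i)
  have hexp : ∀ A : Matrix (Fin n) (Fin n) 𝕜, A.det =
      ∑ σ : Equiv.Perm (Fin n), ((Equiv.Perm.sign σ : ℤ) : 𝕜) * ∏ i, A i (σ i) := fun A => by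
    rw [← Matrix.det_transpose, Matrix.det_apply']
    rfl
  simp_rw [hexp, Matrix.of_apply]
  refine ⟨integrable_finsetSum _ fun σ _ => (hterm σ).const_mul _, ?_⟩
  rw [integral_finsetSum _ fun σ _ => (hterm σ).const_mul _]
  refine Finset.sum_congr rfl fun σ _ => ?_
  rw [integral_const_mul, integral_fintype_prod_eq_prod]

theorem vdet_eq_factorial_mul {n : ℕ} (x : Fin (n + 1) → ℝ) : vdet x = n.factorial *
    (Matrix.of fun i j : Fin n => (x i.succ ^ ((j : ℕ) + 1) - x i.castSucc ^ ((j : ℕ) + 1)) /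
      ((j : ℕ) + 1 : ℝ)).det := by
  have h1 : (n.factorial : ℝ) = ∏ j : Fin n, ((j : ℕ) + 1 : ℝ) := by
    rw [Fin.prod_univ_eq_prod_range (fun j => (j + 1 : ℝ)), ← Finset.prod_range_add_one_eq_factorial]
    push_cast
    rfl
  rw [h1, ← Matrix.det_mul_row]
  set B : Matrix (Fin (n + 1)) (Fin (n + 1)) ℝ := fun i j =>
    (Fin.cons (x 0 ^ (j : ℕ)) (fun i : Fin n => x i.succ ^ (j : ℕ) - x i.castSucc ^ (j : ℕ)) :
      Fin (n + 1) → ℝ) i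
  have hB : vdet x = B.det := by
    refine Matrix.det_eq_of_forall_row_eq_smul_add_pred (fun _ => 1) (fun j => ?_) fun i j => ?_
    · simp [B, Matrix.vandermonde_apply]
    · simp [B, Matrix.vandermonde_apply]
  rw [hB, Matrix.det_succ_column_zero, Fin.sum_univ_succ, Finset.sum_eq_zero]
  · have hB0 : B 0 0 = 1 := by simp [B]
    rw [hB0, Fin.val_zero, pow_zero, one_mul, one_mul, add_zero]
    congr 1
    ext i j
    have : (j : ℝ) + 1 ≠ 0 := by positivity
    rw [Matrix.submatrix_apply, Fin.succAbove_zero, Matrix.of_apply, Matrix.of_apply,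
      mul_div_cancel₀ _ this]
    simp [B]
  · intro i _
    simp [B]

theorem integral_vdet_interlaceBox {n : ℕ} {x : Fin (n + 1) → ℝ} (hx : StrictMono x) :
    ∫ μ in interlaceBox x, vdet μ = vdet x / n.factorial := by
  rw [vdet_eq_factorial_mul, mul_div_cancel_left₀ _ (by positivity), interlaceBox, volume_pi,
    Measure.restrict_pi_pi]
  have hlt : ∀ i : Fin n, x i.castSucc ≤ x i.succ := fun i => (hx (Fin.castSucc_lt_succ)).le
  have := (integral_det_pi (𝕜 := ℝ) (ν := fun i : Fin n =>
    (volume : Measure ℝ).restrict (Set.Ioo (x i.castSucc) (x i.succ)))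
    (g := fun _ j t => t ^ (j : ℕ)) fun i j => by
      have hc : Continuous fun t : ℝ => t ^ (j : ℕ) := by fun_prop
      exact (hc.integrableOn_Icc (a := x i.castSucc) (b := x i.succ)).mono_set
        Set.Ioo_subset_Icc_self).2
  refine this.trans ?_
  congr 1
  ext i j
  rw [Matrix.of_apply, Matrix.of_apply, ← integral_Ioc_eq_integral_Ioo,
    ← intervalIntegral.integral_of_le (hlt i), integral_pow]

theorem vdet_pos_of_strictMono {n : ℕ} {x : Fin n → ℝ} (hx : StrictMono x) : 0 < vdet x := by
  rw [vdet, Matrix.det_vandermonde]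
  exact Finset.prod_pos fun i _ => Finset.prod_pos fun j hj =>
    sub_pos.2 (hx (Finset.mem_Ioi.1 hj))

theorem abs_vdet_comp_perm {n : ℕ} (x : Fin n → ℝ) (σ : Equiv.Perm (Fin n)) :
    |vdet (x ∘ σ)| = |vdet x| := by
  have : Matrix.vandermonde (x ∘ σ) = (Matrix.vandermonde x).submatrix σ id := by
    ext i j
    simp [Matrix.vandermonde_apply]
  rw [vdet, this, Matrix.det_permute, abs_mul]
  have : |((Equiv.Perm.sign σ : ℤ) : ℝ)| = 1 := by
    rcases Int.units_eq_one_or (Equiv.Perm.sign σ) with h | h <;> simp [h]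
  rw [this, one_mul, vdet]

theorem nodeProd_comp_perm {n : ℕ} (μ : Fin n → ℝ) (σ : Equiv.Perm (Fin n)) (i : Fin n) :
    nodeProd (μ ∘ σ) i = nodeProd μ (σ i) := by
  refine Finset.prod_bij (M := ℝ) (fun k _ => σ k) (fun k hk => ?_)
    (fun _ _ _ _ h => σ.injective h) (fun k hk => ⟨σ.symm k, ?_, by simp⟩) (fun _ _ => rfl)
  · simpa using hk
  · simp only [Finset.mem_erase, Finset.mem_univ, and_true] at hk ⊢
    rintro rfl
    simp at hk

theorem arrowCoords_comp_perm_mem_tailPos {n : ℕ} (μ : Fin n → ℝ) (x : Fin (n + 1) → ℝ)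
    (σ : Equiv.Perm (Fin n)) :
    arrowCoords (μ ∘ σ) x ∈ tailPos n ↔ arrowCoords μ x ∈ tailPos n := by
  have h : ∀ i : Fin n, arrowCoords (μ ∘ σ) x i.succ = arrowCoords μ x (σ i).succ := fun i => by
    simp [arrowCoords, nodeProd_comp_perm]
  simp only [tailPos, Set.mem_ofPred_eq, h]
  exact ⟨fun hs i => by simpa using hs (σ.symm i), fun hs i => hs (σ i)⟩

theorem lintegral_abs_vdet_interlacing {n : ℕ} {x : Fin (n + 1) → ℝ} (hx : StrictMono x) :
    ∫⁻ μ : Fin n → ℝ, ({μ | arrowCoords μ x ∈ tailPos n} : Set (Fin n → ℝ)).indicator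
      (fun μ => ENNReal.ofReal |vdet μ|) μ = ENNReal.ofReal |vdet x| := by
  have hsymm : IsSymm fun μ => ({μ | arrowCoords μ x ∈ tailPos n} : Set (Fin n → ℝ)).indicator
      (fun μ => ENNReal.ofReal |vdet μ|) μ := fun σ μ => by
    have e := arrowCoords_comp_perm_mem_tailPos μ x σ
    by_cases h : arrowCoords μ x ∈ tailPos n
    · simp [Set.indicator, h, e.2 h, abs_vdet_comp_perm]
    · simp [Set.indicator, h, mt e.1 h]
  have hbox : MeasurableSet (interlaceBox x) := MeasurableSet.univ_pi fun _ => measurableSet_Ioo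
  have hsub : interlaceBox x ⊆ chamber n := fun μ hμ => strictMono_of_mem_interlaceBox hx hμ
  have hint : IntegrableOn vdet (interlaceBox x) := by
    refine ((continuous_vdet (n := n)).continuousOn.integrableOn_compact (isCompact_univ_pi
      (s := fun i : Fin n => Set.Icc (x i.castSucc) (x i.succ)) fun _ => isCompact_Icc)).mono_set ?_
    exact Set.pi_mono fun i _ => Set.Ioo_subset_Icc_self
  rw [lintegral_symm hsymm]
  have h1 : ∫⁻ μ in chamber n, ({μ | arrowCoords μ x ∈ tailPos n} : Set (Fin n → ℝ)).indicator
      (fun μ => ENNReal.ofReal |vdet μ|) μ =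
      ∫⁻ μ in chamber n, (interlaceBox x).indicator (fun μ => ENNReal.ofReal (vdet μ)) μ := by
    refine setLIntegral_congr_fun (isOpen_chamber n).measurableSet fun μ hμ => ?_
    have e := arrowCoords_mem_tailPos_iff hx hμ
    by_cases h : μ ∈ interlaceBox x
    · simp [Set.indicator, h, e.2 h, abs_of_pos (vdet_pos_of_strictMono hμ)]
    · simp [Set.indicator, h, mt e.1 h]
  rw [h1, setLIntegral_indicator hbox, Set.inter_eq_left.2 hsub,
    ← ofReal_integral_eq_lintegral_ofReal hint
      ((ae_restrict_iff' hbox).2 (Filter.Eventually.of_forall fun μ hμ =>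
        (vdet_pos_of_strictMono (hsub hμ)).le)),
    integral_vdet_interlaceBox hx, abs_of_pos (vdet_pos_of_strictMono hx),
    ← ENNReal.ofReal_natCast, ← ENNReal.ofReal_mul (by positivity)]
  congr 1
  field_simp

/-! ### The Weyl integration formula -/

theorem lintegral_hermVolume_zero (f : (Fin 0 → ℝ) → ENNReal) (hf : IsSymm f) (hm : Measurable f) :
    ∫⁻ M, f (eig M) ∂hermVolume 0 = ∫⁻ x, f x * ENNReal.ofReal (vdet x ^ 2) := by
  rw [lintegral_hermVolume (hf.measurable_comp_eig hm)]
  have h1 : ∀ x : Coords 0, f (eig (hermOfCoords x)) = f default := fun x =>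
    congrArg f (Subsingleton.elim _ _)
  have h2 : ∀ x : Fin 0 → ℝ, f x * ENNReal.ofReal (vdet x ^ 2) = f default := fun x => by
    rw [Subsingleton.elim x default]
    simp [vdet]
  simp_rw [h1, h2, lintegral_const]
  congr 1
  rw [Measure.volume_eq_prod, ← Set.univ_prod_univ, Measure.prod_prod]
  have h3 : (volume : Measure ({p : Fin 0 × Fin 0 // p.1 < p.2} → ℂ)) Set.univ = 1 := by
    rw [volume_pi, Measure.pi_univ]
    simp
  rw [h3, mul_one]

/-- The Weyl integration formula: the eigenvalues of a Hermitian matrix have density proportional to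
the squared Vandermonde determinant. -/
theorem exists_weyl_integration (n : ℕ) : ∃ c : ENNReal, c ≠ 0 ∧ c ≠ ⊤ ∧
    ∀ f : (Fin n → ℝ) → ENNReal, IsSymm f → Measurable f →
      ∫⁻ M, f (eig M) ∂hermVolume n = c * ∫⁻ x, f x * ENNReal.ofReal (vdet x ^ 2) := by
  induction n with
  | zero => exact ⟨1, one_ne_zero, ENNReal.one_ne_top, fun f hf hm => by
      rw [one_mul, lintegral_hermVolume_zero f hf hm]⟩
  | succ n ih =>
    obtain ⟨c₁, hc₁, hc₁', h₁⟩ := exists_lintegral_hermVolume_succ n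
    obtain ⟨c₂, hc₂, hc₂', h₂⟩ := ih
    have hfac : ((n + 1).factorial : ENNReal) ≠ 0 := by exact_mod_cast (n + 1).factorial_ne_zero
    refine ⟨c₁ * c₂ * ((n + 1).factorial : ENNReal)⁻¹,
      mul_ne_zero (mul_ne_zero hc₁ hc₂) (ENNReal.inv_ne_zero.2 (ENNReal.natCast_ne_top _)),
      ENNReal.mul_ne_top (ENNReal.mul_ne_top hc₁' hc₂') (ENNReal.inv_ne_top.2 hfac),
      fun f hf hm => ?_⟩
    have hG : Measurable fun μ : Fin n → ℝ => ∫⁻ y in tailPos n, arrowFun f μ y :=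
      Measurable.lintegral_prod_right' (hf.measurable_arrowFun hm)
    rw [h₁ f hf hm, h₂ _ (hf.lintegral_tailPos_arrowFun hm) hG, mul_assoc c₁, mul_assoc c₁]
    congr 1
    rw [mul_assoc]
    congr 1
    set S : Set ((Fin n → ℝ) × (Fin (n + 1) → ℝ)) := {q | arrowCoords q.1 q.2 ∈ tailPos n}
    have hS : MeasurableSet S := measurable_arrowCoords (isOpen_tailPos n).measurableSet
    have hvm : ∀ m, Measurable fun x : Fin m → ℝ => ENNReal.ofReal |vdet x| := fun m =>
      (ENNReal.continuous_ofReal.comp continuous_vdet.abs).measurable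
    set F : (Fin n → ℝ) × (Fin (n + 1) → ℝ) → ENNReal := S.indicator fun q =>
      ENNReal.ofReal |vdet q.1| * (ENNReal.ofReal |vdet q.2| * f q.2)
    have hF : Measurable F := by
      refine Measurable.indicator ?_ hS
      exact ((hvm n).comp measurable_fst).mul
        (((hvm (n + 1)).comp measurable_snd).mul (hm.comp measurable_snd))
    have hsymm : IsSymm fun x => f x * ENNReal.ofReal (vdet x ^ 2) := fun σ x => by
      simp only [hf σ x]
      rw [← sq_abs, abs_vdet_comp_perm, sq_abs]
    calc ∫⁻ μ, (∫⁻ y in tailPos n, arrowFun f μ y) * ENNReal.ofReal (vdet μ ^ 2)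
        = ∫⁻ μ, ∫⁻ x in chamber (n + 1), F (μ, x) := by
          refine lintegral_congr_ae ?_
          filter_upwards [injective_ae n] with μ hμ
          have hSμ : MeasurableSet (arrowCoords μ ⁻¹' tailPos n) :=
            measurable_arrowCoords.of_uncurry_left (x := μ) (isOpen_tailPos n).measurableSet
          have hμ0 : 0 < |vdet μ| := abs_pos.2 (vdet_ne_zero hμ)
          have hFμ : ∀ x, F (μ, x) = (arrowCoords μ ⁻¹' tailPos n).indicator
              (fun x => ENNReal.ofReal |vdet μ| * (ENNReal.ofReal |vdet x| * f x)) x := fun x => rfl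
          simp_rw [hFμ]
          rw [hf.lintegral_tailPos_eq hμ, setLIntegral_indicator hSμ, Set.inter_comm, mul_comm,
            ← lintegral_const_mul _ (by
              have h2 : Measurable fun x : Fin (n + 1) → ℝ => |vdet x| / |vdet μ| :=
                
                (continuous_vdet.abs.div_const _).measurable
              exact h2.ennreal_ofReal.mul hm)]
          refine lintegral_congr fun x => ?_
          rw [← mul_assoc, ← mul_assoc, ← ENNReal.ofReal_mul (by positivity),
            ← ENNReal.ofReal_mul (by positivity)]
          congr 2
          rw [← sq_abs]
          field_simp
      _ = ∫⁻ x in chamber (n + 1), ∫⁻ μ, F (μ, x) := lintegral_lintegral_swap hF.aemeasurable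
      _ = ∫⁻ x in chamber (n + 1), f x * ENNReal.ofReal (vdet x ^ 2) := by
          refine setLIntegral_congr_fun (isOpen_chamber _).measurableSet fun x hx => ?_
          have hFx : ∀ μ, F (μ, x) = ({μ | arrowCoords μ x ∈ tailPos n} : Set (Fin n → ℝ)).indicator
              (fun μ => ENNReal.ofReal |vdet μ|) μ * (ENNReal.ofReal |vdet x| * f x) := fun μ => by
            simp only [F, S, Set.indicator, Set.mem_ofPred_eq]
            split_ifs <;> simp
          have hSx : MeasurableSet {μ | arrowCoords μ x ∈ tailPos n} :=
            measurable_arrowCoords.of_uncurry_right (y := x) (isOpen_tailPos n).measurableSet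
          simp_rw [hFx]
          rw [lintegral_mul_const _ ((hvm n).indicator hSx),
            lintegral_abs_vdet_interlacing hx, ← mul_assoc, ← ENNReal.ofReal_mul (abs_nonneg _),
            mul_comm, ← sq, sq_abs]
      _ = _ := by
          rw [lintegral_symm hsymm, ← mul_assoc,
            ENNReal.inv_mul_cancel hfac (ENNReal.natCast_ne_top _), one_mul]

end MatrixModel
end

noncomputable section
namespace MatrixModel

/-! ### Slater determinants -/

/-- The Slater determinant of a family of functions. -/
def slater {n : ℕ} (ψ : Fin n → ℝ → ℝ) (x : Fin n → ℝ) : ℝ :=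
  (Matrix.of fun i j => ψ j (x i)).det

theorem slater_comp_perm {n : ℕ} (ψ : Fin n → ℝ → ℝ) (σ : Equiv.Perm (Fin n)) (x : Fin n → ℝ) :
    slater ψ (x ∘ σ) = ((Equiv.Perm.sign σ : ℤ) : ℝ) * slater ψ x := by
  rw [slater, slater, ← Matrix.det_permute]
  rfl

theorem slater_eq_sum {n : ℕ} (ψ : Fin n → ℝ → ℝ) (x : Fin n → ℝ) : slater ψ x =
    ∑ σ : Equiv.Perm (Fin n), ((Equiv.Perm.sign σ : ℤ) : ℝ) * ∏ i, ψ i (x (σ i)) := by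
  rw [slater, Matrix.det_apply']
  rfl

theorem measurable_slater {n : ℕ} {ψ : Fin n → ℝ → ℝ} (hψ : ∀ i, Measurable (ψ i)) :
    Measurable (slater ψ) := by
  simp only [funext (slater_eq_sum ψ)]
  refine Finset.measurable_sum _ fun σ _ => Measurable.const_mul ?_ _
  exact Finset.measurable_prod _ fun i _ => (hψ i).comp (measurable_pi_apply _)

theorem integral_symm_mul_slater_sq {n : ℕ} {ψ : Fin n → ℝ → ℝ} {S : (Fin n → ℝ) → ℝ} (hS : IsSymm S)
    (hint : Integrable fun x => S x * ((∏ i, ψ i (x i)) * slater ψ x)) :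
    Integrable (fun x => S x * slater ψ x ^ 2) ∧ ∫ x, S x * slater ψ x ^ 2 =
      n.factorial * ∫ x, S x * ((∏ i, ψ i (x i)) * slater ψ x) := by
  set F : (Fin n → ℝ) → ℝ := fun x => S x * ((∏ i, ψ i (x i)) * slater ψ x)
  have hexp : ∀ x, S x * slater ψ x ^ 2 = ∑ σ : Equiv.Perm (Fin n), F (x ∘ σ) := fun x => by
    rw [sq]
    nth_rewrite 1 [slater_eq_sum]
    rw [Finset.sum_mul, Finset.mul_sum]
    refine Finset.sum_congr rfl fun σ _ => ?_
    simp only [F]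
    rw [hS σ x, slater_comp_perm]
    simp only [Function.comp_apply]
    ring
  have hmp := fun σ : Equiv.Perm (Fin n) => measurePreserving_comp_perm σ
  have hemb : ∀ σ : Equiv.Perm (Fin n), MeasurableEmbedding fun x : Fin n → ℝ => x ∘ σ := fun σ => by
    rw [← coe_piCongrLeft_const]
    exact (MeasurableEquiv.piCongrLeft (fun _ : Fin n => ℝ) σ.symm).measurableEmbedding
  have hi : ∀ σ : Equiv.Perm (Fin n), Integrable fun x => F (x ∘ σ) := fun σ =>
    ((hmp σ).integrable_comp_emb (hemb σ)).2 hint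
  simp_rw [hexp]
  refine ⟨integrable_finsetSum _ fun σ _ => hi σ, ?_⟩
  rw [integral_finsetSum _ fun σ _ => hi σ]
  simp_rw [fun σ => (hmp σ).integral_comp (hemb σ) F]
  simp [Fintype.card_perm]

theorem integral_prod_mul_slater {n : ℕ} {ψ : Fin n → ℝ → ℝ} {H : Fin n → ℝ → ℝ}
    (hH : ∀ i j, Integrable fun t => H i t * ψ i t * ψ j t) :
    Integrable (fun x : Fin n → ℝ => (∏ i, H i (x i)) * ((∏ i, ψ i (x i)) * slater ψ x)) ∧
    ∫ x : Fin n → ℝ, (∏ i, H i (x i)) * ((∏ i, ψ i (x i)) * slater ψ x) =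
      (Matrix.of fun i j => ∫ t, H i t * ψ i t * ψ j t).det := by
  have h := integral_det_pi (𝕜 := ℝ) (ν := fun _ : Fin n => (volume : Measure ℝ))
    (g := fun i j t => H i t * ψ i t * ψ j t) hH
  have he : ∀ x : Fin n → ℝ, (∏ i, H i (x i)) * ((∏ i, ψ i (x i)) * slater ψ x) =
      (Matrix.of fun i j => H i (x i) * ψ i (x i) * ψ j (x i)).det := fun x => by
    rw [← mul_assoc, ← Finset.prod_mul_distrib, slater, ← Matrix.det_mul_column]
    rfl
  simp_rw [he]
  exact h

theorem det_one_row {n : ℕ} (l : Fin n) (u : Fin n → ℝ) :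
    (Matrix.of fun i j => if i = l then u j else if i = j then (1 : ℝ) else 0).det = u l := by
  have : (Matrix.of fun i j => if i = l then u j else if i = j then (1 : ℝ) else 0) =
      (1 : Matrix (Fin n) (Fin n) ℝ).updateRow l u := by
    ext i j
    by_cases h : i = l
    · subst h; simp
    · simp [h, Matrix.one_apply]
  rw [this, ← Matrix.det_transpose, ← Matrix.updateCol_transpose, Matrix.transpose_one,
    ← Matrix.cramer_apply, Matrix.cramer_one]
  rfl

theorem det_one_two_rows {n : ℕ} {l m : Fin n} (hlm : l ≠ m) (u w : Fin n → ℝ) :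
    (Matrix.of fun i j => if i = l then u j else if i = m then w j else
      if i = j then (1 : ℝ) else 0).det = u l * w m - u m * w l := by
  set A : Matrix (Fin n) (Fin 2) ℝ := Matrix.of fun i k => if i = ![l, m] k then 1 else 0
  set B : Matrix (Fin 2) (Fin n) ℝ := Matrix.of fun k j =>
    ![u j - (if l = j then 1 else 0), w j - (if m = j then 1 else 0)] k
  have h1 : (Matrix.of fun i j => if i = l then u j else if i = m then w j else
      if i = j then (1 : ℝ) else 0) = 1 + A * B := by
    ext i j
    rw [Matrix.add_apply, Matrix.mul_apply, Fin.sum_univ_two, Matrix.one_apply]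
    by_cases h : i = l
    · subst h
      simp [A, B, hlm]
    · by_cases h' : i = m
      · subst h'
        simp [A, B, h]
      · simp [A, B, h, h']
  rw [h1, Matrix.det_one_add_mul_comm, Matrix.det_fin_two]
  have hBA : ∀ k k', (B * A) k k' = B k (![l, m] k') := fun k k' => by
    rw [Matrix.mul_apply, Finset.sum_eq_single (![l, m] k')]
    · simp [A]
    · intro i _ hi
      simp [A, hi]
    · simp
  simp only [Matrix.add_apply, hBA]
  simp [B, hlm, hlm.symm]

/-! ### Linear statistics of the orthogonal polynomial ensemble -/

section
variable {n : ℕ} {ψ : Fin n → ℝ → ℝ}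
  (hψi : ∀ i j, Integrable fun t => ψ i t * ψ j t)
  (hψ : ∀ i j, ∫ t, ψ i t * ψ j t = if i = j then 1 else 0)
include hψi hψ

theorem integral_slater_sq :
    Integrable (fun x => slater ψ x ^ 2) ∧ ∫ x, slater ψ x ^ 2 = n.factorial := by
  have h1 := integral_prod_mul_slater (ψ := ψ) (H := fun _ _ => 1) fun i j => by
    simpa using hψi i j
  have h2 := integral_symm_mul_slater_sq (ψ := ψ) (S := fun _ => 1) (fun _ _ => rfl) (by
    simpa using h1.1)
  simp only [Finset.prod_const_one, one_mul, hψ] at h1 h2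
  refine ⟨h2.1, ?_⟩
  rw [h2.2, h1.2]
  have : (Matrix.of fun i j : Fin n => if i = j then (1 : ℝ) else 0) = 1 := by
    ext i j
    simp [Matrix.one_apply]
  rw [this, Matrix.det_one, mul_one]

variable {φ : ℝ → ℝ}

theorem integral_sum_mul_slater_sq (hφ : ∀ i j, Integrable fun t => φ t * (ψ i t * ψ j t)) :
    Integrable (fun x : Fin n → ℝ => (∑ l, φ (x l)) * slater ψ x ^ 2) ∧
    ∫ x : Fin n → ℝ, (∑ l, φ (x l)) * slater ψ x ^ 2 =
      n.factorial * ∑ l, ∫ t, φ t * (ψ l t * ψ l t) := by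
  have h1 := fun l : Fin n => integral_prod_mul_slater (ψ := ψ)
    (H := fun i t => if i = l then φ t else 1) fun i j => by
      by_cases h : i = l
      · simpa [h, mul_assoc] using hφ l j
      · simpa [h] using hψi i j
  have h2 : ∀ l : Fin n, (Matrix.of fun i j : Fin n =>
      ∫ t, (if i = l then φ t else 1) * ψ i t * ψ j t).det = ∫ t, φ t * (ψ l t * ψ l t) := fun l => by
    rw [← det_one_row l fun j => ∫ t, φ t * (ψ l t * ψ j t)]
    congr 1
    ext i j
    by_cases h : i = l
    · simp [h, mul_assoc]
    · simp [h, hψ]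
  have hS : ∀ x : Fin n → ℝ, (∑ l, φ (x l)) * ((∏ i, ψ i (x i)) * slater ψ x) =
      ∑ l, (∏ i, if i = l then φ (x i) else 1) * ((∏ i, ψ i (x i)) * slater ψ x) := fun x => by
    rw [Finset.sum_mul]
    simp
  have h3 := integral_symm_mul_slater_sq (ψ := ψ) (isSymm_sum φ) (by
    simp_rw [hS]
    exact integrable_finsetSum _ fun l _ => (h1 l).1)
  refine ⟨h3.1, ?_⟩
  rw [h3.2]
  simp_rw [hS]
  rw [integral_finsetSum _ fun l _ => (h1 l).1]
  simp_rw [fun l => (h1 l).2, h2]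

theorem integral_sum_sq_mul_slater_sq (hφ : ∀ i j, Integrable fun t => φ t * (ψ i t * ψ j t))
    (hφ2 : ∀ i j, Integrable fun t => φ t ^ 2 * (ψ i t * ψ j t)) :
    Integrable (fun x : Fin n → ℝ => (∑ l, φ (x l)) ^ 2 * slater ψ x ^ 2) ∧
    ∫ x : Fin n → ℝ, (∑ l, φ (x l)) ^ 2 * slater ψ x ^ 2 =
      n.factorial * ((∑ l, ∫ t, φ t ^ 2 * (ψ l t * ψ l t)) +
        (∑ l, ∫ t, φ t * (ψ l t * ψ l t)) ^ 2 -
          ∑ l, ∑ m, (∫ t, φ t * (ψ l t * ψ m t)) ^ 2) := by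
  set H : Fin n → Fin n → Fin n → ℝ → ℝ := fun l m i t =>
    (if i = l then φ t else 1) * (if i = m then φ t else 1)
  have h1 := fun l m : Fin n => integral_prod_mul_slater (ψ := ψ) (H := H l m) fun i j => by
      by_cases h : i = l
      · by_cases h' : i = m
        · have := hφ2 i j
          simp only [H, if_pos h, if_pos h']
          simpa [mul_assoc, sq] using this
        · simp only [H, if_pos h, if_neg h', mul_one]
          simpa [mul_assoc] using hφ i j
      · by_cases h' : i = m
        · simp only [H, if_neg h, if_pos h', one_mul]
          simpa [mul_assoc] using hφ i j
        · simp only [H, if_neg h, if_neg h', one_mul]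
          exact hψi i j
  have h2 : ∀ l m : Fin n, (Matrix.of fun i j : Fin n => ∫ t, H l m i t * ψ i t * ψ j t).det =
      (if l = m then ∫ t, φ t ^ 2 * (ψ l t * ψ l t) else 0) +
        ((∫ t, φ t * (ψ l t * ψ l t)) * (∫ t, φ t * (ψ m t * ψ m t)) -
          (∫ t, φ t * (ψ l t * ψ m t)) ^ 2) := fun l m => by
    by_cases hlm : l = m
    · subst hlm
      rw [if_pos rfl, ← sq, sub_self, add_zero,
        ← det_one_row l fun j => ∫ t, φ t ^ 2 * (ψ l t * ψ j t)]
      congr 1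
      ext i j
      by_cases h : i = l
      · simp [H, h, mul_assoc, sq]
      · simp [H, h, hψ]
    · have hsym : ∫ t, φ t * (ψ m t * ψ l t) = ∫ t, φ t * (ψ l t * ψ m t) := by
        simp_rw [mul_comm (ψ m _)]
      rw [if_neg hlm, zero_add]
      have := det_one_two_rows hlm (fun j => ∫ t, φ t * (ψ l t * ψ j t))
        fun j => ∫ t, φ t * (ψ m t * ψ j t)
      rw [hsym, ← sq] at this
      rw [← this]
      congr 1
      ext i j
      by_cases h : i = l
      · have h' : i ≠ m := h ▸ hlm
        simp only [H, Matrix.of_apply, if_pos h, if_neg h', mul_assoc, one_mul]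
        rw [h]
      · by_cases h' : i = m
        · simp only [H, Matrix.of_apply, if_neg h, if_pos h', one_mul, mul_assoc]
          rw [h']
        · simp [H, h, h', hψ]
  have hS : ∀ x : Fin n → ℝ, (∑ l, φ (x l)) ^ 2 * ((∏ i, ψ i (x i)) * slater ψ x) =
      ∑ l, ∑ m, (∏ i, H l m i (x i)) * ((∏ i, ψ i (x i)) * slater ψ x) := fun x => by
    simp_rw [← Finset.sum_mul]
    congr 1
    rw [sq, Finset.sum_mul_sum]
    refine Finset.sum_congr rfl fun l _ => Finset.sum_congr rfl fun m _ => ?_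
    simp only [H]
    rw [Finset.prod_mul_distrib]
    simp
  have hi : ∀ l, Integrable fun x : Fin n → ℝ =>
      ∑ m, (∏ i, H l m i (x i)) * ((∏ i, ψ i (x i)) * slater ψ x) := fun l =>
    integrable_finsetSum _ fun m _ => (h1 l m).1
  have hsymm : IsSymm fun x : Fin n → ℝ => (∑ l, φ (x l)) ^ 2 := fun σ x => by
    simp only [isSymm_sum φ σ x]
  have h3 := integral_symm_mul_slater_sq (ψ := ψ) hsymm (by
    simp_rw [hS]
    exact integrable_finsetSum _ fun l _ => hi l)
  refine ⟨h3.1, ?_⟩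
  rw [h3.2]
  simp_rw [hS]
  rw [integral_finsetSum _ fun l _ => hi l]
  simp_rw [fun l => integral_finsetSum Finset.univ fun m _ => (h1 l m).1, fun l m => (h1 l m).2, h2]
  congr 1
  simp_rw [Finset.sum_add_distrib, Finset.sum_sub_distrib]
  rw [sq (∑ l, _), Finset.sum_mul_sum]
  simp
  ring

end

end MatrixModel
end

noncomputable section
namespace MatrixModel

/-! ### Variance in determinantal ensembles -/

/-- The probability law with density `(det ψⱼ(xᵢ))² / n!`. -/
def slaterLaw {n : ℕ} (ψ : Fin n → ℝ → ℝ) : Measure (Fin n → ℝ) :=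
  volume.withDensity fun x => ENNReal.ofReal (slater ψ x ^ 2 / n.factorial)

theorem measurable_slaterDensity {n : ℕ} {ψ : Fin n → ℝ → ℝ} (hm : ∀ i, Measurable (ψ i)) :
    Measurable fun x => ENNReal.ofReal (slater ψ x ^ 2 / n.factorial) :=
  (((measurable_slater hm).pow_const 2).div_const _).ennreal_ofReal

theorem toReal_slaterDensity {n : ℕ} (ψ : Fin n → ℝ → ℝ) (x : Fin n → ℝ) :
    (ENNReal.ofReal (slater ψ x ^ 2 / n.factorial)).toReal = slater ψ x ^ 2 / n.factorial :=
  ENNReal.toReal_ofReal (by positivity)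

theorem integral_slaterLaw {n : ℕ} {ψ : Fin n → ℝ → ℝ} (hm : ∀ i, Measurable (ψ i))
    (f : (Fin n → ℝ) → ℝ) :
    ∫ x, f x ∂slaterLaw ψ = (∫ x, f x * slater ψ x ^ 2) / n.factorial := by
  rw [slaterLaw, integral_withDensity_eq_integral_toReal_smul (measurable_slaterDensity hm) (by simp),
    ← integral_div]
  refine integral_congr_ae (Filter.Eventually.of_forall fun x => ?_)
  simp only [toReal_slaterDensity, smul_eq_mul]
  ring

theorem integrable_slaterLaw_iff {n : ℕ} {ψ : Fin n → ℝ → ℝ} (hm : ∀ i, Measurable (ψ i))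
    {f : (Fin n → ℝ) → ℝ} :
    Integrable f (slaterLaw ψ) ↔ Integrable fun x => f x * slater ψ x ^ 2 := by
  have hn : (n.factorial : ℝ) ≠ 0 := by positivity
  rw [slaterLaw, integrable_withDensity_iff_integrable_smul' (measurable_slaterDensity hm) (by simp)]
  have : (fun x => (ENNReal.ofReal (slater ψ x ^ 2 / n.factorial)).toReal • f x) =
      fun x => f x * slater ψ x ^ 2 * (n.factorial : ℝ)⁻¹ := by
    ext x
    simp only [toReal_slaterDensity, smul_eq_mul]
    ring
  rw [this, integrable_mul_const_iff (IsUnit.mk0 _ (inv_ne_zero hn))]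

/-- The reproducing kernel of a finite family of functions. -/
def kern {n : ℕ} (ψ : Fin n → ℝ → ℝ) (x y : ℝ) : ℝ := ∑ l, ψ l x * ψ l y

theorem kern_sq {n : ℕ} (ψ : Fin n → ℝ → ℝ) (x y : ℝ) :
    kern ψ x y ^ 2 = ∑ l, ∑ m, (ψ l x * ψ m x) * (ψ l y * ψ m y) := by
  rw [kern, sq, Finset.sum_mul_sum]
  exact Finset.sum_congr rfl fun l _ => Finset.sum_congr rfl fun m _ => by ring

section
variable {n : ℕ} {ψ : Fin n → ℝ → ℝ} (hm : ∀ i, Measurable (ψ i))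
  (hψi : ∀ i j, Integrable fun t => ψ i t * ψ j t)
  (hψ : ∀ i j, ∫ t, ψ i t * ψ j t = if i = j then 1 else 0)

include hψi hψ in
theorem integral_sub_sq_mul_kern_sq {φ : ℝ → ℝ}
    (hφ : ∀ i j, Integrable fun t => φ t * (ψ i t * ψ j t))
    (hφ2 : ∀ i j, Integrable fun t => φ t ^ 2 * (ψ i t * ψ j t)) :
    Integrable (fun p : ℝ × ℝ => (φ p.1 - φ p.2) ^ 2 * kern ψ p.1 p.2 ^ 2) ∧
    ∫ p : ℝ × ℝ, (φ p.1 - φ p.2) ^ 2 * kern ψ p.1 p.2 ^ 2 =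
      2 * ((∑ l, ∫ t, φ t ^ 2 * (ψ l t * ψ l t)) -
        ∑ l, ∑ m, (∫ t, φ t * (ψ l t * ψ m t)) ^ 2) := by
  set F : Fin n → Fin n → ℝ × ℝ → ℝ := fun l m p =>
    (φ p.1 ^ 2 * (ψ l p.1 * ψ m p.1)) * (ψ l p.2 * ψ m p.2) +
      (ψ l p.1 * ψ m p.1) * (φ p.2 ^ 2 * (ψ l p.2 * ψ m p.2)) -
      2 * ((φ p.1 * (ψ l p.1 * ψ m p.1)) * (φ p.2 * (ψ l p.2 * ψ m p.2)))
  have he : ∀ p : ℝ × ℝ, (φ p.1 - φ p.2) ^ 2 * kern ψ p.1 p.2 ^ 2 = ∑ l, ∑ m, F l m p := fun p => by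
    rw [kern_sq, Finset.mul_sum]
    simp_rw [Finset.mul_sum]
    refine Finset.sum_congr rfl fun l _ => Finset.sum_congr rfl fun m _ => ?_
    simp only [F]
    ring
  have i1 := fun l m => (hφ2 l m).mul_prod (hψi l m)
  have i2 := fun l m => (hψi l m).mul_prod (hφ2 l m)
  have i3 := fun l m => ((hφ l m).mul_prod (hφ l m)).const_mul 2
  have hF : ∀ l m, Integrable (F l m) := fun l m => ((i1 l m).add (i2 l m)).sub (i3 l m)
  have hF' : ∀ l m, ∫ p, F l m p = (if l = m then 2 * ∫ t, φ t ^ 2 * (ψ l t * ψ l t) else 0) -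
      2 * (∫ t, φ t * (ψ l t * ψ m t)) ^ 2 := fun l m => by
    have h1 : ∫ p, F l m p = ((∫ t, φ t ^ 2 * (ψ l t * ψ m t)) * (∫ t, ψ l t * ψ m t) +
        (∫ t, ψ l t * ψ m t) * ∫ t, φ t ^ 2 * (ψ l t * ψ m t)) -
        2 * ((∫ t, φ t * (ψ l t * ψ m t)) * ∫ t, φ t * (ψ l t * ψ m t)) := by
      rw [← integral_prod_mul, ← integral_prod_mul, ← integral_prod_mul, ← integral_const_mul,
        ← integral_add (i1 l m) (i2 l m)]
      exact integral_sub ((i1 l m).add (i2 l m)) (i3 l m)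
    rw [h1, hψ]
    split_ifs with hlm
    · subst hlm
      ring
    · ring
  have hi : ∀ l, Integrable fun p => ∑ m, F l m p := fun l =>
    integrable_finsetSum _ fun m _ => hF l m
  simp_rw [he]
  refine ⟨integrable_finsetSum _ fun l _ => hi l, ?_⟩
  rw [integral_finsetSum _ fun l _ => hi l]
  simp_rw [fun l => integral_finsetSum Finset.univ fun m _ => hF l m, hF', Finset.sum_sub_distrib]
  simp [Finset.mul_sum, mul_sub]

include hψi hψ

theorem isProbabilityMeasure_slaterLaw : IsProbabilityMeasure (slaterLaw ψ) := by
  have h := integral_slater_sq hψi hψ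
  have hn : (n.factorial : ℝ) ≠ 0 := by positivity
  refine ⟨?_⟩
  rw [slaterLaw, withDensity_apply _ MeasurableSet.univ, setLIntegral_univ,
    ← ofReal_integral_eq_lintegral_ofReal (h.1.div_const _)
      (Filter.Eventually.of_forall fun x => by positivity), integral_div, h.2, div_self hn,
    ENNReal.ofReal_one]

include hm

theorem slaterLaw_variance {φ : ℝ → ℝ} (hφ : ∀ i j, Integrable fun t => φ t * (ψ i t * ψ j t))
    (hφ2 : ∀ i j, Integrable fun t => φ t ^ 2 * (ψ i t * ψ j t)) :
    Integrable (fun x => ∑ l, φ (x l)) (slaterLaw ψ) ∧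
    Integrable (fun x => (∑ l, φ (x l)) ^ 2) (slaterLaw ψ) ∧
    ∫ x, (∑ l, φ (x l) - ∫ y, ∑ l, φ (y l) ∂slaterLaw ψ) ^ 2 ∂slaterLaw ψ =
      (∫ p : ℝ × ℝ, (φ p.1 - φ p.2) ^ 2 * kern ψ p.1 p.2 ^ 2) / 2 := by
  have := isProbabilityMeasure_slaterLaw hψi hψ
  have hn : (n.factorial : ℝ) ≠ 0 := by positivity
  have h1 := integral_sum_mul_slater_sq hψi hψ hφ
  have h2 := integral_sum_sq_mul_slater_sq hψi hψ hφ hφ2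
  have i1 := (integrable_slaterLaw_iff hm).2 h1.1
  have i2 := (integrable_slaterLaw_iff hm).2 h2.1
  refine ⟨i1, i2, ?_⟩
  have e1 : ∫ x, ∑ l, φ (x l) ∂slaterLaw ψ = ∑ l, ∫ t, φ t * (ψ l t * ψ l t) := by
    rw [integral_slaterLaw hm, h1.2, mul_div_cancel_left₀ _ hn]
  have e2 : ∫ x, (∑ l, φ (x l)) ^ 2 ∂slaterLaw ψ = (∑ l, ∫ t, φ t ^ 2 * (ψ l t * ψ l t)) +
        (∑ l, ∫ t, φ t * (ψ l t * ψ l t)) ^ 2 -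
          ∑ l, ∑ m, (∫ t, φ t * (ψ l t * ψ m t)) ^ 2 := by
    rw [integral_slaterLaw hm, h2.2, mul_div_cancel_left₀ _ hn]
  set E := ∫ x, ∑ l, φ (x l) ∂slaterLaw ψ
  have e3 : ∫ x, (∑ l, φ (x l) - E) ^ 2 ∂slaterLaw ψ =
      (∫ x, (∑ l, φ (x l)) ^ 2 ∂slaterLaw ψ) - E ^ 2 := by
    have : ∀ x : Fin n → ℝ, (∑ l, φ (x l) - E) ^ 2 =
        ((∑ l, φ (x l)) ^ 2 - 2 * E * ∑ l, φ (x l)) + E ^ 2 := fun x => by ring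
    simp_rw [this]
    rw [integral_add (by exact i2.sub (i1.const_mul _)) (integrable_const _),
      integral_sub i2 (i1.const_mul _), integral_const_mul]
    simp only [integral_const, probReal_univ, one_smul]
    ring
  rw [e3, e2, e1, (integral_sub_sq_mul_kern_sq hψi hψ hφ hφ2).2]
  ring

theorem slaterLaw_complexVariance {φ : ℝ → ℂ}
    (h1 : ∀ i j, Integrable fun t => (φ t).re * (ψ i t * ψ j t))
    (h1' : ∀ i j, Integrable fun t => (φ t).re ^ 2 * (ψ i t * ψ j t))
    (h2 : ∀ i j, Integrable fun t => (φ t).im * (ψ i t * ψ j t))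
    (h2' : ∀ i j, Integrable fun t => (φ t).im ^ 2 * (ψ i t * ψ j t)) :
    MemLp (fun x => ∑ l, φ (x l)) 2 (slaterLaw ψ) ∧
    Integrable (fun p : ℝ × ℝ => ‖φ p.1 - φ p.2‖ ^ 2 * kern ψ p.1 p.2 ^ 2) ∧
    complexVariance (fun x => ∑ l, φ (x l)) (slaterLaw ψ) =
      (∫ p : ℝ × ℝ, ‖φ p.1 - φ p.2‖ ^ 2 * kern ψ p.1 p.2 ^ 2) / 2 := by
  have := isProbabilityMeasure_slaterLaw hψi hψ
  obtain ⟨a1, a2, a3⟩ := slaterLaw_variance hm hψi hψ h1 h1'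
  obtain ⟨b1, b2, b3⟩ := slaterLaw_variance hm hψi hψ h2 h2'
  have hsq : ∀ z : ℂ, ‖z‖ ^ 2 = z.re ^ 2 + z.im ^ 2 := fun z => by
    rw [Complex.sq_norm, Complex.normSq_apply]
    ring
  have hX : Integrable (fun x : Fin n → ℝ => ∑ l, φ (x l)) (slaterLaw ψ) := by
    have := a1.ofReal (𝕜 := ℂ) |>.add (b1.ofReal (𝕜 := ℂ) |>.mul_const Complex.I)
    refine this.congr (Filter.Eventually.of_forall fun x => ?_)
    apply Complex.ext <;> simp
  have hre : (∫ x, ∑ l, φ (x l) ∂slaterLaw ψ).re = ∫ x, ∑ l, (φ (x l)).re ∂slaterLaw ψ := by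
    have := integral_re hX
    simp only [RCLike.re_to_complex, Complex.re_sum] at this
    exact this.symm
  have him : (∫ x, ∑ l, φ (x l) ∂slaterLaw ψ).im = ∫ x, ∑ l, (φ (x l)).im ∂slaterLaw ψ := by
    have := integral_im hX
    simp only [RCLike.im_to_complex, Complex.im_sum] at this
    exact this.symm
  have hL : MemLp (fun x : Fin n → ℝ => ∑ l, φ (x l)) 2 (slaterLaw ψ) := by
    rw [memLp_two_iff_integrable_sq_norm hX.aestronglyMeasurable]
    simp_rw [hsq, Complex.re_sum, Complex.im_sum]
    exact a2.add b2
  have k1 := integral_sub_sq_mul_kern_sq hψi hψ h1 h1'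
  have k2 := integral_sub_sq_mul_kern_sq hψi hψ h2 h2'
  have c1 : Integrable (fun x : Fin n → ℝ => (∑ l, (φ (x l)).re -
      ∫ x, ∑ l, (φ (x l)).re ∂slaterLaw ψ) ^ 2) (slaterLaw ψ) :=
    (((memLp_two_iff_integrable_sq a1.aestronglyMeasurable).2 a2).sub (memLp_const _)).integrable_sq
  have c2 : Integrable (fun x : Fin n → ℝ => (∑ l, (φ (x l)).im -
      ∫ x, ∑ l, (φ (x l)).im ∂slaterLaw ψ) ^ 2) (slaterLaw ψ) :=
    (((memLp_two_iff_integrable_sq b1.aestronglyMeasurable).2 b2).sub (memLp_const _)).integrable_sq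
  simp_rw [complexVariance, hsq, Complex.sub_re, Complex.sub_im, hre, him, Complex.re_sum,
    Complex.im_sum, add_mul]
  refine ⟨hL, k1.1.add k2.1, ?_⟩
  rw [integral_add c1 c2, a3, b3, integral_add k1.1 k2.1, add_div]

end

/-! ### The variance bound for the orthogonal polynomial ensemble -/

section
variable {V : ℝ → ℝ} {n : ℕ} (h : Admissible V n)
include h

theorem Admissible.integrable_sq_mul_psi_mul_psi {l m : ℕ} (hl : l < n) (hm : m < n) {g : ℝ → ℝ}
    (hg : Measurable g) {a S : ℝ} (hb : ∀ x, |g x| ≤ a + S * |x|) :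
    Integrable fun x => g x ^ 2 * (psi V n l x * psi V n m x) := by
  have i1 := (h.integrable_psi_mul_psi hl.le hl.le).add (h.integrable_psi_mul_psi hm.le hm.le)
  have i2 := (h.integrable_sq_mul_psi_sq hl).add (h.integrable_sq_mul_psi_sq hm)
  refine ((i1.const_mul (a ^ 2)).add (i2.const_mul (S ^ 2))).mono' ?_
    (Filter.Eventually.of_forall fun x => ?_)
  · exact ((hg.pow_const 2).mul ((h.measurable_psi l).mul (h.measurable_psi m))).aestronglyMeasurable
  · simp only [Pi.add_apply, Real.norm_eq_abs, abs_mul, abs_pow]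
    have h1 : |g x| ^ 2 ≤ 2 * (a ^ 2 + S ^ 2 * x ^ 2) := by
      have : |g x| ^ 2 ≤ (a + S * |x|) ^ 2 := pow_le_pow_left₀ (abs_nonneg _) (hb x) 2
      nlinarith [sq_nonneg (a - S * |x|), sq_abs x]
    have h2 : |psi V n l x| * |psi V n m x| ≤ (psi V n l x ^ 2 + psi V n m x ^ 2) / 2 := by
      nlinarith [sq_nonneg (|psi V n l x| - |psi V n m x|), sq_abs (psi V n l x),
        sq_abs (psi V n m x)]
    calc _ ≤ 2 * (a ^ 2 + S ^ 2 * x ^ 2) * ((psi V n l x ^ 2 + psi V n m x ^ 2) / 2) := by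
          gcongr
      _ = _ := by ring

theorem Admissible.integrable_mul_psi_mul_psi {l m : ℕ} (hl : l < n) (hm : m < n) {g : ℝ → ℝ}
    (hg : Measurable g) {a S : ℝ} (hb : ∀ x, |g x| ≤ a + S * |x|) :
    Integrable fun x => g x * (psi V n l x * psi V n m x) := by
  refine ((h.integrable_psi_mul_psi hl.le hm.le).norm.add
    (h.integrable_sq_mul_psi_mul_psi hl hm hg hb).norm).mono' ?_
    (Filter.Eventually.of_forall fun x => ?_)
  · exact (hg.mul ((h.measurable_psi l).mul (h.measurable_psi m))).aestronglyMeasurable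
  · simp only [Pi.add_apply, Real.norm_eq_abs, abs_mul (g x), abs_mul (g x ^ 2), abs_pow]
    rw [← one_add_mul]
    gcongr
    nlinarith [sq_nonneg (|g x| - 1)]

theorem Admissible.integral_sub_sq_mul_kern_sq (hn : 1 ≤ n) :
    Integrable (fun p : ℝ × ℝ =>
      (p.1 - p.2) ^ 2 * kern (fun j : Fin n => psi V n j) p.1 p.2 ^ 2) ∧
    ∫ p : ℝ × ℝ, (p.1 - p.2) ^ 2 * kern (fun j : Fin n => psi V n j) p.1 p.2 ^ 2 =
      2 * recR V n (n - 1) ^ 2 := by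
  obtain ⟨m, rfl⟩ : ∃ m, n = m + 1 := ⟨n - 1, by omega⟩
  rw [Nat.add_sub_cancel]
  set r := recR V (m + 1) m
  set f := psi V (m + 1) (m + 1)
  set g := psi V (m + 1) m
  have he : ∀ p : ℝ × ℝ,
      (p.1 - p.2) ^ 2 * kern (fun j : Fin (m + 1) => psi V (m + 1) j) p.1 p.2 ^ 2 =
      r ^ 2 * (((f p.1 * f p.1) * (g p.2 * g p.2) + (g p.1 * g p.1) * (f p.2 * f p.2)) -
        2 * ((f p.1 * g p.1) * (f p.2 * g p.2))) := fun p => by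
    rw [← mul_pow, kern, Fin.sum_univ_eq_sum_range
      (fun l => psi V (m + 1) l p.1 * psi V (m + 1) l p.2), h.christoffel_darboux (Nat.lt_succ_self m)]
    ring
  have iff := h.integrable_psi_mul_psi (le_refl (m + 1)) (le_refl (m + 1))
  have igg := h.integrable_psi_mul_psi (Nat.le_succ m) (Nat.le_succ m)
  have ifg := h.integrable_psi_mul_psi (le_refl (m + 1)) (Nat.le_succ m)
  have eff := h.integral_psi_mul_psi (le_refl (m + 1)) (le_refl (m + 1))
  have egg := h.integral_psi_mul_psi (Nat.le_succ m) (Nat.le_succ m)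
  have efg := h.integral_psi_mul_psi (le_refl (m + 1)) (Nat.le_succ m)
  rw [if_pos rfl] at eff egg
  rw [if_neg (by omega)] at efg
  have j1 := iff.mul_prod igg
  have j2 := igg.mul_prod iff
  have j3 := (ifg.mul_prod ifg).const_mul 2
  simp_rw [he]
  refine ⟨((j1.add j2).sub j3).const_mul _, ?_⟩
  have e : ∫ p : ℝ × ℝ, (((f p.1 * f p.1) * (g p.2 * g p.2) + (g p.1 * g p.1) * (f p.2 * f p.2)) -
        2 * ((f p.1 * g p.1) * (f p.2 * g p.2))) = 2 := by
    refine (integral_sub (j1.add j2) j3).trans ?_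
    refine (congrArg (· - _) (integral_add j1 j2)).trans ?_
    rw [integral_const_mul]
    refine (congrArg₂ (· - ·) (congrArg₂ (· + ·)
      (integral_prod_mul (fun t => f t * f t) fun t => g t * g t)
      (integral_prod_mul (fun t => g t * g t) fun t => f t * f t))
      (congrArg (2 * ·) (integral_prod_mul (fun t => f t * g t) fun t => f t * g t))).trans ?_
    rw [eff, egg, efg]
    norm_num
  rw [integral_const_mul, e, mul_comm]

theorem Admissible.slaterLaw_variance_le (hn : 1 ≤ n) {φ : ℝ → ℂ} {S : ℝ}
    (hS : ∀ x y, ‖φ x - φ y‖ ≤ S * |x - y|) :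
    MemLp (fun x => ∑ l, φ (x l)) 2 (slaterLaw fun j : Fin n => psi V n j) ∧
    complexVariance (fun x => ∑ l, φ (x l)) (slaterLaw fun j : Fin n => psi V n j) ≤
      recR V n (n - 1) ^ 2 * S ^ 2 := by
  have hφ : Measurable φ := by
    refine (LipschitzWith.of_dist_le_mul (K := S.toNNReal) fun x y => ?_).continuous.measurable
    rw [dist_eq_norm, Real.dist_eq]
    refine (hS x y).trans ?_
    gcongr
    exact Real.le_coe_toNNReal S
  have hb : ∀ x, ‖φ x‖ ≤ ‖φ 0‖ + S * |x| := fun x => by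
    have h1 := hS x 0
    rw [sub_zero] at h1
    have h2 := norm_sub_norm_le (φ x) (φ 0)
    linarith
  have hre := fun x => (Complex.abs_re_le_norm (φ x)).trans (hb x)
  have him := fun x => (Complex.abs_im_le_norm (φ x)).trans (hb x)
  have mre : Measurable fun x => (φ x).re := Complex.measurable_re.comp hφ
  have mim : Measurable fun x => (φ x).im := Complex.measurable_im.comp hφ
  obtain ⟨h1, h2, h3⟩ := slaterLaw_complexVariance (ψ := fun j : Fin n => psi V n j) (φ := φ)
    (fun i => h.measurable_psi i)
    (fun i j => h.integrable_psi_mul_psi i.2.le j.2.le)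
    (fun i j => by simpa [Fin.ext_iff] using h.integral_psi_mul_psi i.2.le j.2.le)
    (fun i j => h.integrable_mul_psi_mul_psi i.2 j.2 mre hre)
    (fun i j => h.integrable_sq_mul_psi_mul_psi i.2 j.2 mre hre)
    (fun i j => h.integrable_mul_psi_mul_psi i.2 j.2 mim him)
    (fun i j => h.integrable_sq_mul_psi_mul_psi i.2 j.2 mim him)
  obtain ⟨k1, k2⟩ := h.integral_sub_sq_mul_kern_sq hn
  refine ⟨h1, ?_⟩
  have hle := integral_mono h2 (k1.const_mul (S ^ 2)) fun p => by
    have : ‖φ p.1 - φ p.2‖ ^ 2 ≤ S ^ 2 * (p.1 - p.2) ^ 2 := by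
      rw [← sq_abs (p.1 - p.2), ← mul_pow]
      exact pow_le_pow_left₀ (norm_nonneg _) (hS _ _) 2
    calc _ ≤ S ^ 2 * (p.1 - p.2) ^ 2 * kern (fun j : Fin n => psi V n j) p.1 p.2 ^ 2 := by gcongr
      _ = _ := mul_assoc _ _ _
  rw [integral_const_mul, k2] at hle
  rw [h3]
  linarith

end

end MatrixModel
end

noncomputable section
namespace MatrixModel

/-! ### The law of the eigenvalues -/

theorem isSymm_nodeVals {n : ℕ} : IsSymm (nodeVals (n := n)) := fun σ x =>
  funext fun k => isSymm_prod (fun t => (k : ℝ) - t) σ x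

theorem measurable_sum_apply {n : ℕ} {β : Type*} [AddCommMonoid β] [MeasurableSpace β]
    [MeasurableAdd₂ β] {g : ℝ → β} (hg : Measurable g) :
    Measurable fun x : Fin n → ℝ => ∑ l, g (x l) :=
  Finset.measurable_sum _ fun l _ => hg.comp (measurable_pi_apply l)

/-- Two measures which agree on symmetric functions of the eigenvalues, resp. the points, have the
same image under ordering. -/
theorem map_sort_eq {n : ℕ} {P : Measure (HermMat n)} {Q : Measure (Fin n → ℝ)}
    (hPQ : ∀ f : (Fin n → ℝ) → ENNReal, IsSymm f → Measurable f →
      ∫⁻ M, f (eig M) ∂P = ∫⁻ x, f x ∂Q) :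
    P.map (fun M => sortOfVals n (nodeVals (eig M))) =
      Q.map fun x => sortOfVals n (nodeVals x) := by
  have hs : Measurable fun x => sortOfVals n (nodeVals x) :=
    (measurable_sortOfVals n).comp continuous_nodeVals.measurable
  have he : Measurable fun M : HermMat n => sortOfVals n (nodeVals (eig M)) :=
    (measurable_sortOfVals n).comp continuous_nodeVals_eig.measurable
  refine Measure.ext_of_lintegral _ fun f hf => ?_
  rw [lintegral_map hf hs, lintegral_map hf he]
  refine hPQ (fun x => f (sortOfVals n (nodeVals x))) (fun σ x => ?_) (hf.comp hs)
  simp only [isSymm_nodeVals σ x]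

theorem complexVariance_map {α β : Type*} [MeasurableSpace α] [MeasurableSpace β] {μ : Measure α}
    {T : α → β} (hT : Measurable T) {g : β → ℂ} (hg : Measurable g) :
    complexVariance g (μ.map T) = complexVariance (fun a => g (T a)) μ := by
  rw [complexVariance, complexVariance, integral_map hT.aemeasurable hg.aestronglyMeasurable,
    integral_map hT.aemeasurable]
  exact ((hg.sub_const _).norm.pow_const 2).aestronglyMeasurable

theorem memLp_and_complexVariance_comp_eig {n : ℕ} {P : Measure (HermMat n)}
    {Q : Measure (Fin n → ℝ)} (hPQ : ∀ f : (Fin n → ℝ) → ENNReal, IsSymm f → Measurable f →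
      ∫⁻ M, f (eig M) ∂P = ∫⁻ x, f x ∂Q) {g : (Fin n → ℝ) → ℂ} (hg : Measurable g) (hs : IsSymm g)
    (hL : MemLp g 2 Q) :
    MemLp (fun M => g (eig M)) 2 P ∧
      complexVariance (fun M => g (eig M)) P = complexVariance g Q := by
  have hm := map_sort_eq hPQ
  have h1 : Measurable fun x => sortOfVals n (nodeVals x) :=
    (measurable_sortOfVals n).comp continuous_nodeVals.measurable
  have h2 : Measurable fun M : HermMat n => sortOfVals n (nodeVals (eig M)) :=
    (measurable_sortOfVals n).comp continuous_nodeVals_eig.measurable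
  have e : ∀ x : Fin n → ℝ, g (sortOfVals n (nodeVals x)) = g x := fun x => by
    rw [sortOfVals_nodeVals, hs]
  have v1 := complexVariance_map (μ := Q) h1 hg
  have v2 := complexVariance_map (μ := P) h2 hg
  have l1 := memLp_map_measure_iff (p := 2) (μ := Q) hg.aestronglyMeasurable h1.aemeasurable
  have l2 := memLp_map_measure_iff (p := 2) (μ := P) hg.aestronglyMeasurable h2.aemeasurable
  simp only [Function.comp_def, e] at v1 v2 l1 l2
  exact ⟨l2.1 (hm ▸ l1.2 hL), by rw [← v2, hm, v1]⟩

section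
variable {V : ℝ → ℝ} {n : ℕ} (h : Admissible V n)
include h

theorem Admissible.exists_slater_sq_eq : ∃ κ : ℝ, 0 < κ ∧ ∀ x : Fin n → ℝ,
    slater (fun j : Fin n => psi V n j) x ^ 2 =
      κ * (Real.exp (-((n : ℝ) * ∑ l, V (x l))) * vdet x ^ 2) := by
  set s : Fin n → ℝ := fun j =>
    1 / Real.sqrt (weightInner V n (monicOrthoPoly V n j) (monicOrthoPoly V n j))
  refine ⟨(∏ j, s j) ^ 2, pow_pos (Finset.prod_pos fun j _ => h.orthoPoly_scale_pos j.2.le) 2,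
    fun x => ?_⟩
  have h1 : slater (fun j : Fin n => psi V n j) x =
      (∏ i, Real.exp (-((n : ℝ) * V (x i) / 2))) * ((∏ j, s j) * vdet x) := by
    rw [vdet, Matrix.det_eval_matrixOfPolynomials_eq_det_vandermonde x
      (fun j => monicOrthoPoly V n j) (fun j => natDegree_monicOrthoPoly V n j)
      (fun j => monicOrthoPoly_monic V n j), ← Matrix.det_mul_row, ← Matrix.det_mul_column, slater]
    congr 1
    ext i j
    simp [psi, orthoPoly, s]
  have h2 : (∏ i, Real.exp (-((n : ℝ) * V (x i) / 2))) ^ 2 =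
      Real.exp (-((n : ℝ) * ∑ l, V (x l))) := by
    rw [← Real.exp_sum, ← Real.exp_nat_mul, Finset.mul_sum, Finset.mul_sum, ← Finset.sum_neg_distrib]
    congr 1
    exact Finset.sum_congr rfl fun i _ => by push_cast; ring
  rw [h1, mul_pow, mul_pow, h2]
  ring

theorem Admissible.isProbabilityMeasure_slaterLaw_psi :
    IsProbabilityMeasure (slaterLaw fun j : Fin n => psi V n j) :=
  isProbabilityMeasure_slaterLaw (fun i j => h.integrable_psi_mul_psi i.2.le j.2.le)
    fun i j => by simpa [Fin.ext_iff] using h.integral_psi_mul_psi i.2.le j.2.le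

theorem Admissible.exists_lintegral_hermVolume : ∃ D : ENNReal, D ≠ 0 ∧ D ≠ ⊤ ∧
    ∀ f : (Fin n → ℝ) → ENNReal, IsSymm f → Measurable f →
      ∫⁻ M, ENNReal.ofReal (Real.exp (-((n : ℝ) * traceFun V M))) * f (eig M) ∂hermVolume n =
        D * ∫⁻ x, f x ∂slaterLaw fun j : Fin n => psi V n j := by
  obtain ⟨c, hc0, hc, hW⟩ := exists_weyl_integration n
  obtain ⟨κ, hκ, hs⟩ := h.exists_slater_sq_eq
  refine ⟨c * ENNReal.ofReal (n.factorial / κ),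
    mul_ne_zero hc0 (ENNReal.ofReal_pos.2 (by positivity)).ne', by finiteness, fun f hf hfm => ?_⟩
  set g : (Fin n → ℝ) → ENNReal := fun x =>
    ENNReal.ofReal (Real.exp (-((n : ℝ) * ∑ l, V (x l)))) with hg
  have hgs : IsSymm g := fun σ x => by simp only [hg, isSymm_sum V σ x]
  have hgm : Measurable g := by
    have := measurable_sum_apply (n := n) h.measurable
    fun_prop
  have hd := measurable_slaterDensity (ψ := fun j : Fin n => psi V n j) fun j => h.measurable_psi j
  have h1 := hW (fun x => g x * f x) (fun σ x => by simp only [hgs σ x, hf σ x]) (hgm.mul hfm)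
  rw [slaterLaw, lintegral_withDensity_eq_lintegral_mul _ hd hfm, mul_assoc,
    ← lintegral_const_mul _ (hd.mul hfm)]
  refine h1.trans ?_
  congr 1
  refine lintegral_congr fun x => ?_
  simp only [Pi.mul_apply, hg]
  rw [mul_right_comm, ← ENNReal.ofReal_mul (Real.exp_nonneg _), ← mul_assoc,
    ← ENNReal.ofReal_mul (by positivity), hs]
  congr 2
  field_simp

theorem Admissible.lintegral_hermVolume_exp {D : ENNReal} (hD : ∀ f : (Fin n → ℝ) → ENNReal,
    IsSymm f → Measurable f →
      ∫⁻ M, ENNReal.ofReal (Real.exp (-((n : ℝ) * traceFun V M))) * f (eig M) ∂hermVolume n =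
        D * ∫⁻ x, f x ∂slaterLaw fun j : Fin n => psi V n j) :
    ∫⁻ M, ENNReal.ofReal (Real.exp (-((n : ℝ) * traceFun V M))) ∂hermVolume n = D := by
  have := h.isProbabilityMeasure_slaterLaw_psi
  simpa using hD (fun _ => 1) (fun _ _ => rfl) measurable_const

theorem Admissible.matrixLaw_spec : IsProbabilityMeasure (matrixLaw V n) ∧
    ∀ f : (Fin n → ℝ) → ENNReal, IsSymm f → Measurable f →
      ∫⁻ M, f (eig M) ∂matrixLaw V n = ∫⁻ x, f x ∂slaterLaw fun j : Fin n => psi V n j := by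
  obtain ⟨D, hD0, hD, hf⟩ := h.exists_lintegral_hermVolume
  have h1 := h.lintegral_hermVolume_exp hf
  have hm : Measurable fun M : HermMat n => Real.exp (-((n : ℝ) * traceFun V M)) := by
    have : Measurable fun M : HermMat n => traceFun V M :=
      (isSymm_sum V).measurable_comp_eig (measurable_sum_apply h.measurable)
    fun_prop
  have hpos : ∀ᵐ M ∂hermVolume n, 0 ≤ Real.exp (-((n : ℝ) * traceFun V M)) :=
    Filter.Eventually.of_forall fun M => Real.exp_nonneg _
  have hi : Integrable (fun M : HermMat n => Real.exp (-((n : ℝ) * traceFun V M))) (hermVolume n) := by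
    refine ⟨hm.aestronglyMeasurable, ?_⟩
    rw [hasFiniteIntegral_iff_ofReal hpos, h1]
    exact hD.lt_top
  have hI : ENNReal.ofReal (∫ M, Real.exp (-((n : ℝ) * traceFun V M)) ∂hermVolume n) = D := by
    rw [ofReal_integral_eq_lintegral_ofReal hi hpos, h1]
  have hne : NeZero (hermVolume n) := ⟨fun h0 => hD0 (by rw [← h1, h0, lintegral_zero_measure])⟩
  refine ⟨isProbabilityMeasure_tilted hi, fun f hs hfm => ?_⟩
  rw [matrixLaw, lintegral_tilted]
  simp_rw [ENNReal.ofReal_div_of_pos (integral_exp_pos hi), hI, ENNReal.div_eq_inv_mul, mul_assoc]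
  rw [lintegral_const_mul _ (by exact hm.ennreal_ofReal.mul (hs.measurable_comp_eig hfm)), hf f hs hfm,
    ← mul_assoc, ENNReal.inv_mul_cancel hD0 hD, one_mul]

theorem Admissible.linearStatistic_variance_le (hn : 1 ≤ n) {φ : ℝ → ℂ} (hφ : ContDiff ℝ 1 φ)
    (hb : BddAbove (Set.range fun x => ‖deriv φ x‖)) :
    MemLp (linearStatistic φ) 2 (matrixLaw V n) ∧
      complexVariance (linearStatistic φ) (matrixLaw V n) ≤
        recR V n (n - 1) ^ 2 * (⨆ x, ‖deriv φ x‖) ^ 2 := by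
  have hS : ∀ x y, ‖φ x - φ y‖ ≤ (⨆ x, ‖deriv φ x‖) * |x - y| := fun x y =>
    convex_univ.norm_image_sub_le_of_norm_deriv_le
      (fun z _ => (hφ.differentiable (by simp)).differentiableAt) (fun z _ => le_ciSup hb z)
      (Set.mem_univ y) (Set.mem_univ x)
  obtain ⟨h1, h2⟩ := h.slaterLaw_variance_le hn hS
  obtain ⟨h3, h4⟩ := memLp_and_complexVariance_comp_eig h.matrixLaw_spec.2
    (measurable_sum_apply hφ.continuous.measurable) (isSymm_sum φ) h1
  exact ⟨h3, h4.trans_le h2⟩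

end

end MatrixModel
end

theorem mainTheorem6 (V : ℝ → ℝ) (hVmeas : Measurable V) (hVnonneg : ∀ x, 0 ≤ V x)
    (δ L : ℝ) (hδ : 0 < δ) (hL : 0 < L)
    (hgrowth : ∀ x : ℝ, L < |x| → (2 + δ) * Real.log |x| ≤ V x)
    (hlip : ∀ R : ℝ, 0 < R → ∃ A γ : ℝ, 0 < A ∧ 0 < γ ∧
      ∀ x y : ℝ, |x| ≤ R → |y| ≤ R → |V x - V y| ≤ A * |x - y| ^ γ) :
    (∀ n : ℕ, 1 < (n : ℝ) * δ →
      Integrable fun x : ℝ => x ^ (2 * n) * MatrixModel.weight V n x) ∧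
    ∃ K : ℝ, ∀ n : ℕ, 1 ≤ n →
      (Integrable fun x : ℝ => x ^ (2 * n) * MatrixModel.weight V n x) →
      IsProbabilityMeasure (MatrixModel.matrixLaw V n) ∧
      MatrixModel.OrthonormalUpTo V n ∧
      MatrixModel.ThreeTermUpTo V n ∧
      MatrixModel.recR V n (n - 1) ^ 2 ≤ K ∧
      ∀ φ : ℝ → ℂ, ContDiff ℝ 1 φ → BddAbove (Set.range fun x => ‖deriv φ x‖) →
        MemLp (MatrixModel.linearStatistic φ) 2 (MatrixModel.matrixLaw V n) ∧
        MatrixModel.complexVariance (MatrixModel.linearStatistic φ) (MatrixModel.matrixLaw V n) ≤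
          MatrixModel.recR V n (n - 1) ^ 2 * (⨆ x, ‖deriv φ x‖) ^ 2 ∧
        MatrixModel.complexVariance (MatrixModel.linearStatistic φ) (MatrixModel.matrixLaw V n) ≤
          K * (⨆ x, ‖deriv φ x‖) ^ 2 := by
  refine ⟨fun n hn => MatrixModel.integrable_pow_mul_weight hVmeas hVnonneg hgrowth hn, ?_⟩
  obtain ⟨B, hB⟩ := MatrixModel.exists_bound_of_holder hlip
  obtain ⟨K, hK⟩ := MatrixModel.exists_recR_sq_le hδ hgrowth hB
  refine ⟨K, fun n hn hint => ?_⟩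
  have h : MatrixModel.Admissible V n := ⟨hVmeas, hVnonneg, hint⟩
  refine ⟨h.matrixLaw_spec.1, h.orthonormalUpTo, h.threeTermUpTo, hK n hn h, fun φ hφ hb => ?_⟩
  obtain ⟨h1, h2⟩ := h.linearStatistic_variance_le hn hφ hb
  exact ⟨h1, h2, h2.trans (mul_le_mul_of_nonneg_right (hK n hn h) (sq_nonneg _))⟩
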